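/- **Setting.** Let $\mathcal X$ and $\mathcal Y$ be standard Borel spaces, with a distinguished "silence" symbol $0\in\mathcal X$, and let $1\le K<\infty$. A random access channel (RAC) is a family of memoryless channels $P_{Y_k|X_{[k]}}$ from $\mathcal X^k$ to $\mathcal Y$, $k=0,\dots,K$, where $[k]=\{1,\dots,k\}$. Assume that it is permutation-invariant ($P_{Y_k|X_{[k]}=x}$ does not change when the coordinates of $x$ are permuted) and reducible ($P_{Y_s|X_{[s]}=x}=P_{Y_k|X_{[k]}=(x,0^{k-s})}$ for $0\le s<k\le K$). The output symbols are read as real numbers through a fixed measurable map $\mathcal Y\to\mathbb R$ (the inclusion if $\mathcal Y\subseteq\mathbb R$). Fix a probability distribution $P_X$ on $\mathcal X$, let $X_1,X_2,\dots$ be i.i.d. with law $P_X$, let $Y_k$ be the output of the $k$-th channel for the input $X_{[k]}$, and let $F_k$ be the distribution function of $Y_k$. For $1\le s\le t\le K$ let $\imath_t(x_{[s]};y)=\log\frac{P_{Y_t|X_{[s]}}(y|x_{[s]})}{P_{Y_t}(y)}$ be the information density, the densities being taken with respect to a common measure dominating all $P_{Y_j}$, $0\le j\le K$, with value $-\infty$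 where the numerator vanishes. Put $I_k=\mathbb E[\imath_k(X_{[k]};Y_k)]$ and $V_k=\mathrm{Var}[\imath_k(X_{[k]};Y_k)]$. Assume that, for all $1\le k\le K$: * (friendliness) $I(X_{[s]};Y_k\,|\,X_{[s+1:k]}=0^{k-s})\ge I(X_{[s]};Y_k\,|\,X_{[s+1:k]})$ for all $1\le s\le k$; * (interference) for all $1\le s<t\le k$, $X_{[s]}$ and $X_{[s+1:t]}$ are not conditionally independent given $Y_k$; * (Kolmogorov–Smirnov separation) there is $\delta_0>0$, not depending on $k$, with $\sup_{x\in\mathbb R}|F_k(x)-F_0(x)|\ge\delta_0$; * (moments) the law of $(X_{[k]},Y_k)$ is absolutely continuous with respect to the product of its marginals, $V_k>0$, $\mathbb E|\imath_k(X_{[k]};Y_k)-I_k|^3<\infty$, and, for all $1\le s\le t\le k$ such that $\imath_t(X_{[s]};Y_k)>-\infty$ almost surely, $\mathrm{Var}[\imath_t(X_{[s]};Y_k)]<\infty$. **Codes.** An $(M,\{(n_k,\epsilon_k)\}_{k=0}^K)$ rateless RAC code consists of decoding times $n_0<n_1<\dots<n_K$, a random variable $U$ with values in a set $\mathcal U$,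 $|\mathcal U|\le K+1$, known to the transmitters and the receiver, one encoder $\mathsf f:\mathcal U\times[M]\to\mathcal X^{n_K}$ used by every transmitter, and (measurable) decoders $\mathsf g_k:\mathcal U\times\mathcal Y^{n_k}\to[M]^k\cup\{\mathsf e\}$, $0\le k\le K$, such that for every $0\le k\le K$, if $k$ transmitters send the first $n_k$ letters of the codewords of independent uniform messages $W_1,\dots,W_k$ (independent of $U$), then the probability that $\mathsf g_k(U,Y_k^{n_k})$ is not a permutation of $(W_1,\dots,W_k)$ or that $\mathsf g_t(U,Y_k^{n_t})\ne\mathsf e$ for some $t<k$ is at most $\epsilon_k$. The decoder is *single-threshold* if there are $\gamma_1,\dots,\gamma_K>0$ such that for each $1\le k\le K$, $\mathsf g_k(u,y^{n_k})$ is always some $w_1<\dots<w_k$ with $\sum_{i=1}^{n_k}\imath_k\big(\mathsf f(u,w_1)_i,\dots,\mathsf f(u,w_k)_i;y_i\big)>\log\gamma_k$ if such a vector exists, and $\mathsf e$ otherwise. **Theorem (Achievability).** There is a constant $C>0$ (depending only on the channel and $P_X$) such that for all $\epsilon_0,\dots,\epsilon_K\in(0,1)$ there are constants $A$, $B$, $M_0$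 and a function $r(m)=o(\log m)$ such that for every $M\ge M_0$: 1. If $n_0<n_1<\dots<n_K$ satisfy $$\log M\le\frac1k\Big\{n_kI_k-\sqrt{n_kV_k}\,Q^{-1}(\epsilon_k)-\tfrac12\log n_k-A\Big\}\quad(1\le k\le K),\qquad n_0\ge C\log n_1+r(n_1),$$ then there exists an $(M,\{(n_k,\epsilon_k)\}_{k=0}^K)$ rateless RAC code with a single-threshold decoder. Here $Q(x)=\frac1{\sqrt{2\pi}}\int_x^\infty e^{-u^2/2}\,du$. 2. The first- and second-order terms are attained for all $k$ simultaneously: there are $n_0<n_1<\dots<n_K$ that satisfy the conditions in 1, with $n_0=\lceil C\log n_1+r(n_1)\rceil^+$ (where $\lceil x\rceil^+=\max(\lceil x\rceil,0)$), and also $\log M\ge\frac1k\{n_kI_k-\sqrt{n_kV_k}\,Q^{-1}(\epsilon_k)-\frac12\log n_k-B\}$ for all $1\le k\le K$. -/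

import Mathlib

open MeasureTheory ProbabilityTheory
open scoped ENNReal

noncomputable section

/-- A memoryless random access channel with input alphabet `X`, silence symbol `0 : X` and outputs in
`Y`: `W k` is the conditional law `P_{Y_k | X_[k]}` of one output letter when
`k` transmitters are active.  Every notion below takes the maximal number `K` of transmitters as a
parameter and uses `W k` for `k ≤ K` only. -/
structure RAC (X Y : Type*) [MeasurableSpace X] [MeasurableSpace Y] where
  W : (k : ℕ) → Kernel (Fin k → X) Y
  markov : ∀ k, IsMarkovKernel (W k)

attribute [instance] RAC.markov

/-- `splice x z` is the vector `z` with its first `s` coordinates overwritten by those of `x`. -/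
def splice {X : Type*} {s t : ℕ} (x : Fin s → X) (z : Fin t → X) : Fin t → X :=
  fun i => if h : i.1 < s then x ⟨i.1, h⟩ else z i

/-- `mixHead s z x` has its first `s` coordinates from `z` and the remaining ones from `x`. -/
def mixHead {X : Type*} {t : ℕ} (s : ℕ) (z x : Fin t → X) : Fin t → X :=
  fun i => if i.1 < s then z i else x i

theorem measurable_splice {X : Type*} [MeasurableSpace X] {s t : ℕ} :
    Measurable (fun p : (Fin s → X) × (Fin t → X) => splice p.1 p.2) := by
  refine measurable_pi_lambda _ fun i => ?_
  by_cases h : i.1 < s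
  · simp only [splice, h, dite_true]; fun_prop
  · simp only [splice, h, dite_false]; fun_prop

theorem measurable_mixHead {X : Type*} [MeasurableSpace X] {t : ℕ} (s : ℕ) :
    Measurable (fun p : (Fin t → X) × (Fin t → X) => mixHead s p.2 p.1) := by
  refine measurable_pi_lambda _ fun i => ?_
  by_cases h : i.1 < s
  · simp only [mixHead, h, if_true]; fun_prop
  · simp only [mixHead, h, if_false]; fun_prop

/-- The law `P_X^t` of `t` independent inputs. -/
def inputLaw {X : Type*} [MeasurableSpace X] (P : Measure X) (t : ℕ) : Measure (Fin t → X) :=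
  Measure.pi fun _ => P

instance {X : Type*} [MeasurableSpace X] (P : Measure X) [IsProbabilityMeasure P] (t : ℕ) :
    IsProbabilityMeasure (inputLaw P t) := by
  unfold inputLaw; infer_instance

/-- Mutual information of the input law `p` and the channel `κ`: the divergence of the joint law from
the product of its marginals. -/
def mutualInfo {A Y : Type*} [MeasurableSpace A] [MeasurableSpace Y] (p : Measure A)
    (κ : Kernel A Y) : ℝ≥0∞ :=
  InformationTheory.klDiv (p ⊗ₘ κ) (p.prod (κ ∘ₘ p))

namespace RAC

variable {X Y : Type*} [MeasurableSpace X] [MeasurableSpace Y]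

def PermutationInvariant (R : RAC X Y) (K : ℕ) : Prop :=
  ∀ k ≤ K, ∀ (σ : Equiv.Perm (Fin k)) (x : Fin k → X), R.W k (x ∘ σ) = R.W k x

def Reducible [Zero X] (R : RAC X Y) (K : ℕ) : Prop :=
  ∀ k ≤ K, ∀ s < k, ∀ x : Fin s → X, R.W s x = R.W k (splice x 0)

/-- `P_{Y_k}` for i.i.d. inputs of law `P`. -/
def outLaw (R : RAC X Y) (P : Measure X) (k : ℕ) : Measure Y :=
  R.W k ∘ₘ inputLaw P k

/-- `P_{Y_t | X_[s]}` (for `s ≤ t`): the remaining `t - s` inputs are i.i.d. of law `P`. -/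
def outGivenHead (R : RAC X Y) (P : Measure X) (s t : ℕ) : Kernel (Fin s → X) Y :=
  R.W t ∘ₖ ((Kernel.id ×ₖ Kernel.const _ (inputLaw P t)).map fun p => splice p.1 p.2)

/-- `P_{Y_k | X_[s+1:k]}`, as a kernel from all `k` inputs that ignores the first `s` of them. -/
def outGivenTail (R : RAC X Y) (P : Measure X) (s k : ℕ) : Kernel (Fin k → X) Y :=
  R.W k ∘ₖ ((Kernel.id ×ₖ Kernel.const _ (inputLaw P k)).map fun p => mixHead s p.2 p.1)

/-- `P_{Y_k | X_[s], X_[s+1:k] = 0}`. -/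
def outSilentTail [Zero X] (R : RAC X Y) (s k : ℕ) : Kernel (Fin s → X) Y :=
  (R.W k).comap (fun x => splice x 0) (measurable_splice.comp (measurable_id.prodMk measurable_const))

/-- The joint law of `(X_[s], Y_k)`, `s ≤ k`. -/
def headLaw (R : RAC X Y) (P : Measure X) (s k : ℕ) : Measure ((Fin s → X) × Y) :=
  inputLaw P s ⊗ₘ R.outGivenHead P s k

/-- Friendliness: `I_k(X_[s]; Y_k | X_[s+1:k] = 0) ≥ I_k(X_[s]; Y_k | X_[s+1:k])`, where the right
side is the divergence of `P_{X_[k]} P_{Y_k | X_[k]}` from `P_{X_[k]} P_{Y_k | X_[s+1:k]}`. -/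
def Friendly [Zero X] (R : RAC X Y) (P : Measure X) (K : ℕ) : Prop :=
  ∀ k ≤ K, ∀ s, 1 ≤ s → s ≤ k →
    InformationTheory.klDiv (inputLaw P k ⊗ₘ R.W k) (inputLaw P k ⊗ₘ R.outGivenTail P s k)
      ≤ mutualInfo (inputLaw P s) (R.outSilentTail s k)

/-- Interference: for `1 ≤ s < t ≤ k`, the inputs `X_[s]` and `X_[s+1:t]` are not conditionally
independent given `Y_k`. -/
def Interfering [StandardBorelSpace X] [StandardBorelSpace Y] (R : RAC X Y)
    (P : Measure X) [IsProbabilityMeasure P] (K : ℕ) : Prop :=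
  ∀ k ≤ K, ∀ s t, 1 ≤ s → s < t → t ≤ k →
    ¬ CondIndepFun (MeasurableSpace.comap (Prod.snd : (Fin k → X) × Y → Y) inferInstance)
      measurable_snd.comap_le
      (fun ω (i : {i : Fin k // i.1 < s}) => ω.1 i.1)
      (fun ω (i : {i : Fin k // s ≤ i.1 ∧ i.1 < t}) => ω.1 i.1)
      (inputLaw P k ⊗ₘ R.W k)

/-- Distribution function of `P_{Y_k}`, the outputs being read as real numbers through `φ`. -/
def outCDF (R : RAC X Y) (P : Measure X) (φ : Y → ℝ) (k : ℕ) (x : ℝ) : ℝ :=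
  (R.outLaw P k).real {y | φ y ≤ x}

/-- Kolmogorov–Smirnov separation of `P_{Y_0}` from `P_{Y_1}, …, P_{Y_K}`. -/
def KSSeparated (R : RAC X Y) (P : Measure X) (φ : Y → ℝ) (K : ℕ) : Prop :=
  ∃ δ₀ > 0, ∀ k, 1 ≤ k → k ≤ K → δ₀ ≤ ⨆ x : ℝ, |R.outCDF P φ k x - R.outCDF P φ 0 x|

/-- The reference measure `∑_{j ≤ K} P_{Y_j}`, with respect to which densities are taken. -/
def refLaw (R : RAC X Y) (P : Measure X) (K : ℕ) : Measure Y :=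
  ∑ j ∈ Finset.range (K + 1), R.outLaw P j

/-- The information density `ı_t(x_[s]; y) = log (P_{Y_t | X_[s]}(y | x_[s]) / P_{Y_t}(y))`, both
densities being taken with respect to the common reference measure, so that it may be evaluated at
outputs of every channel of the family.  It is `-∞` where `P_{Y_t | X_[s]}(y | x_[s]) = 0`. -/
def infoDensity [StandardBorelSpace Y] (R : RAC X Y) (P : Measure X) (K s t : ℕ)
    (x : Fin s → X) (y : Y) : EReal :=
  ENNReal.log (Kernel.rnDeriv (R.outGivenHead P s t) (Kernel.const _ (R.refLaw P K)) x y /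
    (R.outLaw P t).rnDeriv (R.refLaw P K) y)

/-- `ı_k(x_[k]; y)` as a real-valued function on input-output pairs. -/
def sumDensity [StandardBorelSpace Y] (R : RAC X Y) (P : Measure X) (K k : ℕ)
    (p : (Fin k → X) × Y) : ℝ :=
  (R.infoDensity P K k k p.1 p.2).toReal

/-- `I_k = E[ı_k(X_[k]; Y_k)]`. -/
def I [StandardBorelSpace Y] (R : RAC X Y) (P : Measure X) (K k : ℕ) : ℝ :=
  ∫ p, R.sumDensity P K k p ∂(inputLaw P k ⊗ₘ R.W k)

/-- `V_k = Var[ı_k(X_[k]; Y_k)]`. -/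
def V [StandardBorelSpace Y] (R : RAC X Y) (P : Measure X) (K k : ℕ) : ℝ :=
  variance (R.sumDensity P K k) (inputLaw P k ⊗ₘ R.W k)

/-- The moment assumptions.  The absolute continuity says that `ı_k(X_[k]; Y_k)` exists. -/
structure MomentConditions [StandardBorelSpace Y] (R : RAC X Y) (P : Measure X) (K : ℕ) : Prop where
  abs_cont : ∀ k, 1 ≤ k → k ≤ K →
    (inputLaw P k ⊗ₘ R.W k) ≪ (inputLaw P k).prod (R.outLaw P k)
  var_pos : ∀ k, 1 ≤ k → k ≤ K → 0 < R.V P K k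
  third_moment : ∀ k, 1 ≤ k → k ≤ K →
    Integrable (fun p => |R.sumDensity P K k p - R.I P K k| ^ 3) (inputLaw P k ⊗ₘ R.W k)
  var_finite : ∀ s t k, 1 ≤ s → s ≤ t → t ≤ k → k ≤ K →
    (∀ᵐ p ∂(R.headLaw P s k), R.infoDensity P K s t p.1 p.2 ≠ ⊥) →
    MemLp (fun p => (R.infoDensity P K s t p.1 p.2).toReal) 2 (R.headLaw P s k)

end RAC

/-- A rateless code with `M` messages and decoding times `n 0 < ⋯ < n K`: common randomness in a set
`U` of at most `K + 1` elements, one encoder used by all transmitters, and one decoder per decoding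
time; the output `none` is the erasure symbol. -/
structure RACCode (X Y : Type*) [MeasurableSpace Y] (K M : ℕ) (n : ℕ → ℕ) where
  U : Type
  [fintypeU : Fintype U]
  card_le : Fintype.card U ≤ K + 1
  pU : PMF U
  n_mono : StrictMonoOn n (Set.Iic K)
  enc : U → Fin M → (Fin (n K) → X)
  dec : (k : ℕ) → U → (Fin (n k) → Y) → Option (Fin k → Fin M)
  dec_meas : ∀ k ≤ K, ∀ u v, MeasurableSet (dec k u ⁻¹' {v})

attribute [instance] RACCode.fintypeU

namespace RACCode

variable {X Y : Type*} [MeasurableSpace Y] {K M : ℕ} {n : ℕ → ℕ}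

theorem n_le (c : RACCode X Y K M n) {s t : ℕ} (hst : s ≤ t) (ht : t ≤ K) : n s ≤ n t :=
  c.n_mono.monotoneOn (hst.trans ht) ht hst

/-- Letter `i` of the codewords of the messages `w`, as an input of the `k`-transmitter channel. -/
def input (c : RACCode X Y K M n) {k : ℕ} (hk : k ≤ K) (u : c.U) (w : Fin k → Fin M)
    (i : Fin (n k)) : Fin k → X :=
  fun j => c.enc u (w j) (Fin.castLE (c.n_le hk le_rfl) i)

variable [MeasurableSpace X]

/-- Law of `Y_k^{n_k}` given `U = u` and `W_[k] = w`. -/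
def output (c : RACCode X Y K M n) (R : RAC X Y) {k : ℕ} (hk : k ≤ K) (u : c.U)
    (w : Fin k → Fin M) : Measure (Fin (n k) → Y) :=
  Measure.pi fun i => R.W k (c.input hk u w i)

/-- The decoder at time `n k` does not return `w` up to a permutation, or an earlier decoder returns
something other than an erasure. -/
def errorEvent (c : RACCode X Y K M n) {k : ℕ} (hk : k ≤ K) (u : c.U) (w : Fin k → Fin M) :
    Set (Fin (n k) → Y) :=
  {y | (¬ ∃ σ : Equiv.Perm (Fin k), c.dec k u y = some (w ∘ σ)) ∨
    ∃ (t : ℕ) (ht : t < k), c.dec t u (fun i => y (Fin.castLE (c.n_le ht.le hk) i)) ≠ none}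

/-- Average error probability when `k` transmitters are active. -/
def errorProb (c : RACCode X Y K M n) (R : RAC X Y) {k : ℕ} (hk : k ≤ K) : ℝ :=
  (1 / (M : ℝ) ^ k) * ∑ w : Fin k → Fin M, ∑ u : c.U,
    (c.pU u).toReal * (c.output R hk u w).real (c.errorEvent hk u w)

/-- `c` is an `(M, {(n_k, ε_k)}_{k=0}^K)` code for the channel `R`. -/
def Achieves (c : RACCode X Y K M n) (R : RAC X Y) (ε : ℕ → ℝ) : Prop :=
  ∀ (k : ℕ) (hk : k ≤ K), c.errorProb R hk ≤ ε k

/-- Single-threshold decoding: for `1 ≤ k ≤ K`, the decoder at time `n k` returns some message vector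
`w_1 < ⋯ < w_k` with `ı_k(f(w)^{n_k}; y^{n_k}) > log γ_k`, and erases iff there is none. -/
def IsSingleThreshold [StandardBorelSpace Y] (c : RACCode X Y K M n) (R : RAC X Y)
    (P : Measure X) : Prop :=
  ∃ γ : ℕ → ℝ, ∀ (k : ℕ) (hk : k ≤ K), 1 ≤ k → 0 < γ k ∧
    ∀ (u : c.U) (y : Fin (n k) → Y),
      let Good : (Fin k → Fin M) → Prop := fun w => StrictMono w ∧
        ((Real.log (γ k) : ℝ) : EReal) < ∑ i, R.infoDensity P K k k (c.input hk u w i) (y i)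
      (∀ w, c.dec k u y = some w → Good w) ∧ (c.dec k u y = none → ∀ w, ¬ Good w)

end RACCode

/-- The Gaussian complementary distribution function. -/
def gaussianQ (x : ℝ) : ℝ :=
  1 / Real.sqrt (2 * Real.pi) * ∫ u in Set.Ioi x, Real.exp (-u ^ 2 / 2)

/-- The inverse of `gaussianQ` on `(0, 1)`. -/
def gaussianQInv : ℝ → ℝ := Function.invFun gaussianQ

/-- `n I_k - √(n V_k) Q⁻¹(ε) - (1/2) log n`. -/
def secondOrder {X Y : Type*} [MeasurableSpace X] [MeasurableSpace Y] [StandardBorelSpace Y]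
    (R : RAC X Y) (P : Measure X) (K k n : ℕ) (ε : ℝ) : ℝ :=
  n * R.I P K k - Real.sqrt (n * R.V P K k) * gaussianQInv ε - 1 / 2 * Real.log n

end

/-!
Random coding, with a threshold test of the information density at each decoding time.

*Decoder.*  At time `n_0` the receiver decides whether anybody transmits, by comparing empirical
distribution functions; since `P_{Y_0}` is separated from the other output laws, the error
probabilities are exponentially small in `n_0` (`exists_separating_test`), hence `O(n_1^(-1/2))` if `n_0`
is a suitable multiple of `log n_1`.  At time `n_k` it looks for `w_1 < ⋯ < w_k` whose information
density exceeds a threshold `b_k`.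

*Errors.*  If `k` transmitters are active, then apart from a repeated message the decoder fails only if
activity is missed, if the density of the transmitted messages stays below `b_k`, or if at some time
`n_t`, `t ≤ k`, other messages `w'` pass the test, exactly `s < k` of which are transmitted ones
(`RAC.measure_errorSet_le`).  For the last event, first bound the density of the `s` shared messages
alone: it exceeds `exp (n_t c)` with probability `O(n_t^(-1/2))` only, for some `c < (s / t) I_t`
(`RAC.exists_headDens_tail_bound`).  Given that it does not, each `w'` passes the test with probability
at most `exp (n_t c - b_t)` (`RAC.exists_shared_bound`), and there are `O(M ^ (t - s))` of them.  Since
`b_t ≥ t log M + (1/2) log n_t` and `b_t ≥ n_t I_t - O(n_t^(1/2))`, the union bound is `O(n_t^(-1/2))`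
(`count_mul_exp_le`).

*Rates.*  That `c` exists is the place where the assumptions on the channel enter.  The information
`I_k(X_[s]; Y_k)` is convex in `s` by submodularity, with strict inequality at the first step by
interference, since equality means conditional independence
(`integral_log_margDensity_submodular`, `condIndepFun_of_margDensity_mul`, `RAC.mul_info_lt`).
Friendliness bounds `I_k - I_k(X_[k-t]; Y_k)` by `I_t`, and both together give
`I_k(X_[s]; Y_k) < (s / t) I_t` and `I_k / k < I_t / t` for `t < k` (`RAC.mul_I_lt`).  The mean of the
density of the shared messages is at most `I_k(X_[s]; Y_k)`, by Gibbs' inequality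
(`RAC.integral_log_headDens_le`).

*Second order.*  All errors but a miss of the transmitted messages add up to `O((log M)^(-1/2))`, with
a constant that does not depend on the thresholds.  If `n_k` is of order `log M`, the Berry–Esseen
theorem `berry_esseen` gives a threshold within `O(1)` of
`n_k I_k - (n_k V_k)^(1/2) Q⁻¹(ε_k)` that is missed with probability at most
`ε_k - O((log M)^(-1/2))`; if `n_k` is much larger, a Chebyshev bound suffices (`exists_threshold`).
Berry–Esseen is proved by exchanging the summands with Gaussian ones after a Gaussian smoothing, and by
induction on the number of summands (`exists_ksDist_le`).

*One code.*  The averages over codebooks are bounds for `K` error probabilities at once, and by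
Carathéodory's theorem they are attained by a mixture of `K + 1` codebooks, which the common randomness
chooses from (`RAC.exists_code`).  The bound for `k = 0` holds for every codebook.

For the second part, take the least decoding times that satisfy the conditions.  They are
`(1 + o(1)) k log M / I_k`, hence increasing in `k` for large `M` (`RAC.exists_lengths`).
-/

set_option linter.unusedSectionVars false

/-! ### The Gaussian distribution function -/

noncomputable section

/-- The standard Gaussian density. -/
def stdPhi (x : ℝ) : ℝ := (Real.sqrt (2 * Real.pi))⁻¹ * Real.exp (-x ^ 2 / 2)

/-- The standard Gaussian distribution function. -/
def stdCDF (x : ℝ) : ℝ := (gaussianReal 0 1).real (Set.Iic x)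

theorem stdPhi_eq_gaussianPDFReal : stdPhi = gaussianPDFReal 0 1 := by
  funext x; simp [stdPhi, gaussianPDFReal]

theorem stdPhi_pos (x : ℝ) : 0 < stdPhi x := by unfold stdPhi; positivity

theorem sqrt_two_pi_inv_le : (Real.sqrt (2 * Real.pi))⁻¹ ≤ 1 / 2 := by
  have h : (2 : ℝ) ≤ Real.sqrt (2 * Real.pi) := by
    apply Real.le_sqrt_of_sq_le; nlinarith [Real.pi_gt_three]
  rw [inv_eq_one_div]
  exact one_div_le_one_div_of_le (by norm_num) h

theorem add_one_mul_stdPhi_le (x : ℝ) : (1 + x ^ 2 / 2) * stdPhi x ≤ 1 / 2 := by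
  have h1 : 1 + x ^ 2 / 2 ≤ Real.exp (x ^ 2 / 2) := by
    linarith [Real.add_one_le_exp (x ^ 2 / 2)]
  have h2 : Real.exp (x ^ 2 / 2) * Real.exp (-x ^ 2 / 2) = 1 := by
    rw [← Real.exp_add]; simp [neg_div]
  have h3 := sqrt_two_pi_inv_le
  have h4 : 0 ≤ (Real.sqrt (2 * Real.pi))⁻¹ := by positivity
  have h5 := Real.exp_pos (-x ^ 2 / 2)
  unfold stdPhi
  calc _ = (Real.sqrt (2 * Real.pi))⁻¹ * ((1 + x ^ 2 / 2) * Real.exp (-x ^ 2 / 2)) := by ring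
    _ ≤ (Real.sqrt (2 * Real.pi))⁻¹ * (Real.exp (x ^ 2 / 2) * Real.exp (-x ^ 2 / 2)) := by gcongr
    _ ≤ 1 / 2 := by rw [h2]; linarith

theorem abs_mul_stdPhi_le {q x : ℝ} (h : |q| ≤ 2 * (1 + x ^ 2 / 2)) : |q * stdPhi x| ≤ 1 := by
  rw [abs_mul, abs_of_pos (stdPhi_pos x)]
  have := mul_le_mul_of_nonneg_right h (stdPhi_pos x).le
  linarith [add_one_mul_stdPhi_le x]

theorem continuous_stdPhi : Continuous stdPhi := by unfold stdPhi; fun_prop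

theorem hasDerivAt_stdPhi (x : ℝ) : HasDerivAt stdPhi (-x * stdPhi x) x := by
  have h : HasDerivAt (fun x : ℝ => -x ^ 2 / 2) (-x) x :=
    (((hasDerivAt_pow 2 x).neg).div_const 2).congr_deriv (by simp; ring)
  exact (h.exp.const_mul (Real.sqrt (2 * Real.pi))⁻¹).congr_deriv (by unfold stdPhi; ring)

theorem hasDerivAt_stdPhi_one (x : ℝ) :
    HasDerivAt (fun x => -x * stdPhi x) ((x ^ 2 - 1) * stdPhi x) x :=
  (((hasDerivAt_id x).neg).mul (hasDerivAt_stdPhi x)).congr_deriv (by simp; ring)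

theorem hasDerivAt_stdPhi_two (x : ℝ) :
    HasDerivAt (fun x => (x ^ 2 - 1) * stdPhi x) ((3 * x - x ^ 3) * stdPhi x) x :=
  (((hasDerivAt_pow 2 x).sub_const 1).mul (hasDerivAt_stdPhi x)).congr_deriv (by norm_num; ring)

theorem stdCDF_eq_integral (x : ℝ) : stdCDF x = ∫ t in Set.Iic x, stdPhi t := by
  unfold stdCDF
  rw [Measure.real, gaussianReal_apply_eq_integral 0 one_ne_zero, stdPhi_eq_gaussianPDFReal,
    ENNReal.toReal_ofReal]
  exact setIntegral_nonneg measurableSet_Iic fun _ _ => gaussianPDFReal_nonneg _ _ _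

theorem integrable_stdPhi : Integrable stdPhi := by
  rw [stdPhi_eq_gaussianPDFReal]; exact integrable_gaussianPDFReal 0 1

theorem hasDerivAt_stdCDF (x : ℝ) : HasDerivAt stdCDF (stdPhi x) x := by
  have h : stdCDF = fun x => stdCDF 0 + ∫ t in (0 : ℝ)..x, stdPhi t := by
    funext x
    rw [← intervalIntegral.integral_Iic_sub_Iic integrable_stdPhi.integrableOn
      integrable_stdPhi.integrableOn, ← stdCDF_eq_integral, ← stdCDF_eq_integral]
    ring
  rw [h]
  exact (intervalIntegral.integral_hasDerivAt_right integrable_stdPhi.intervalIntegrable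
    continuous_stdPhi.stronglyMeasurable.stronglyMeasurableAtFilter
    continuous_stdPhi.continuousAt).const_add _

theorem stdCDF_sub_le {x y : ℝ} (h : x ≤ y) : stdCDF y - stdCDF x ≤ y - x := by
  have := (convex_univ (𝕜 := ℝ) (E := ℝ)).norm_image_sub_le_of_norm_hasDerivWithin_le
    (f := stdCDF) (f' := stdPhi) (C := 1) (x := x) (y := y)
    (fun x _ => (hasDerivAt_stdCDF x).hasDerivWithinAt)
    (fun x _ => by
      have := abs_mul_stdPhi_le (q := 1) (x := x) (by rw [abs_one]; nlinarith [sq_nonneg x])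
      simpa using this) trivial trivial
  rw [Real.norm_eq_abs, Real.norm_eq_abs, abs_of_nonneg (sub_nonneg.2 h)] at this
  linarith [le_abs_self (stdCDF y - stdCDF x)]

theorem integrable_stdPhi_three : Integrable fun x => (3 * x - x ^ 3) * stdPhi x := by
  have h3 : Integrable fun x : ℝ => x ^ 3 * Real.exp (-(1 / 2) * x ^ 2) := by
    have := integrable_rpow_mul_exp_neg_mul_sq (b := 1 / 2) (by norm_num) (s := 3) (by norm_num)
    simpa using this
  have h1 : Integrable fun x : ℝ => x * Real.exp (-(1 / 2) * x ^ 2) :=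
    integrable_mul_exp_neg_mul_sq (by norm_num)
  have := ((h1.const_mul 3).sub h3).const_mul (Real.sqrt (2 * Real.pi))⁻¹
  refine this.congr (Filter.Eventually.of_forall fun x => ?_)
  simp only [stdPhi, Pi.sub_apply]
  rw [show -x ^ 2 / 2 = -(1 / 2) * x ^ 2 by ring]
  ring

theorem tendsto_stdPhi_two_atBot :
    Filter.Tendsto (fun x => (x ^ 2 - 1) * stdPhi x) Filter.atBot (nhds 0) := by
  have h2 : Integrable fun x : ℝ => (x ^ 2 - 1) * stdPhi x := by
    have h3 : Integrable fun x : ℝ => x ^ 2 * Real.exp (-(1 / 2) * x ^ 2) := by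
      have := integrable_rpow_mul_exp_neg_mul_sq (b := 1 / 2) (by norm_num) (s := 2) (by norm_num)
      simpa using this
    refine ((h3.const_mul (Real.sqrt (2 * Real.pi))⁻¹).sub integrable_stdPhi).congr
      (Filter.Eventually.of_forall fun x => ?_)
    simp only [stdPhi, Pi.sub_apply]
    rw [show -x ^ 2 / 2 = -(1 / 2) * x ^ 2 by ring]
    ring
  exact tendsto_zero_of_hasDerivAt_of_integrableOn_Iic (a := 0)
    (fun x _ => hasDerivAt_stdPhi_two x) integrable_stdPhi_three.integrableOn h2.integrableOn

/-- The distribution function of the centered Gaussian law of variance `m`. -/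
def gcdf (m : ℕ) (z : ℝ) : ℝ := (gaussianReal 0 (m : NNReal)).real (Set.Iic z)

theorem gcdf_eq {m : ℕ} (hm : 1 ≤ m) (z : ℝ) : gcdf m z = stdCDF (z / Real.sqrt m) := by
  have hm0 : (0 : ℝ) < Real.sqrt m := Real.sqrt_pos.2 (by exact_mod_cast hm)
  have h := gaussianReal_map_const_mul (μ := 0) (v := 1) (Real.sqrt m)
  have hv : (NNReal.mk (Real.sqrt m ^ 2) (sq_nonneg _) * 1 : NNReal) = (m : NNReal) := by
    ext; simp
  rw [mul_zero, hv] at h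
  unfold gcdf stdCDF
  rw [← h, map_measureReal_apply (by fun_prop) measurableSet_Iic]
  congr 1
  ext x
  simp only [Set.mem_preimage, Set.mem_Iic]
  rw [le_div_iff₀ hm0, mul_comm]

theorem conv_real_Iic (ν κ : Measure ℝ) [IsProbabilityMeasure ν] [IsProbabilityMeasure κ] (z : ℝ) :
    (ν ∗ κ).real (Set.Iic z) = ∫ s, κ.real (Set.Iic (z - s)) ∂ν := by
  have : (ν ∗ κ).real (Set.Iic z) = ∫ x, (Set.Iic z).indicator (fun _ => (1 : ℝ)) x ∂(ν ∗ κ) := by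
    rw [integral_indicator measurableSet_Iic]; simp
  rw [this, integral_conv]
  · congr 1; funext s
    have : κ.real (Set.Iic (z - s)) = ∫ x, (Set.Iic (z - s)).indicator (fun _ => (1 : ℝ)) x ∂κ := by
      rw [integral_indicator measurableSet_Iic]; simp
    rw [this]
    congr 1; funext y
    simp only [Set.indicator_apply, Set.mem_Iic, le_sub_iff_add_le']
  · exact (integrable_const 1).indicator measurableSet_Iic

theorem gaussian_conv_nat (k m : ℕ) :
    gaussianReal 0 (k : NNReal) ∗ gaussianReal 0 (m : NNReal)
      = gaussianReal 0 ((k + m : ℕ) : NNReal) := by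
  rw [gaussianReal_conv_gaussianReal]; simp

/-- Smoothing by a probability law can be differentiated under the integral sign. -/
theorem hasDerivAt_integral_sub {g g' : ℝ → ℝ} {C C' : ℝ} (hg : ∀ x, HasDerivAt g (g' x) x)
    (hb : ∀ x, |g x| ≤ C) (hb' : ∀ x, |g' x| ≤ C') (hc : Continuous g')
    (ν : Measure ℝ) [IsProbabilityMeasure ν] (z : ℝ) :
    HasDerivAt (fun z => ∫ s, g (z - s) ∂ν) (∫ s, g' (z - s) ∂ν) z := by
  have hgc : Continuous g := continuous_iff_continuousAt.2 fun x => (hg x).continuousAt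
  refine (hasDerivAt_integral_of_dominated_loc_of_deriv_le (F := fun z s => g (z - s))
    (F' := fun z s => g' (z - s)) (bound := fun _ => C') (s := Set.univ) Filter.univ_mem
    (Filter.Eventually.of_forall fun x => (by fun_prop)) ?_ (by fun_prop) ?_ (integrable_const _)
    ?_).2
  · exact Integrable.of_bound (by fun_prop) C (Filter.Eventually.of_forall fun s => hb _)
  · exact Filter.Eventually.of_forall fun s x _ => hb' _
  · refine Filter.Eventually.of_forall fun s x _ => ?_
    have := (hg (x - s)).comp x ((hasDerivAt_id x).sub_const s)
    simpa [Function.comp_def] using this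

end

/-! ### Gaussian smoothing -/

noncomputable section

/-- First derivative of `gcdf m`. -/
def gcdf1 (m : ℕ) (z : ℝ) : ℝ := (Real.sqrt m)⁻¹ * stdPhi (z / Real.sqrt m)
/-- Second derivative of `gcdf m`. -/
def gcdf2 (m : ℕ) (z : ℝ) : ℝ :=
  (Real.sqrt m)⁻¹ ^ 2 * (-(z / Real.sqrt m) * stdPhi (z / Real.sqrt m))
/-- Third derivative of `gcdf m`. -/
def gcdf3 (m : ℕ) (z : ℝ) : ℝ :=
  (Real.sqrt m)⁻¹ ^ 3 * (((z / Real.sqrt m) ^ 2 - 1) * stdPhi (z / Real.sqrt m))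
/-- Fourth derivative of `gcdf m`. -/
def gcdf4 (m : ℕ) (z : ℝ) : ℝ :=
  (Real.sqrt m)⁻¹ ^ 4 *
    ((3 * (z / Real.sqrt m) - (z / Real.sqrt m) ^ 3) * stdPhi (z / Real.sqrt m))

theorem hasDerivAt_scale {f f' : ℝ → ℝ} (hf : ∀ x, HasDerivAt f (f' x) x) (σ : ℝ) (j : ℕ) (z : ℝ) :
    HasDerivAt (fun z => σ⁻¹ ^ j * f (z / σ)) (σ⁻¹ ^ (j + 1) * f' (z / σ)) z := by
  have h := (hf (z / σ)).comp z ((hasDerivAt_id z).div_const σ)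
  exact (h.const_mul (σ⁻¹ ^ j)).congr_deriv (by simp only [one_div]; ring)

variable {m : ℕ}

theorem hasDerivAt_gcdf (hm : 1 ≤ m) (z : ℝ) : HasDerivAt (gcdf m) (gcdf1 m z) z := by
  have := hasDerivAt_scale hasDerivAt_stdCDF (Real.sqrt m) 0 z
  simp only [pow_zero, one_mul, zero_add, pow_one] at this
  exact this.congr_of_eventuallyEq (Filter.Eventually.of_forall fun z => gcdf_eq hm z)

theorem hasDerivAt_gcdf1 (z : ℝ) : HasDerivAt (gcdf1 m) (gcdf2 m z) z := by
  have := hasDerivAt_scale hasDerivAt_stdPhi (Real.sqrt m) 1 z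
  simp only [pow_one] at this
  exact this

theorem hasDerivAt_gcdf2 (z : ℝ) : HasDerivAt (gcdf2 m) (gcdf3 m z) z :=
  hasDerivAt_scale hasDerivAt_stdPhi_one (Real.sqrt m) 2 z

theorem hasDerivAt_gcdf3 (z : ℝ) : HasDerivAt (gcdf3 m) (gcdf4 m z) z :=
  hasDerivAt_scale hasDerivAt_stdPhi_two (Real.sqrt m) 3 z

theorem continuous_gcdf1 : Continuous (gcdf1 m) :=
  continuous_iff_continuousAt.2 fun x => (hasDerivAt_gcdf1 x).continuousAt
theorem continuous_gcdf2 : Continuous (gcdf2 m) :=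
  continuous_iff_continuousAt.2 fun x => (hasDerivAt_gcdf2 x).continuousAt
theorem continuous_gcdf3 : Continuous (gcdf3 m) :=
  continuous_iff_continuousAt.2 fun x => (hasDerivAt_gcdf3 x).continuousAt
theorem abs_gcdf_le (z : ℝ) : |gcdf m z| ≤ 1 := by
  rw [gcdf, abs_of_nonneg measureReal_nonneg]; exact measureReal_le_one

theorem abs_gcdf1_le (z : ℝ) : |gcdf1 m z| ≤ (Real.sqrt m)⁻¹ := by
  rw [gcdf1, abs_mul, abs_of_nonneg (by positivity)]
  apply mul_le_of_le_one_right (by positivity)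
  have := abs_mul_stdPhi_le (q := 1) (x := z / Real.sqrt m)
    (by rw [abs_one]; nlinarith [sq_nonneg (z / Real.sqrt m)])
  simpa using this

theorem abs_gcdf2_le (z : ℝ) : |gcdf2 m z| ≤ (Real.sqrt m)⁻¹ ^ 2 := by
  rw [gcdf2, abs_mul, abs_of_nonneg (by positivity)]
  apply mul_le_of_le_one_right (by positivity)
  refine abs_mul_stdPhi_le (abs_le.2 ⟨?_, ?_⟩) <;>
    nlinarith [sq_nonneg (z / Real.sqrt m - 1), sq_nonneg (z / Real.sqrt m + 1)]

theorem abs_gcdf3_le (z : ℝ) : |gcdf3 m z| ≤ (Real.sqrt m)⁻¹ ^ 3 := by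
  rw [gcdf3, abs_mul, abs_of_nonneg (by positivity)]
  apply mul_le_of_le_one_right (by positivity)
  refine abs_mul_stdPhi_le (abs_le.2 ⟨?_, ?_⟩) <;> nlinarith [sq_nonneg (z / Real.sqrt m)]

/-- `∫ |φ'''|` for the standard Gaussian density `φ`. -/
def phiThreeNorm : ℝ := ∫ x, |(3 * x - x ^ 3) * stdPhi x|

theorem phiThreeNorm_nonneg : 0 ≤ phiThreeNorm := integral_nonneg fun _ => abs_nonneg _

theorem integrable_gcdf4 (hm : 1 ≤ m) : Integrable (gcdf4 m) := by
  have hm0 : (0 : ℝ) < Real.sqrt m := Real.sqrt_pos.2 (by exact_mod_cast hm)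
  exact (integrable_stdPhi_three.comp_div hm0.ne').const_mul _

theorem integral_abs_gcdf4 (hm : 1 ≤ m) :
    ∫ z, |gcdf4 m z| = (Real.sqrt m)⁻¹ ^ 3 * phiThreeNorm := by
  have hm0 : (0 : ℝ) < Real.sqrt m := Real.sqrt_pos.2 (by exact_mod_cast hm)
  have : ∀ z, |gcdf4 m z| = (Real.sqrt m)⁻¹ ^ 4 *
      (fun x => |(3 * x - x ^ 3) * stdPhi x|) (z / Real.sqrt m) := fun z => by
    simp only [gcdf4]; rw [abs_mul, abs_of_nonneg (by positivity)]
  rw [funext this, integral_const_mul, Measure.integral_comp_div (fun x => |(3 * x - x ^ 3) * stdPhi x|), abs_of_pos hm0, smul_eq_mul, phiThreeNorm]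
  field_simp

theorem gcdf3_eq_integral (hm : 1 ≤ m) (x : ℝ) : gcdf3 m x = ∫ t in Set.Iic x, gcdf4 m t := by
  have hm0 : (0 : ℝ) < Real.sqrt m := Real.sqrt_pos.2 (by exact_mod_cast hm)
  rw [integral_Iic_of_hasDerivAt_of_tendsto (f := gcdf3 m) (m := 0)
    continuous_gcdf3.continuousWithinAt (fun x _ => hasDerivAt_gcdf3 x)
    (integrable_gcdf4 hm).integrableOn, sub_zero]
  have h : Filter.Tendsto (fun z : ℝ => z / Real.sqrt m) Filter.atBot Filter.atBot :=
    Filter.tendsto_id.atBot_div_const hm0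
  have := (tendsto_stdPhi_two_atBot.comp h).const_mul ((Real.sqrt m)⁻¹ ^ 3)
  rw [mul_zero] at this
  exact this

/-- Integration by parts: smoothing `gcdf3` sees `ν` through its distribution function only. -/
theorem integral_gcdf3_sub (hm : 1 ≤ m) (ν : Measure ℝ) [IsProbabilityMeasure ν] (z : ℝ) :
    ∫ s, gcdf3 m (z - s) ∂ν = ∫ t, gcdf4 m t * ν.real (Set.Iic (z - t)) := by
  have h1 : ∀ s, gcdf3 m (z - s) = ∫ t, if t ≤ z - s then gcdf4 m t else 0 := fun s => by
    rw [gcdf3_eq_integral hm, ← integral_indicator measurableSet_Iic]; rfl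
  simp_rw [h1]
  rw [integral_integral_swap]
  · congr 1; funext t
    have : ∀ s, (if t ≤ z - s then gcdf4 m t else 0)
        = gcdf4 m t * (Set.Iic (z - t)).indicator (fun _ => (1 : ℝ)) s := fun s => by
      simp only [Set.indicator_apply, Set.mem_Iic, le_sub_comm (a := t)]
      split_ifs <;> simp
    simp_rw [this]
    rw [integral_const_mul, integral_indicator measurableSet_Iic]
    simp
  · have hi : Integrable (fun p : ℝ × ℝ => gcdf4 m p.2) (ν.prod volume) :=
      (integrable_gcdf4 hm).comp_snd ν
    have : Function.uncurry (fun s t => if t ≤ z - s then gcdf4 m t else 0)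
        = {p : ℝ × ℝ | p.2 ≤ z - p.1}.indicator fun p => gcdf4 m p.2 := by
      ext ⟨s, t⟩; simp [Set.indicator_apply]
    rw [this]
    exact hi.indicator (measurableSet_le (by fun_prop) (by fun_prop))

/-- Smoothing by laws at Kolmogorov distance at most `D` differs by `O(D m^(-3/2))`. -/
theorem abs_integral_gcdf3_sub_le (hm : 1 ≤ m) (ν ν' : Measure ℝ) [IsProbabilityMeasure ν]
    [IsProbabilityMeasure ν'] {D : ℝ} (hD : ∀ z, |ν.real (Set.Iic z) - ν'.real (Set.Iic z)| ≤ D)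
    (z : ℝ) :
    |∫ s, gcdf3 m (z - s) ∂ν - ∫ s, gcdf3 m (z - s) ∂ν'|
      ≤ D * ((Real.sqrt m)⁻¹ ^ 3 * phiThreeNorm) := by
  have hmeas : ∀ (ν : Measure ℝ) [IsProbabilityMeasure ν],
      Integrable (fun t => gcdf4 m t * ν.real (Set.Iic (z - t))) := fun ν _ => by
    refine (integrable_gcdf4 hm).mul_bdd (c := 1) ?_ (Filter.Eventually.of_forall fun t => ?_)
    · have hmono : Monotone fun x => ν.real (Set.Iic x) :=
        fun _ _ h => measureReal_mono (Set.Iic_subset_Iic.2 h)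
      exact (hmono.measurable.comp (measurable_const.sub measurable_id)).aestronglyMeasurable
    · rw [Real.norm_eq_abs, abs_of_nonneg measureReal_nonneg]; exact measureReal_le_one
  rw [integral_gcdf3_sub hm, integral_gcdf3_sub hm, ← integral_sub (hmeas ν) (hmeas ν'),
    ← integral_abs_gcdf4 hm, ← integral_const_mul]
  refine (abs_integral_le_integral_abs).trans (integral_mono ?_ ?_ fun t => ?_)
  · exact ((hmeas ν).sub (hmeas ν')).abs
  · exact (integrable_gcdf4 hm).abs.const_mul D
  · simp only
    rw [← mul_sub, abs_mul, mul_comm]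
    exact mul_le_mul_of_nonneg_right (hD _) (abs_nonneg _)

section Smooth
variable (ν : Measure ℝ) [IsProbabilityMeasure ν]

theorem hasDerivAt_smooth0 (hm : 1 ≤ m) (z : ℝ) :
    HasDerivAt (fun z => ∫ s, gcdf m (z - s) ∂ν) (∫ s, gcdf1 m (z - s) ∂ν) z :=
  hasDerivAt_integral_sub (hasDerivAt_gcdf hm) abs_gcdf_le abs_gcdf1_le continuous_gcdf1 ν z
theorem hasDerivAt_smooth1 (z : ℝ) :
    HasDerivAt (fun z => ∫ s, gcdf1 m (z - s) ∂ν) (∫ s, gcdf2 m (z - s) ∂ν) z :=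
  hasDerivAt_integral_sub hasDerivAt_gcdf1 abs_gcdf1_le abs_gcdf2_le continuous_gcdf2 ν z
theorem hasDerivAt_smooth2 (z : ℝ) :
    HasDerivAt (fun z => ∫ s, gcdf2 m (z - s) ∂ν) (∫ s, gcdf3 m (z - s) ∂ν) z :=
  hasDerivAt_integral_sub hasDerivAt_gcdf2 abs_gcdf2_le abs_gcdf3_le continuous_gcdf3 ν z

end Smooth

/-- Smoothing by a Gaussian law adds its variance. -/
theorem integral_gcdf3_gaussian (hm : 1 ≤ m) (k : ℕ) (z : ℝ) :
    ∫ s, gcdf3 m (z - s) ∂(gaussianReal 0 (k : NNReal)) = gcdf3 (k + m) z := by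
  have hkm : 1 ≤ k + m := by omega
  have e0 : (fun z => ∫ s, gcdf m (z - s) ∂(gaussianReal 0 (k : NNReal))) = gcdf (k + m) := by
    funext z
    rw [gcdf, ← gaussian_conv_nat, conv_real_Iic]; rfl
  have e1 : (fun z => ∫ s, gcdf1 m (z - s) ∂(gaussianReal 0 (k : NNReal))) = gcdf1 (k + m) := by
    funext z
    exact (e0 ▸ hasDerivAt_smooth0 (gaussianReal 0 (k : NNReal)) hm z).unique (hasDerivAt_gcdf hkm z)
  have e2 : (fun z => ∫ s, gcdf2 m (z - s) ∂(gaussianReal 0 (k : NNReal))) = gcdf2 (k + m) := by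
    funext z
    exact (e1 ▸ hasDerivAt_smooth1 (gaussianReal 0 (k : NNReal)) z).unique (hasDerivAt_gcdf1 z)
  exact (e2 ▸ hasDerivAt_smooth2 (gaussianReal 0 (k : NNReal)) z).unique (hasDerivAt_gcdf2 z)

theorem abs_le_of_deriv_le {f f' : ℝ → ℝ} (hf : ∀ x, HasDerivAt f (f' x) x) (h0 : f 0 = 0)
    {C : ℝ} (hC : 0 ≤ C) (n : ℕ) (hb : ∀ x, |f' x| ≤ C * |x| ^ n) (a : ℝ) :
    |f a| ≤ C * |a| ^ (n + 1) := by
  have := (convex_closedBall (0 : ℝ) |a|).norm_image_sub_le_of_norm_hasDerivWithin_le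
    (f := f) (f' := f') (C := C * |a| ^ n) (x := 0) (y := a)
    (fun x _ => (hf x).hasDerivWithinAt)
    (fun x hx => (hb x).trans (by
      have : |x| ≤ |a| := by simpa using hx
      gcongr)) (by simp) (by simp)
  simp only [h0, sub_zero, Real.norm_eq_abs] at this
  calc |f a| ≤ _ := this
    _ = _ := by ring

/-- Taylor expansion to second order, with a crude constant. -/
theorem abs_taylor_two_le {H H1 H2 H3 : ℝ → ℝ} (h0 : ∀ x, HasDerivAt H (H1 x) x)
    (h1 : ∀ x, HasDerivAt H1 (H2 x) x) (h2 : ∀ x, HasDerivAt H2 (H3 x) x) {B : ℝ}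
    (hB : ∀ x, |H3 x| ≤ B) (z a : ℝ) :
    |H (z + a) - (H z + a * H1 z + a ^ 2 / 2 * H2 z)| ≤ B * |a| ^ 3 := by
  have hB0 : 0 ≤ B := (abs_nonneg _).trans (hB 0)
  have sh : ∀ {f f' : ℝ → ℝ}, (∀ x, HasDerivAt f (f' x) x) →
      ∀ x, HasDerivAt (fun a => f (z + a)) (f' (z + x)) x := fun hf x => by
    simpa using (hf (z + x)).comp_const_add z x
  have s2 := abs_le_of_deriv_le (f := fun a => H2 (z + a) - H2 z) (f' := fun a => H3 (z + a))
    (fun x => (sh h2 x).sub_const _) (by simp) hB0 0 (fun x => by simpa using hB _)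
  have s1 := abs_le_of_deriv_le (f := fun a => H1 (z + a) - H1 z - a * H2 z)
    (f' := fun a => H2 (z + a) - H2 z)
    (fun x => (((sh h1 x).sub_const _).sub ((hasDerivAt_id x).mul_const _)).congr_deriv (by simp))
    (by simp) hB0 1 s2
  have s0 := abs_le_of_deriv_le (f := fun a => H (z + a) - H z - a * H1 z - a ^ 2 / 2 * H2 z)
    (f' := fun a => H1 (z + a) - H1 z - a * H2 z)
    (fun x => ((((sh h0 x).sub_const _).sub ((hasDerivAt_id x).mul_const _)).sub
      (((hasDerivAt_pow 2 x).div_const 2).mul_const _)).congr_deriv (by simp))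
    (by simp) hB0 2 s1
  convert s0 a using 2
  ring

/-- The Lindeberg step: two laws with the same first two moments are nearly exchangeable against a
function with bounded third derivative. -/
theorem abs_integral_sub_le_of_moments {H H1 H2 H3 : ℝ → ℝ} (h0 : ∀ x, HasDerivAt H (H1 x) x)
    (h1 : ∀ x, HasDerivAt H1 (H2 x) x) (h2 : ∀ x, HasDerivAt H2 (H3 x) x) {B C : ℝ}
    (hB : ∀ x, |H3 x| ≤ B) (hH : ∀ x, |H x| ≤ C) (μ : Measure ℝ) [IsProbabilityMeasure μ]
    (i1 : Integrable (fun x : ℝ => x) μ) (i2 : Integrable (fun x : ℝ => x ^ 2) μ)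
    (i3 : Integrable (fun x : ℝ => |x| ^ 3) μ)
    (m1 : ∫ x, x ∂μ = 0) (m2 : ∫ x, x ^ 2 ∂μ = 1) (z : ℝ) :
    |∫ a, H (z - a) ∂μ - (H z + H2 z / 2)| ≤ B * ∫ x, |x| ^ 3 ∂μ := by
  have hc : Continuous H := continuous_iff_continuousAt.2 fun x => (h0 x).continuousAt
  have iH : Integrable (fun a => H (z - a)) μ :=
    Integrable.of_bound (by fun_prop) C (Filter.Eventually.of_forall fun s => hH _)
  have j1 : Integrable (fun a : ℝ => -a * H1 z) μ := i1.neg.mul_const _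
  have j2 : Integrable (fun a : ℝ => (-a) ^ 2 / 2 * H2 z) μ := by
    simpa using (i2.div_const 2).mul_const (H2 z)
  have j0 : Integrable (fun a : ℝ => H z + -a * H1 z) μ := (integrable_const _).add j1
  have iq : Integrable (fun a : ℝ => H z + (-a) * H1 z + (-a) ^ 2 / 2 * H2 z) μ := j0.add j2
  have e : ∫ a : ℝ, (H z + (-a) * H1 z + (-a) ^ 2 / 2 * H2 z) ∂μ = H z + H2 z / 2 := by
    rw [integral_add j0 j2, integral_add (integrable_const _) j1, integral_mul_const,
      integral_neg, m1, integral_mul_const]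
    simp only [neg_sq, integral_div, m2]
    simp; ring
  rw [← e, ← integral_sub iH iq, ← integral_const_mul]
  refine abs_integral_le_integral_abs.trans (integral_mono (iH.sub iq).abs (i3.const_mul B) ?_)
  intro a
  have := abs_taylor_two_le h0 h1 h2 hB z (-a)
  simpa [sub_eq_add_neg] using this

end

/-! ### The Berry–Esseen theorem -/

noncomputable section

/-- The `k`-fold convolution power of `μ`. -/
def convPow (μ : Measure ℝ) : ℕ → Measure ℝ
  | 0 => Measure.dirac 0
  | k + 1 => convPow μ k ∗ μ

instance convPow_isProbabilityMeasure (μ : Measure ℝ) [IsProbabilityMeasure μ] (k : ℕ) :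
    IsProbabilityMeasure (convPow μ k) := by
  induction k with
  | zero => unfold convPow; infer_instance
  | succ k ih => unfold convPow; infer_instance

/-- Kolmogorov distance between the `k`-fold convolution power of `μ` and the centered Gaussian law
of variance `k`. -/
def ksDist (μ : Measure ℝ) (k : ℕ) : ℝ := ⨆ z, |(convPow μ k).real (Set.Iic z) - gcdf k z|

theorem ksDist_zero (μ : Measure ℝ) : ksDist μ 0 = 0 := by
  have : ∀ z, |(convPow μ 0).real (Set.Iic z) - gcdf 0 z| = 0 := fun z => by
    simp [convPow, gcdf]
  simp [ksDist, this]

section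
variable (μ : Measure ℝ) [IsProbabilityMeasure μ]

theorem abs_convPow_sub_gcdf_le_one (k : ℕ) (z : ℝ) :
    |(convPow μ k).real (Set.Iic z) - gcdf k z| ≤ 1 := by
  have h1 : 0 ≤ (convPow μ k).real (Set.Iic z) := measureReal_nonneg
  have h2 : (convPow μ k).real (Set.Iic z) ≤ 1 := measureReal_le_one
  have h3 : 0 ≤ gcdf k z := measureReal_nonneg
  have h4 : gcdf k z ≤ 1 := measureReal_le_one
  rw [abs_le]; constructor <;> linarith

theorem abs_convPow_sub_gcdf_le (k : ℕ) (z : ℝ) :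
    |(convPow μ k).real (Set.Iic z) - gcdf k z| ≤ ksDist μ k :=
  le_ciSup (f := fun z => |(convPow μ k).real (Set.Iic z) - gcdf k z|)
    ⟨1, by rintro _ ⟨z, rfl⟩; exact abs_convPow_sub_gcdf_le_one μ k z⟩ z

theorem integrable_cube_stdGaussian : Integrable (fun x : ℝ => |x| ^ 3) (gaussianReal 0 1) := by
  have := (memLp_id_gaussianReal (μ := 0) (v := 1) 3).integrable_norm_pow (p := 3) (by norm_num)
  simpa using this

theorem integral_sq_stdGaussian : ∫ x, x ^ 2 ∂(gaussianReal 0 1) = 1 := by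
  have h := variance_fun_id_gaussianReal (μ := 0) (v := 1)
  rw [variance_eq_integral (by fun_prop)] at h
  simpa [integral_id_gaussianReal] using h

/-- Replacing one factor `μ` by a standard Gaussian. -/
theorem abs_swap_le (i3 : Integrable (fun x : ℝ => |x| ^ 3) μ)
    (m1 : ∫ x, x ∂μ = 0) (m2 : ∫ x, x ^ 2 ∂μ = 1) (k : ℕ) {m : ℕ} (hm : 1 ≤ m) (z : ℝ) :
    |(convPow μ (k + 1) ∗ gaussianReal 0 (m : NNReal)).real (Set.Iic z)
      - (convPow μ k ∗ gaussianReal 0 ((m + 1 : ℕ) : NNReal)).real (Set.Iic z)|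
      ≤ ((Real.sqrt (k + m : ℕ))⁻¹ ^ 3 + ksDist μ k * ((Real.sqrt m)⁻¹ ^ 3 * phiThreeNorm)) *
        (∫ x, |x| ^ 3 ∂μ + ∫ x, |x| ^ 3 ∂(gaussianReal 0 1)) := by
  set ν := convPow μ k
  set H : ℝ → ℝ := fun z => ∫ s, gcdf m (z - s) ∂ν with hH
  have hHe : ∀ z, (ν ∗ gaussianReal 0 (m : NNReal)).real (Set.Iic z) = H z := fun z => by
    rw [conv_real_Iic]; rfl
  have e1 : (convPow μ (k + 1) ∗ gaussianReal 0 (m : NNReal)).real (Set.Iic z)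
      = ∫ a, H (z - a) ∂μ := by
    simp_rw [← hHe]
    rw [← conv_real_Iic, ← Measure.conv_assoc, Measure.conv_comm μ ν]; rfl
  have e2 : (ν ∗ gaussianReal 0 ((m + 1 : ℕ) : NNReal)).real (Set.Iic z)
      = ∫ a, H (z - a) ∂(gaussianReal 0 1) := by
    simp_rw [← hHe]
    have := gaussian_conv_nat m 1
    rw [← conv_real_Iic, Measure.conv_comm (gaussianReal 0 1), Measure.conv_assoc, ← this]
    simp
  rw [e1, e2]
  have hB : ∀ z, |∫ s, gcdf3 m (z - s) ∂ν|
      ≤ (Real.sqrt (k + m : ℕ))⁻¹ ^ 3 + ksDist μ k * ((Real.sqrt m)⁻¹ ^ 3 * phiThreeNorm) := by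
    intro z
    have h1 := abs_integral_gcdf3_sub_le hm ν (gaussianReal 0 (k : NNReal))
      (abs_convPow_sub_gcdf_le μ k) z
    rw [integral_gcdf3_gaussian hm] at h1
    have h2 := abs_gcdf3_le (m := k + m) z
    have h3 := abs_sub_abs_le_abs_sub (∫ s, gcdf3 m (z - s) ∂ν) (gcdf3 (k + m) z)
    linarith
  have hHb : ∀ x, |H x| ≤ 1 := fun x => by
    rw [← hHe, abs_of_nonneg measureReal_nonneg]; exact measureReal_le_one
  have i2 : ∀ (μ : Measure ℝ) [IsProbabilityMeasure μ], Integrable (fun x : ℝ => |x| ^ 3) μ →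
      Integrable (fun x : ℝ => x ^ 2) μ := fun μ _ i3 => by
    refine ((integrable_const 1).add i3).mono' (by fun_prop)
      (Filter.Eventually.of_forall fun x => ?_)
    simp only [norm_pow, Real.norm_eq_abs, Pi.add_apply]
    have := abs_nonneg x
    rcases le_total |x| 1 with h | h
    · have h1 : |x| ^ 2 ≤ 1 := pow_le_one₀ this h
      have : 0 ≤ |x| ^ 3 := by positivity
      linarith
    · nlinarith [sq_nonneg |x|]
  have i1 : ∀ (μ : Measure ℝ) [IsProbabilityMeasure μ], Integrable (fun x : ℝ => |x| ^ 3) μ →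
      Integrable (fun x : ℝ => x) μ := fun μ _ i3 => by
    refine ((integrable_const 1).add (i2 μ i3)).mono' (by fun_prop)
      (Filter.Eventually.of_forall fun x => ?_)
    simp only [Real.norm_eq_abs, Pi.add_apply]
    rw [← sq_abs]; nlinarith [sq_nonneg (|x| - 1)]
  have t1 := abs_integral_sub_le_of_moments (hasDerivAt_smooth0 ν hm) (hasDerivAt_smooth1 ν)
    (hasDerivAt_smooth2 ν) hB hHb μ (i1 μ i3) (i2 μ i3) i3 m1 m2 z
  have t2 := abs_integral_sub_le_of_moments (hasDerivAt_smooth0 ν hm) (hasDerivAt_smooth1 ν)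
    (hasDerivAt_smooth2 ν) hB hHb (gaussianReal 0 1) (i1 _ integrable_cube_stdGaussian)
    (i2 _ integrable_cube_stdGaussian) integrable_cube_stdGaussian integral_id_gaussianReal
    integral_sq_stdGaussian z
  rw [abs_sub_comm] at t2
  have t3 := abs_sub_le (∫ a, H (z - a) ∂μ) (H z + (∫ s, gcdf2 m (z - s) ∂ν) / 2)
    (∫ a, H (z - a) ∂(gaussianReal 0 1))
  rw [mul_add]
  linarith

end

/-- Removing a smoothing: if `F - G` is small after convolution with `γ`, then it is small. -/
theorem abs_sub_le_of_smoothed {F G : ℝ → ℝ} (hF : Monotone F) {L a D E : ℝ} (hL : 0 ≤ L)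
    (hG : ∀ x y, x ≤ y → G y - G x ≤ L * (y - x)) (hGc : Measurable G)
    (γ : Measure ℝ) [IsProbabilityMeasure γ] (hγ : γ.real {s | a < |s|} ≤ 1 / 4)
    (hD : ∀ z, |F z - G z| ≤ D) (hE : ∀ z, |∫ s, (F (z - s) - G (z - s)) ∂γ| ≤ E) (z : ℝ) :
    |F z - G z| ≤ 2 * a * L + 4 / 3 * (E + D / 4) := by
  have hD0 : 0 ≤ D := (abs_nonneg _).trans (hD 0)
  have hE0 : 0 ≤ E := (abs_nonneg _).trans (hE 0)
  have hms : MeasurableSet {s : ℝ | a < |s|} := measurableSet_lt measurable_const (by fun_prop)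
  have hFm : Measurable F := hF.measurable
  have hint : ∀ z, Integrable (fun s => F (z - s) - G (z - s)) γ := fun z =>
    Integrable.of_bound (by fun_prop) D (Filter.Eventually.of_forall fun s => hD _)
  set q := γ.real {s : ℝ | a < |s|}
  have hq0 : 0 ≤ q := measureReal_nonneg
  -- a lower bound `c` on `{|s| ≤ a}` and `-D` elsewhere
  have key : ∀ (c : ℝ) (f : ℝ → ℝ), Integrable f γ → (∀ s, |s| ≤ a → c ≤ f s) → (∀ s, -D ≤ f s) →
      c * (1 - q) - D * q ≤ ∫ s, f s ∂γ := by
    intro c f hf h1 h2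
    have : c * (1 - q) - D * q
        = ∫ s, (c + ({s : ℝ | a < |s|}.indicator (fun _ => (-D - c)) s)) ∂γ := by
      rw [integral_add (integrable_const _) ((integrable_const _).indicator hms),
        integral_indicator hms]
      simp
      ring
    rw [this]
    refine integral_mono ((integrable_const _).add ((integrable_const _).indicator hms)) hf ?_
    intro s
    by_cases hs : a < |s|
    · simpa [hs] using h2 s
    · simpa [hs] using h1 s (not_lt.1 hs)
  rw [abs_le]
  have fin : ∀ c, c * (1 - q) - D * q ≤ E → c ≤ 4 / 3 * (E + D / 4) := fun c hc => by
    by_contra! h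
    have hc0 : 0 ≤ c := by linarith [show 0 ≤ 4 / 3 * (E + D / 4) by positivity]
    nlinarith
  constructor
  · have := key (-(F z - G z) - 2 * a * L) (fun s => -(F (z - a - s) - G (z - a - s)))
      (hint (z - a)).neg (fun s hs => by
        have hs' := abs_le.1 hs
        have h1 : F (z - a - s) ≤ F z := hF (by linarith)
        have h2 := hG (z - a - s) z (by linarith)
        have h3 : L * (z - (z - a - s)) ≤ L * (2 * a) := by
          apply mul_le_mul_of_nonneg_left _ hL; linarith
        linarith) (fun s => by linarith [(abs_le.1 (hD (z - a - s))).2])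
    rw [integral_neg] at this
    have := fin _ (this.trans ((neg_le_abs _).trans (hE _)))
    linarith
  · have := key ((F z - G z) - 2 * a * L) (fun s => (F (z + a - s) - G (z + a - s)))
      (hint (z + a)) (fun s hs => by
        have hs' := abs_le.1 hs
        have h1 : F z ≤ F (z + a - s) := hF (by linarith)
        have h2 := hG z (z + a - s) (by linarith)
        have h3 : L * ((z + a - s) - z) ≤ L * (2 * a) := by
          apply mul_le_mul_of_nonneg_left _ hL; linarith
        linarith) (fun s => by linarith [(abs_le.1 (hD (z + a - s))).1])
    have := fin _ (this.trans ((le_abs_self _).trans (hE _)))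
    linarith

theorem gaussian_tail_le (N : ℕ) (hN : 1 ≤ N) :
    (gaussianReal 0 (N : NNReal)).real {s | 2 * Real.sqrt N < |s|} ≤ 1 / 4 := by
  have hN0 : (0 : ℝ) < Real.sqrt N := Real.sqrt_pos.2 (by exact_mod_cast hN)
  have h := meas_ge_le_variance_div_sq (μ := gaussianReal 0 (N : NNReal)) (X := fun x => x)
    (memLp_id_gaussianReal 2) (c := 2 * Real.sqrt N) (by positivity)
  rw [variance_fun_id_gaussianReal, integral_id_gaussianReal] at h
  have h2 : (((N : NNReal) : ℝ) / (2 * Real.sqrt N) ^ 2) = 1 / 4 := by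
    rw [mul_pow, Real.sq_sqrt (by positivity)]
    have : (N : ℝ) ≠ 0 := by positivity
    simp; field_simp; norm_num
  rw [h2] at h
  refine ENNReal.toReal_le_of_le_ofReal (by norm_num) ((measure_mono ?_).trans h)
  intro s hs
  simp only [Set.mem_ofPred_eq, sub_zero] at hs ⊢
  exact hs.le

theorem sum_inv_sqrt_le (n : ℕ) : ∑ j ∈ Finset.range n, (Real.sqrt (j + 1 : ℕ))⁻¹ ≤ 2 * Real.sqrt n := by
  induction n with
  | zero => simp
  | succ n ih =>
    rw [Finset.sum_range_succ]
    set α := Real.sqrt n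
    set β := Real.sqrt (n + 1 : ℕ)
    have hβ : 0 < β := Real.sqrt_pos.2 (by positivity)
    have h1 : α ^ 2 = n := Real.sq_sqrt (by positivity)
    have h2 : β ^ 2 = n + 1 := by rw [Real.sq_sqrt (by positivity)]; push_cast; ring
    have h3 : 2 * α * β ≤ 2 * β ^ 2 - 1 := by nlinarith [sq_nonneg (α - β)]
    have : 2 * α + β⁻¹ ≤ 2 * β := by
      rw [← sub_nonneg]
      have : 2 * β - (2 * α + β⁻¹) = (2 * β ^ 2 - 1 - 2 * α * β) * β⁻¹ := by field_simp; ring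
      rw [this]; apply mul_nonneg (by linarith) (by positivity)
    linarith

theorem sum_inv_sqrt_cube_le {N : ℕ} (hN : 1 ≤ N) (n : ℕ) :
    ∑ j ∈ Finset.range n, (Real.sqrt (N + j : ℕ))⁻¹ ^ 3 ≤ 6 * (Real.sqrt N)⁻¹ := by
  suffices h : ∑ j ∈ Finset.range n, (Real.sqrt (N + j : ℕ))⁻¹ ^ 3
      ≤ 6 * ((Real.sqrt N)⁻¹ - (Real.sqrt (N + n : ℕ))⁻¹) by
    have : 0 ≤ (Real.sqrt (N + n : ℕ))⁻¹ := by positivity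
    linarith
  induction n with
  | zero => simp
  | succ n ih =>
    rw [Finset.sum_range_succ]
    set b := N + n
    have hb : 1 ≤ b := by omega
    have hb' : (1 : ℝ) ≤ b := by exact_mod_cast hb
    have e : N + (n + 1) = b + 1 := by omega
    rw [e]
    set α := Real.sqrt b
    set β := Real.sqrt (b + 1 : ℕ)
    have hα : 0 < α := Real.sqrt_pos.2 (by positivity)
    have hβ : 0 < β := Real.sqrt_pos.2 (by positivity)
    have h1 : α ^ 2 = b := Real.sq_sqrt (by positivity)
    have h2 : β ^ 2 = b + 1 := by rw [Real.sq_sqrt (by positivity)]; push_cast; ring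
    have h3 : β ≤ 2 * α := by
      apply le_of_sq_le_sq _ (by positivity)
      nlinarith
    have h4 : (β - α) * (β + α) = 1 := by ring_nf; linarith
    have : α⁻¹ ^ 3 ≤ 6 * (α⁻¹ - β⁻¹) := by
      rw [← sub_nonneg]
      have e2 : α⁻¹ - β⁻¹ = 1 / (α * β * (β + α)) := by
        field_simp; linarith
      rw [e2, sub_nonneg, inv_pow, ← one_div, mul_one_div, div_le_div_iff₀ (by positivity)
        (by positivity)]
      have : α * β * (β + α) ≤ α * (2 * α) * (2 * α + α) := by gcongr
      nlinarith
    linarith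

/-- The convolution of `j^(-1/2)` and `(N + j)^(-3/2)` is `O(N^(-1/2) (n + N)^(-1/2))`, because one of
the two arguments is always at least half of their sum. -/
theorem sum_mixed_le {N : ℕ} (hN : 1 ≤ N) (n : ℕ) :
    ∑ j ∈ Finset.range n, (Real.sqrt (j + 1 : ℕ))⁻¹ * (Real.sqrt (N + (n - 1 - j) : ℕ))⁻¹ ^ 3
      ≤ 8 * ((Real.sqrt N)⁻¹ * (Real.sqrt (n + N : ℕ))⁻¹) := by
  set s := Real.sqrt (n + N : ℕ)
  have hs : 0 < s := Real.sqrt_pos.2 (by positivity)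
  have hs2 : s ^ 2 = n + N := by rw [Real.sq_sqrt (by positivity)]; push_cast; ring
  have hN0 : 0 < Real.sqrt N := Real.sqrt_pos.2 (by positivity)
  have step : ∀ j ∈ Finset.range n,
      (Real.sqrt (j + 1 : ℕ))⁻¹ * (Real.sqrt (N + (n - 1 - j) : ℕ))⁻¹ ^ 3
      ≤ (s ^ 2)⁻¹ * (Real.sqrt N)⁻¹ * (Real.sqrt (j + 1 : ℕ))⁻¹
        + s⁻¹ * (Real.sqrt (N + (n - 1 - j) : ℕ))⁻¹ ^ 3 := by
    intro j hj
    have hj := Finset.mem_range.1 hj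
    have hle : Real.sqrt N ≤ Real.sqrt (N + (n - 1 - j) : ℕ) :=
      Real.sqrt_le_sqrt (by exact_mod_cast Nat.le_add_right _ _)
    have hle2 : Real.sqrt (j + 1 : ℕ) ≤ s := Real.sqrt_le_sqrt (by exact_mod_cast (by omega))
    have ha : Real.sqrt (j + 1 : ℕ) ^ 2 = (j : ℝ) + 1 := by
      rw [Real.sq_sqrt (by positivity)]; push_cast; ring
    have hb : Real.sqrt (N + (n - 1 - j) : ℕ) ^ 2 = (N : ℝ) + n - 1 - j := by
      rw [Real.sq_sqrt (by positivity)]; rw [Nat.cast_add, Nat.cast_sub (by omega),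
        Nat.cast_sub (by omega)]; push_cast; ring
    set α := Real.sqrt (j + 1 : ℕ)
    set β := Real.sqrt (N + (n - 1 - j) : ℕ)
    have hα : 0 < α := Real.sqrt_pos.2 (by positivity)
    have hβ : 0 < β := lt_of_lt_of_le hN0 hle
    have hab : α ^ 2 + β ^ 2 = s ^ 2 := by rw [ha, hb, hs2]; ring
    have e : α⁻¹ * β⁻¹ ^ 3 = (s ^ 2)⁻¹ * β⁻¹ * α⁻¹ + (s ^ 2)⁻¹ * α * β⁻¹ ^ 3 := by
      rw [← hab]; field_simp; ring
    rw [e]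
    have h1 : β⁻¹ ≤ (Real.sqrt N)⁻¹ := inv_anti₀ hN0 hle
    have h2 : (s ^ 2)⁻¹ * α ≤ s⁻¹ := by
      calc (s ^ 2)⁻¹ * α ≤ (s ^ 2)⁻¹ * s := by gcongr
        _ = s⁻¹ := by field_simp
    gcongr
  refine (Finset.sum_le_sum step).trans ?_
  rw [Finset.sum_add_distrib, ← Finset.mul_sum, ← Finset.mul_sum]
  have r := Finset.sum_range_reflect (fun j => (Real.sqrt (N + j : ℕ))⁻¹ ^ 3) n
  rw [r]
  have b1 := sum_inv_sqrt_le n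
  have b2 := sum_inv_sqrt_cube_le hN n
  have b3 : Real.sqrt n ≤ s := Real.sqrt_le_sqrt (by exact_mod_cast Nat.le_add_right _ _)
  calc _ ≤ (s ^ 2)⁻¹ * (Real.sqrt N)⁻¹ * (2 * s) + s⁻¹ * (6 * (Real.sqrt N)⁻¹) := by
        gcongr; linarith
    _ = 8 * ((Real.sqrt N)⁻¹ * s⁻¹) := by field_simp; ring

/-- Exchanging the `n` factors one by one, after a smoothing of variance `N`; the step that leaves `k`
factors costs the error already known for `k` of them. -/
theorem abs_convPow_smoothed_le (μ : Measure ℝ) [IsProbabilityMeasure μ]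
    (i3 : Integrable (fun x : ℝ => |x| ^ 3) μ)
    (m1 : ∫ x, x ∂μ = 0) (m2 : ∫ x, x ^ 2 ∂μ = 1) {N : ℕ} (hN : 1 ≤ N) {n : ℕ} (hn : 1 ≤ n) (z : ℝ) :
    |(convPow μ n ∗ gaussianReal 0 (N : NNReal)).real (Set.Iic z) - gcdf (n + N) z|
      ≤ ((Real.sqrt n)⁻¹ + phiThreeNorm * ∑ k ∈ Finset.range n, ksDist μ k *
          (Real.sqrt (N + (n - 1 - k) : ℕ))⁻¹ ^ 3) *
        (∫ x, |x| ^ 3 ∂μ + ∫ x, |x| ^ 3 ∂(gaussianReal 0 1)) := by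
  set ρ := ∫ x, |x| ^ 3 ∂μ + ∫ x, |x| ^ 3 ∂(gaussianReal 0 1)
  have hρ : 0 ≤ ρ := add_nonneg (integral_nonneg fun _ => by positivity)
    (integral_nonneg fun _ => by positivity)
  set f : ℕ → ℝ := fun j =>
    (convPow μ j ∗ gaussianReal 0 ((N + (n - j) : ℕ) : NNReal)).real (Set.Iic z) with hf
  have h0 : gcdf (n + N) z = f 0 := by
    simp [hf, convPow, gcdf, add_comm]
  have hn' : (convPow μ n ∗ gaussianReal 0 (N : NNReal)).real (Set.Iic z) = f n := by simp [hf]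
  rw [h0, hn', ← Finset.sum_range_sub]
  refine (Finset.abs_sum_le_sum_abs _ _).trans ?_
  have hn0 : 0 < Real.sqrt n := Real.sqrt_pos.2 (by exact_mod_cast hn)
  have step : ∀ k ∈ Finset.range n, |f (k + 1) - f k| ≤ ((Real.sqrt n)⁻¹ ^ 3 + phiThreeNorm *
      (ksDist μ k * (Real.sqrt (N + (n - 1 - k) : ℕ))⁻¹ ^ 3)) * ρ := by
    intro k hk
    have hk := Finset.mem_range.1 hk
    have := abs_swap_le μ i3 m1 m2 k (m := N + (n - 1 - k)) (by omega) z
    have e1 : N + (n - 1 - k) + 1 = N + (n - k) := by omega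
    have e2 : N + (n - 1 - k) = N + (n - (k + 1)) := by omega
    rw [e1] at this
    simp only [hf, ← e2]
    refine this.trans (mul_le_mul_of_nonneg_right (add_le_add ?_ (by rw [← mul_assoc, mul_comm]))
      hρ)
    have : Real.sqrt n ≤ Real.sqrt (k + (N + (n - 1 - k)) : ℕ) :=
      Real.sqrt_le_sqrt (by exact_mod_cast (by omega))
    gcongr
  refine (Finset.sum_le_sum step).trans ?_
  rw [← Finset.sum_mul, Finset.sum_add_distrib, ← Finset.mul_sum]
  refine mul_le_mul_of_nonneg_right (add_le_add (le_of_eq ?_) le_rfl) hρ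
  rw [Finset.sum_const, Finset.card_range, nsmul_eq_mul]
  have : (n : ℝ) = Real.sqrt n ^ 2 := (Real.sq_sqrt (by positivity)).symm
  nth_rewrite 1 [this]
  field_simp

/-- A recursive bound for the Kolmogorov distance.  Undoing the smoothing costs `O((N / n)^(1/2))`. -/
theorem ksDist_le (μ : Measure ℝ) [IsProbabilityMeasure μ]
    (i3 : Integrable (fun x : ℝ => |x| ^ 3) μ)
    (m1 : ∫ x, x ∂μ = 0) (m2 : ∫ x, x ^ 2 ∂μ = 1) {N : ℕ} (hN : 1 ≤ N) {n : ℕ} (hn : 1 ≤ n) :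
    ksDist μ n ≤ 6 * Real.sqrt N * (Real.sqrt n)⁻¹ +
      2 * (((Real.sqrt n)⁻¹ + phiThreeNorm * ∑ k ∈ Finset.range n, ksDist μ k *
          (Real.sqrt (N + (n - 1 - k) : ℕ))⁻¹ ^ 3) *
        (∫ x, |x| ^ 3 ∂μ + ∫ x, |x| ^ 3 ∂(gaussianReal 0 1))) := by
  set E := (((Real.sqrt n)⁻¹ + phiThreeNorm * ∑ k ∈ Finset.range n, ksDist μ k *
          (Real.sqrt (N + (n - 1 - k) : ℕ))⁻¹ ^ 3) *
        (∫ x, |x| ^ 3 ∂μ + ∫ x, |x| ^ 3 ∂(gaussianReal 0 1)))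
  have hn0 : 0 < Real.sqrt n := Real.sqrt_pos.2 (by exact_mod_cast hn)
  have hmF : Monotone fun z => (convPow μ n).real (Set.Iic z) :=
    fun _ _ h => measureReal_mono (Set.Iic_subset_Iic.2 h)
  have hmG : Monotone (gcdf n) := fun _ _ h => measureReal_mono (Set.Iic_subset_Iic.2 h)
  have hint : ∀ (f : ℝ → ℝ), Monotone f → (∀ x, 0 ≤ f x) → (∀ x, f x ≤ 1) → ∀ z,
      Integrable (fun s => f (z - s)) (gaussianReal 0 (N : NNReal)) := fun f hf h0 h1 z => by
    refine Integrable.of_bound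
      ((hf.measurable.comp (measurable_const.sub measurable_id)).aestronglyMeasurable) 1
      (Filter.Eventually.of_forall fun s => ?_)
    rw [Real.norm_eq_abs, abs_of_nonneg (h0 _)]; exact h1 _
  have main : ∀ z, |(convPow μ n).real (Set.Iic z) - gcdf n z|
      ≤ 2 * (2 * Real.sqrt N) * (Real.sqrt n)⁻¹ + 4 / 3 * (E + ksDist μ n / 4) := by
    refine abs_sub_le_of_smoothed hmF (by positivity) ?_ hmG.measurable
      (gaussianReal 0 (N : NNReal)) (gaussian_tail_le N hN)
      (abs_convPow_sub_gcdf_le μ n) ?_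
    · intro x y hxy
      rw [gcdf_eq hn, gcdf_eq hn]
      have := stdCDF_sub_le (div_le_div_of_nonneg_right hxy hn0.le)
      rw [← sub_div, div_eq_inv_mul (y - x)] at this
      exact this
    · intro z
      have := abs_convPow_smoothed_le μ i3 m1 m2 hN hn z
      rw [integral_sub (hint _ hmF (fun _ => measureReal_nonneg) (fun _ => measureReal_le_one) z)
        (hint _ hmG (fun _ => measureReal_nonneg) (fun _ => measureReal_le_one) z)]
      rw [Measure.conv_comm, conv_real_Iic] at this
      have e : gcdf (n + N) z = ∫ s, gcdf n (z - s) ∂(gaussianReal 0 (N : NNReal)) := by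
        unfold gcdf
        rw [← conv_real_Iic, gaussian_conv_nat, add_comm]
      rwa [e] at this
  have : ksDist μ n ≤ 2 * (2 * Real.sqrt N) * (Real.sqrt n)⁻¹ + 4 / 3 * (E + ksDist μ n / 4) :=
    ciSup_le main
  linarith

/-- The Berry–Esseen bound for convolution powers, by induction on their number. -/
theorem exists_ksDist_le (μ : Measure ℝ) [IsProbabilityMeasure μ]
    (i3 : Integrable (fun x : ℝ => |x| ^ 3) μ)
    (m1 : ∫ x, x ∂μ = 0) (m2 : ∫ x, x ^ 2 ∂μ = 1) :
    ∃ C : ℝ, 0 ≤ C ∧ ∀ n, ksDist μ n ≤ C * (Real.sqrt (n + 1 : ℕ))⁻¹ := by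
  set ρ := ∫ x, |x| ^ 3 ∂μ + ∫ x, |x| ^ 3 ∂(gaussianReal 0 1) with hρd
  have hρ : 0 ≤ ρ := add_nonneg (integral_nonneg fun _ => by positivity)
    (integral_nonneg fun _ => by positivity)
  have hc := phiThreeNorm_nonneg
  -- with this smoothing the induction hypothesis enters with a factor at most `1 / 2`
  obtain ⟨N, hN⟩ := exists_nat_ge (max 1 ((32 * ρ * phiThreeNorm) ^ 2))
  have hN1 : 1 ≤ N := by exact_mod_cast (le_max_left _ _).trans hN
  have hN2 : 32 * ρ * phiThreeNorm ≤ Real.sqrt N :=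
    Real.le_sqrt_of_sq_le ((le_max_right _ _).trans hN)
  have hN0 : 0 < Real.sqrt N := Real.sqrt_pos.2 (by exact_mod_cast hN1)
  set C := 2 * (4 * ρ + 12 * Real.sqrt N) with hC
  have hC0 : 0 ≤ C := by positivity
  refine ⟨C, hC0, fun n => ?_⟩
  induction n using Nat.strong_induction_on with
  | _ n ih =>
  rcases Nat.eq_zero_or_pos n with rfl | hn
  · rw [ksDist_zero]; positivity
  have h := ksDist_le μ i3 m1 m2 hN1 hn
  rw [← hρd] at h
  have hn0 : 0 < Real.sqrt n := Real.sqrt_pos.2 (by exact_mod_cast hn)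
  have hn1 : 0 < Real.sqrt (n + 1 : ℕ) := Real.sqrt_pos.2 (by positivity)
  have s1 : (Real.sqrt n)⁻¹ ≤ 2 * (Real.sqrt (n + 1 : ℕ))⁻¹ := by
    have hn' : (1 : ℝ) ≤ n := by exact_mod_cast hn
    have : Real.sqrt (n + 1 : ℕ) ≤ 2 * Real.sqrt n := by
      apply Real.sqrt_le_iff.2 ⟨by positivity, ?_⟩
      rw [mul_pow, Real.sq_sqrt (by positivity)]; push_cast; linarith
    rw [← div_eq_mul_inv, inv_eq_one_div, div_le_div_iff₀ hn0 hn1]; linarith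
  have s2 : ∑ k ∈ Finset.range n, ksDist μ k * (Real.sqrt (N + (n - 1 - k) : ℕ))⁻¹ ^ 3
      ≤ C * (8 * ((Real.sqrt N)⁻¹ * (Real.sqrt (n + 1 : ℕ))⁻¹)) := by
    calc _ ≤ ∑ k ∈ Finset.range n, C * ((Real.sqrt (k + 1 : ℕ))⁻¹ *
          (Real.sqrt (N + (n - 1 - k) : ℕ))⁻¹ ^ 3) := by
          refine Finset.sum_le_sum fun k hk => ?_
          rw [← mul_assoc]
          exact mul_le_mul_of_nonneg_right (ih k (Finset.mem_range.1 hk)) (by positivity)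
      _ ≤ C * (8 * ((Real.sqrt N)⁻¹ * (Real.sqrt (n + N : ℕ))⁻¹)) := by
          rw [← Finset.mul_sum]
          exact mul_le_mul_of_nonneg_left (sum_mixed_le hN1 n) hC0
      _ ≤ _ := by
          have : Real.sqrt (n + 1 : ℕ) ≤ Real.sqrt (n + N : ℕ) :=
            Real.sqrt_le_sqrt (by exact_mod_cast (by omega))
          gcongr
  set τ := (Real.sqrt (n + 1 : ℕ))⁻¹
  have hτ : 0 < τ := by positivity
  have s3 : phiThreeNorm * (C * (8 * ((Real.sqrt N)⁻¹ * τ))) * ρ ≤ C * τ / 4 := by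
    have : 32 * ρ * phiThreeNorm * (Real.sqrt N)⁻¹ ≤ 1 := by
      rw [← div_eq_mul_inv]; exact (div_le_one hN0).2 hN2
    have := mul_le_mul_of_nonneg_right this (mul_nonneg hC0 hτ.le)
    linarith
  calc ksDist μ n ≤ 6 * Real.sqrt N * (2 * τ) + 2 * ((2 * τ + phiThreeNorm *
        (C * (8 * ((Real.sqrt N)⁻¹ * τ)))) * ρ) := by
        refine h.trans ?_
        gcongr
    _ ≤ 12 * Real.sqrt N * τ + 4 * ρ * τ + C * τ / 2 := by linarith
    _ = C * τ := by rw [hC]; ring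

/-- A sum of i.i.d. variables has a convolution power as its law. -/
theorem map_sum_pi_eq_convPow {Ω : Type*} [MeasurableSpace Ω] (J : Measure Ω)
    [IsProbabilityMeasure J] {g : Ω → ℝ} (hg : Measurable g) (n : ℕ) :
    (Measure.pi fun _ : Fin n => J).map (fun ω => ∑ i, g (ω i)) = convPow (J.map g) n := by
  have : IsProbabilityMeasure (J.map g) := Measure.isProbabilityMeasure_map hg.aemeasurable
  induction n with
  | zero =>
    simp only [Finset.univ_eq_empty, Finset.sum_empty, convPow]
    rw [Measure.map_const]; simp
  | succ n ih =>
    have h := (measurePreserving_piFinSuccAbove (fun _ : Fin (n + 1) => J) 0)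
    have e : (fun ω : Fin (n + 1) → Ω => ∑ i, g (ω i))
        = (fun p : Ω × (Fin n → Ω) => g p.1 + ∑ i, g (p.2 i))
          ∘ (MeasurableEquiv.piFinSuccAbove (fun _ : Fin (n + 1) => Ω) 0) := by
      funext ω
      simp [Fin.sum_univ_succ, MeasurableEquiv.piFinSuccAbove, Fin.insertNthEquiv, Fin.tail]
    rw [e, ← Measure.map_map (by fun_prop) (MeasurableEquiv.measurable _), h.map_eq, convPow,
      Measure.conv_comm, ← ih, Measure.conv, Measure.map_prod_map _ _ hg (by fun_prop),
      Measure.map_map (by fun_prop) (by fun_prop)]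
    rfl

/-- **Berry–Esseen theorem** for sums of i.i.d. real random variables, on the product space, with a
constant that depends on the law. -/
theorem berry_esseen {Ω : Type*} [MeasurableSpace Ω] (J : Measure Ω) [IsProbabilityMeasure J]
    {f : Ω → ℝ} (hf : Measurable f) (hV : 0 < variance f J)
    (h3 : Integrable (fun ω => |f ω - ∫ x, f x ∂J| ^ 3) J) :
    ∃ B : ℝ, 0 ≤ B ∧ ∀ n : ℕ, 1 ≤ n → ∀ x : ℝ,
      |(Measure.pi fun _ : Fin n => J).real
        {ω | ∑ i, f (ω i) ≤ n * (∫ x, f x ∂J) + Real.sqrt (n * variance f J) * x}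
        - stdCDF x| ≤ B * (Real.sqrt n)⁻¹ := by
  set m := ∫ x, f x ∂J
  set V := variance f J with hVd
  have hs : 0 < Real.sqrt V := Real.sqrt_pos.2 hV
  set g : Ω → ℝ := fun ω => (f ω - m) / Real.sqrt V with hgd
  have hg : Measurable g := by fun_prop
  have : IsProbabilityMeasure (J.map g) := Measure.isProbabilityMeasure_map hg.aemeasurable
  have hfm : MemLp f 2 J := by
    by_contra h
    rw [hVd, variance_of_not_memLp hf.aestronglyMeasurable h] at hV
    exact lt_irrefl _ hV
  have hfi : Integrable f J := hfm.integrable (by norm_num)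
  have i3 : Integrable (fun x : ℝ => |x| ^ 3) (J.map g) := by
    rw [integrable_map_measure (by fun_prop) hg.aemeasurable]
    refine (h3.div_const (Real.sqrt V ^ 3)).congr (Filter.Eventually.of_forall fun ω => ?_)
    simp [hgd, abs_div, div_pow, abs_of_pos hs]
  have m1 : ∫ x, x ∂(J.map g) = 0 := by
    rw [integral_map hg.aemeasurable (by fun_prop)]
    simp only [hgd]
    rw [integral_div, integral_sub hfi (integrable_const _)]
    simp [m]
  have m2 : ∫ x, x ^ 2 ∂(J.map g) = 1 := by
    rw [integral_map hg.aemeasurable (by fun_prop)]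
    simp only [hgd, div_pow]
    rw [integral_div, ← variance_eq_integral hf.aemeasurable, Real.sq_sqrt hV.le]
    exact div_self hV.ne'
  obtain ⟨C, hC0, hC⟩ := exists_ksDist_le (J.map g) i3 m1 m2
  refine ⟨C, hC0, fun n hn x => ?_⟩
  have hn0 : 0 < Real.sqrt n := Real.sqrt_pos.2 (by exact_mod_cast hn)
  have h := abs_convPow_sub_gcdf_le (J.map g) n (Real.sqrt n * x)
  rw [gcdf_eq hn, mul_div_cancel_left₀ _ hn0.ne', ← map_sum_pi_eq_convPow J hg,
    map_measureReal_apply (by fun_prop) measurableSet_Iic] at h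
  have e : (fun ω : Fin n → Ω => ∑ i, g (ω i)) ⁻¹' Set.Iic (Real.sqrt n * x)
      = {ω | ∑ i, f (ω i) ≤ n * m + Real.sqrt (n * V) * x} := by
    ext ω
    simp only [hgd, Set.mem_preimage, Set.mem_Iic, Set.mem_ofPred_eq]
    rw [← Finset.sum_div, div_le_iff₀ hs, Finset.sum_sub_distrib, Real.sqrt_mul (by positivity)]
    simp only [Finset.sum_const, Finset.card_univ, Fintype.card_fin, nsmul_eq_mul]
    constructor <;> intro h <;> nlinarith
  rw [e] at h
  refine h.trans ((hC n).trans ?_)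
  have : Real.sqrt n ≤ Real.sqrt (n + 1 : ℕ) := Real.sqrt_le_sqrt (by exact_mod_cast Nat.le_succ n)
  gcongr

end

/-! ### Gaussian quantiles, and tests by empirical frequencies -/

noncomputable section

theorem stdCDF_neg_eq_gaussianQ (x : ℝ) : gaussianQ x = stdCDF (-x) := by
  rw [stdCDF_eq_integral, ← integral_comp_neg_Ioi, gaussianQ, ← integral_const_mul]
  simp [stdPhi]

theorem continuous_stdCDF : Continuous stdCDF :=
  continuous_iff_continuousAt.2 fun x => (hasDerivAt_stdCDF x).continuousAt

theorem exists_stdCDF_eq {p : ℝ} (h0 : 0 < p) (h1 : p < 1) : ∃ x, stdCDF x = p := by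
  have e : stdCDF = cdf (gaussianReal 0 1) := by
    funext x; rw [cdf_eq_real, stdCDF]
  have hb : Filter.Tendsto stdCDF Filter.atBot (nhds 0) := e ▸ tendsto_cdf_atBot _
  have ht : Filter.Tendsto stdCDF Filter.atTop (nhds 1) := e ▸ tendsto_cdf_atTop _
  obtain ⟨a, ha⟩ := (hb.eventually (ge_mem_nhds h0)).exists
  obtain ⟨b, hb⟩ := (ht.eventually (le_mem_nhds h1)).exists
  exact mem_range_of_exists_le_of_exists_ge continuous_stdCDF ⟨a, ha⟩ ⟨b, hb⟩

theorem stdCDF_neg_gaussianQInv {ε : ℝ} (h0 : 0 < ε) (h1 : ε < 1) :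
    stdCDF (-gaussianQInv ε) = ε := by
  rw [← stdCDF_neg_eq_gaussianQ, gaussianQInv]
  apply Function.invFun_eq
  obtain ⟨x, hx⟩ := exists_stdCDF_eq h0 h1
  exact ⟨-x, by rw [stdCDF_neg_eq_gaussianQ, neg_neg, hx]⟩

/-- A lower bound for the local slope of the Gaussian distribution function. -/
theorem stdCDF_sub_le_sub_mul (q : ℝ) {h : ℝ} (h0 : 0 ≤ h) (h1 : h ≤ 1) :
    stdCDF (-q - h) ≤ stdCDF (-q) - stdPhi (|q| + 1) * h := by
  rcases h0.eq_or_lt with rfl | h0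
  · simp
  obtain ⟨c, hc, he⟩ := exists_hasDerivAt_eq_slope stdCDF stdPhi (a := -q - h) (b := -q)
    (by linarith) continuous_stdCDF.continuousOn fun x _ => hasDerivAt_stdCDF x
  have hcq : |c| ≤ |q| + 1 := by
    have := hc.1; have := hc.2; have := le_abs_self q; have := neg_abs_le q
    rw [abs_le]; constructor <;> linarith
  have : stdPhi (|q| + 1) ≤ stdPhi c := by
    unfold stdPhi
    have : c ^ 2 ≤ (|q| + 1) ^ 2 := by
      rw [← sq_abs c]; gcongr
    gcongr
  rw [he, show -q - (-q - h) = h by ring, le_div_iff₀ h0] at this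
  linarith

/-- Chebyshev's inequality for i.i.d. sums on a product space. -/
theorem pi_chebyshev {Ω : Type*} [MeasurableSpace Ω] (J : Measure Ω) [IsProbabilityMeasure J]
    {f : Ω → ℝ} (hf : MemLp f 2 J) (n : ℕ) {c : ℝ} (hc : 0 < c) :
    (Measure.pi fun _ : Fin n => J).real {ω | c ≤ |∑ i, f (ω i) - n * ∫ x, f x ∂J|}
      ≤ n * variance f J / c ^ 2 := by
  have hmp : ∀ i : Fin n, MeasurePreserving (fun ω : Fin n → Ω => ω i)
      (Measure.pi fun _ : Fin n => J) J := fun i => measurePreserving_eval (fun _ => J) i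
  have hL : ∀ i : Fin n, MemLp (fun ω : Fin n → Ω => f (ω i)) 2 (Measure.pi fun _ : Fin n => J) :=
    fun i => hf.comp_measurePreserving (hmp i)
  have hS : MemLp (fun ω : Fin n → Ω => ∑ i, f (ω i)) 2 (Measure.pi fun _ : Fin n => J) :=
    memLp_finsetSum _ fun i _ => hL i
  have hE : ∫ ω : Fin n → Ω, ∑ i, f (ω i) ∂(Measure.pi fun _ : Fin n => J) = n * ∫ x, f x ∂J := by
    rw [integral_finsetSum _ fun i _ => (hL i).integrable (by norm_num)]
    have : ∀ i : Fin n, ∫ ω : Fin n → Ω, f (ω i) ∂(Measure.pi fun _ : Fin n => J) = ∫ x, f x ∂J :=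
      fun i => by
        conv_rhs => rw [← (hmp i).map_eq]
        rw [integral_map (hmp i).measurable.aemeasurable]
        rw [(hmp i).map_eq]; exact hf.aestronglyMeasurable
    simp [this]
  have hVar : variance (fun ω : Fin n → Ω => ∑ i, f (ω i)) (Measure.pi fun _ : Fin n => J)
      = n * variance f J := by
    have := variance_sum_pi (μ := fun _ : Fin n => J) (X := fun _ => f) (fun _ => hf)
    have e : (fun ω : Fin n → Ω => ∑ i, f (ω i)) = ∑ i : Fin n, fun ω : Fin n → Ω => f (ω i) := by
      ext ω; simp
    rw [e, this]; simp
  have h := meas_ge_le_variance_div_sq hS hc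
  rw [hE, hVar] at h
  exact ENNReal.toReal_le_of_le_ofReal
    (div_nonneg (mul_nonneg (by positivity) (variance_nonneg _ _)) (by positivity)) h

/-- Hoeffding's inequality for empirical frequencies. -/
theorem pi_hoeffding {Y : Type*} [MeasurableSpace Y] (μ : Measure Y) [IsProbabilityMeasure μ]
    {B : Set Y} (hB : MeasurableSet B) (n : ℕ) {τ : ℝ} (hτ : 0 ≤ τ) :
    (Measure.pi fun _ : Fin n => μ).real
      {y | n * τ ≤ |∑ i, B.indicator (fun _ => (1 : ℝ)) (y i) - n * μ.real B|}
      ≤ 2 * Real.exp (-(2 * τ ^ 2) * n) := by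
  set g : Y → ℝ := B.indicator fun _ => (1 : ℝ) with hg
  have hgm : Measurable g := measurable_const.indicator hB
  have hint : ∫ y, g y ∂μ = μ.real B := by
    rw [hg, integral_indicator hB]; simp
  have hsub0 : HasSubgaussianMGF (fun y => g y - μ.real B) ((‖(1 : ℝ) - 0‖₊ / 2) ^ 2) μ := by
    rw [← hint]
    refine hasSubgaussianMGF_of_mem_Icc hgm.aemeasurable (Filter.Eventually.of_forall fun y => ?_)
    by_cases h : y ∈ B <;> simp [hg, h]
  have hsub : ∀ i : Fin n, HasSubgaussianMGF (fun y : Fin n → Y => g (y i) - μ.real B)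
      ((‖(1 : ℝ) - 0‖₊ / 2) ^ 2) (Measure.pi fun _ : Fin n => μ) := fun i => by
    have hmp := measurePreserving_eval (fun _ : Fin n => μ) i
    refine HasSubgaussianMGF.of_map (Y := fun y : Fin n → Y => y i)
      (X := fun y => g y - μ.real B) hmp.measurable.aemeasurable ?_
    rw [show Measure.map (fun y : Fin n → Y => y i) (Measure.pi fun _ : Fin n => μ) = μ from
      hmp.map_eq]
    exact hsub0
  have hind : iIndepFun (fun (i : Fin n) (y : Fin n → Y) => g (y i) - μ.real B)
      (Measure.pi fun _ : Fin n => μ) :=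
    iIndepFun_pi (X := fun _ y => g y - μ.real B) fun _ => (hgm.sub_const _).aemeasurable
  have hindn : iIndepFun (fun (i : Fin n) (y : Fin n → Y) => -(g (y i) - μ.real B))
      (Measure.pi fun _ : Fin n => μ) :=
    iIndepFun_pi (X := fun _ y => -(g y - μ.real B)) fun _ => (hgm.sub_const _).neg.aemeasurable
  have h1 := HasSubgaussianMGF.measure_sum_ge_le_of_iIndepFun hind (s := Finset.univ)
    (fun i _ => hsub i) (ε := n * τ) (by positivity)
  have h2 := HasSubgaussianMGF.measure_sum_ge_le_of_iIndepFun hindn (s := Finset.univ)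
    (fun i _ => (hsub i).neg) (ε := n * τ) (by positivity)
  have he : -(n * τ) ^ 2 / (2 * ((∑ i ∈ (Finset.univ : Finset (Fin n)),
      ((‖(1 : ℝ) - 0‖₊ / 2) ^ 2 : NNReal) : NNReal) : ℝ)) = -(2 * τ ^ 2) * n := by
    rcases Nat.eq_zero_or_pos n with rfl | hn
    · simp
    · have : (n : ℝ) ≠ 0 := by positivity
      simp; field_simp
  simp only [NNReal.coe_sum] at he
  push_cast at h1 h2 he
  rw [he] at h1 h2
  have hsum : ∀ y : Fin n → Y, ∑ i, (g (y i) - μ.real B) = ∑ i, g (y i) - n * μ.real B :=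
    fun y => by simp
  have hsub' : {y : Fin n → Y | n * τ ≤ |∑ i, g (y i) - n * μ.real B|} ⊆
      {y | n * τ ≤ ∑ i, (g (y i) - μ.real B)} ∪ {y | n * τ ≤ ∑ i, -(g (y i) - μ.real B)} := by
    intro y hy
    simp only [Set.mem_ofPred_eq, Set.mem_union, Finset.sum_neg_distrib, hsum] at hy ⊢
    exact le_abs.1 hy
  calc _ ≤ _ := measureReal_mono hsub'
    _ ≤ _ := measureReal_union_le _ _
    _ ≤ _ := by linarith

/-- Finitely many laws on the line that are separated from `μ 0` in Kolmogorov distance can be told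
from it, by comparing empirical distribution functions at one point each, with exponentially small
error probabilities. -/
theorem exists_separating_test {Y : Type*} [MeasurableSpace Y] {φ : Y → ℝ} (hφ : Measurable φ)
    (μ : ℕ → Measure Y) [∀ k, IsProbabilityMeasure (μ k)] (K : ℕ) {δ : ℝ} (hδ : 0 < δ)
    (hsep : ∀ k, 1 ≤ k → k ≤ K →
      δ ≤ ⨆ x : ℝ, |(μ k).real {y | φ y ≤ x} - (μ 0).real {y | φ y ≤ x}|) :
    ∃ c : ℝ, 0 < c ∧ ∀ n : ℕ, ∃ A : Set (Fin n → Y), MeasurableSet A ∧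
      (Measure.pi fun _ : Fin n => μ 0).real Aᶜ ≤ 2 * K * Real.exp (-c * n) ∧
      ∀ k, 1 ≤ k → k ≤ K → (Measure.pi fun _ : Fin n => μ k).real A ≤ 2 * Real.exp (-c * n) := by
  have hx : ∀ k, ∃ x : ℝ, 1 ≤ k → k ≤ K →
      δ / 2 < |(μ k).real {y | φ y ≤ x} - (μ 0).real {y | φ y ≤ x}| := by
    intro k
    by_cases h : 1 ≤ k ∧ k ≤ K
    · obtain ⟨x, hx⟩ := exists_lt_of_lt_ciSup
        (lt_of_lt_of_le (half_lt_self hδ) (hsep k h.1 h.2))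
      exact ⟨x, fun _ _ => hx⟩
    · exact ⟨0, fun h1 h2 => absurd ⟨h1, h2⟩ h⟩
  choose x hx using hx
  set B : ℕ → Set Y := fun k => {y | φ y ≤ x k}
  have hB : ∀ k, MeasurableSet (B k) := fun k => measurableSet_le hφ measurable_const
  refine ⟨2 * (δ / 4) ^ 2, by positivity, fun n => ?_⟩
  set E : ℕ → Set (Fin n → Y) := fun k =>
    {y | n * (δ / 4) ≤ |∑ i, (B k).indicator (fun _ => (1 : ℝ)) (y i) - n * (μ 0).real (B k)|}
  have hE : ∀ k, MeasurableSet (E k) := fun k => by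
    refine measurableSet_le measurable_const (Measurable.abs (Measurable.sub_const ?_ _))
    exact Finset.measurable_sum _ fun i _ =>
      (measurable_const.indicator (hB k)).comp (measurable_pi_apply i)
  have hprob := fun (k : ℕ) => (inferInstance : IsProbabilityMeasure (Measure.pi fun _ : Fin n => μ k))
  refine ⟨⋂ k ∈ Finset.Icc 1 K, (E k)ᶜ, Finset.measurableSet_biInter _ fun k _ => (hE k).compl,
    ?_, ?_⟩
  · have : (⋂ k ∈ Finset.Icc 1 K, (E k)ᶜ)ᶜ = ⋃ k ∈ Finset.Icc 1 K, E k := by simp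
    rw [this]
    refine (measureReal_biUnion_finset_le _ _).trans ?_
    calc _ ≤ ∑ k ∈ Finset.Icc 1 K, 2 * Real.exp (-(2 * (δ / 4) ^ 2) * n) :=
          Finset.sum_le_sum fun k _ => pi_hoeffding (μ 0) (hB k) n (by positivity)
      _ = _ := by simp; ring
  · intro k h1 h2
    rcases Nat.eq_zero_or_pos n with rfl | hn
    · refine (measureReal_le_one (μ := Measure.pi fun _ : Fin 0 => μ k)).trans ?_
      simp
    have hn0 : (0 : ℝ) < n := by exact_mod_cast hn
    refine (measureReal_mono ?_).trans (pi_hoeffding (μ k) (hB k) n (τ := δ / 4) (by positivity))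
    intro y hy
    have hy := Set.mem_iInter₂.1 hy k (Finset.mem_Icc.2 ⟨h1, h2⟩)
    simp only [E, Set.mem_compl_iff, Set.mem_ofPred_eq, not_le] at hy ⊢
    have hk := hx k h1 h2
    set S := ∑ i, (B k).indicator (fun _ => (1 : ℝ)) (y i)
    have h3 : n * (δ / 2) ≤ |n * (μ k).real (B k) - n * (μ 0).real (B k)| := by
      rw [← mul_sub, abs_mul, abs_of_pos hn0]
      exact mul_le_mul_of_nonneg_left hk.le hn0.le
    have h4 := abs_sub_le (n * (μ k).real (B k)) S (n * (μ 0).real (B k))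
    rw [abs_sub_comm _ S] at h4
    linarith

end

/-! ### Product measures and divergence -/

noncomputable section

/-- The coordinates of a product measure along an injection have the product law. -/
theorem pi_map_injective {ι κ α : Type*} [Fintype ι] [Fintype κ] [MeasurableSpace α]
    (μ : κ → Measure α) [∀ j, IsProbabilityMeasure (μ j)] {a : ι → κ} (ha : Function.Injective a) :
    (Measure.pi μ).map (fun x i => x (a i)) = Measure.pi fun i => μ (a i) := by
  classical
  symm
  refine Measure.pi_eq fun s hs => ?_
  rw [Measure.map_apply (by fun_prop) (MeasurableSet.univ_pi hs)]
  set s' : κ → Set α := Function.extend a s fun _ => Set.univ with hs'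
  have e : (fun (x : κ → α) i => x (a i)) ⁻¹' Set.univ.pi s = Set.univ.pi s' := by
    ext x
    simp only [Set.mem_preimage, Set.mem_univ_pi]
    constructor
    · intro h j
      by_cases hj : ∃ i, a i = j
      · obtain ⟨i, rfl⟩ := hj
        rw [hs', ha.extend_apply]; exact h i
      · rw [hs', Function.extend_apply' _ _ _ hj]; trivial
    · intro h i
      have := h (a i)
      rwa [hs', ha.extend_apply] at this
  rw [e, Measure.pi_pi]
  symm
  calc ∏ i, μ (a i) (s i) = ∏ i, μ (a i) (s' (a i)) := by simp [hs', ha.extend_apply]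
    _ = ∏ j ∈ Finset.univ.image a, μ j (s' j) := by
        rw [Finset.prod_image (fun i _ j _ h => ha h)]
    _ = ∏ j, μ j (s' j) := by
        refine Finset.prod_subset (Finset.subset_univ _) fun j _ hj => ?_
        have : ¬ ∃ i, a i = j := by simpa using hj
        rw [hs', Function.extend_apply' _ _ _ this, measure_univ]

/-- Choosing each coordinate from one of two independent i.i.d. vectors, without repetition. -/
theorem prod_pi_map_elim {ι κ κ' α : Type*} [Fintype ι] [Fintype κ] [Fintype κ']
    [MeasurableSpace α] (P : Measure α) [IsProbabilityMeasure P] {c : ι → κ ⊕ κ'}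
    (hc : Function.Injective c) :
    ((Measure.pi fun _ : κ => P).prod (Measure.pi fun _ : κ' => P)).map
      (fun p i => Sum.elim p.1 p.2 (c i)) = Measure.pi fun _ : ι => P := by
  have h := measurePreserving_sumPiEquivProdPi_symm (X := fun _ : κ ⊕ κ' => α) (fun _ => P)
  have h2 := pi_map_injective (fun _ : κ ⊕ κ' => P) hc
  rw [← h2]
  have hm : Measurable fun (x : κ ⊕ κ' → α) i => x (c i) := by fun_prop
  rw [← h.map_eq, Measure.map_map hm (MeasurableEquiv.measurable _)]
  congr 1

theorem lintegral_pi_prod {ι α : Type*} [Fintype ι] [MeasurableSpace α]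
    (μ : ι → Measure α) [∀ j, IsProbabilityMeasure (μ j)] {f : ι → α → ℝ≥0∞}
    (hf : ∀ i, Measurable (f i)) :
    ∫⁻ x, ∏ i, f i (x i) ∂(Measure.pi μ) = ∏ i, ∫⁻ x, f i x ∂(μ i) := by
  have h := lintegral_prod_eq_prod_lintegral_of_indepFun Finset.univ
    (fun (i : ι) (x : ι → α) => f i (x i)) (iIndepFun_pi (μ := μ) fun i => (hf i).aemeasurable)
    (fun i => (hf i).comp (measurable_pi_apply i))
  refine h.trans ?_
  refine Finset.prod_congr rfl fun i _ => ?_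
  have := (measurePreserving_eval μ i)
  conv_rhs => rw [← this.map_eq, lintegral_map (hf i) this.measurable]

/-- The product of the laws `κ (x i)`, as a kernel in `x`. -/
def piKernel {α β : Type*} [MeasurableSpace α] [MeasurableSpace β] (ι : Type*) [Fintype ι]
    (κ : Kernel α β) [IsMarkovKernel κ] : Kernel (ι → α) (ι → β) where
  toFun x := Measure.pi fun i => κ (x i)
  measurable' := by
    refine Measurable.measure_of_isPiSystem_of_isProbabilityMeasure
      (S := Set.univ.pi '' Set.univ.pi fun _ : ι => {s : Set β | MeasurableSet s})
      generateFrom_pi.symm isPiSystem_pi ?_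
    rintro _ ⟨s, hs, rfl⟩
    simp only [Measure.pi_pi]
    refine Finset.measurable_prod _ fun i _ => ?_
    exact (κ.measurable_coe (hs i trivial)).comp (measurable_pi_apply i)

theorem piKernel_apply {α β : Type*} [MeasurableSpace α] [MeasurableSpace β] (ι : Type*) [Fintype ι]
    (κ : Kernel α β) [IsMarkovKernel κ] (x : ι → α) :
    piKernel ι κ x = Measure.pi fun i => κ (x i) := rfl

instance {α β : Type*} [MeasurableSpace α] [MeasurableSpace β] (ι : Type*) [Fintype ι]
    (κ : Kernel α β) [IsMarkovKernel κ] : IsMarkovKernel (piKernel ι κ) :=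
  ⟨fun x => by rw [piKernel_apply]; infer_instance⟩

/-- A memoryless channel with i.i.d. inputs has i.i.d. input-output pairs. -/
theorem pi_compProd_piKernel {α β ι : Type*} [MeasurableSpace α] [MeasurableSpace β] [Fintype ι]
    (P : Measure α) [IsProbabilityMeasure P] (κ : Kernel α β) [IsMarkovKernel κ] :
    ((Measure.pi fun _ : ι => P) ⊗ₘ piKernel ι κ).map (fun p i => (p.1 i, p.2 i))
      = Measure.pi fun _ : ι => P ⊗ₘ κ := by
  symm
  refine Measure.pi_eq fun s hs => ?_
  have hm : Measurable fun (p : (ι → α) × (ι → β)) (i : ι) => (p.1 i, p.2 i) := by fun_prop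
  rw [Measure.map_apply hm (MeasurableSet.univ_pi hs),
    Measure.compProd_apply (hm (MeasurableSet.univ_pi hs))]
  have e : ∀ x : ι → α, (Prod.mk x ⁻¹' ((fun (p : (ι → α) × (ι → β)) (i : ι) => (p.1 i, p.2 i)) ⁻¹'
      Set.univ.pi s)) = Set.univ.pi fun i => Prod.mk (x i) ⁻¹' s i := fun x => by
    ext y; simp
  simp_rw [e, piKernel_apply, Measure.pi_pi]
  rw [lintegral_pi_prod (fun _ : ι => P) (f := fun i x => κ x (Prod.mk x ⁻¹' s i))
    fun i => Kernel.measurable_kernel_prodMk_left (hs i)]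
  exact Finset.prod_congr rfl fun i _ => (Measure.compProd_apply (hs i)).symm

/-- Probability, averaged over i.i.d. inputs `x`, of an event about the letters `a i` of the input
and the output of a memoryless channel. -/
theorem lintegral_pi_channel {α β ι ι' : Type*} [MeasurableSpace α] [MeasurableSpace β] [Fintype ι]
    [Fintype ι'] (P : Measure α) [IsProbabilityMeasure P] (κ : Kernel α β) [IsMarkovKernel κ]
    {a : ι → ι'} (ha : Function.Injective a) {A : Set (ι → α × β)} (hA : MeasurableSet A) :
    ∫⁻ x, (Measure.pi fun i => κ (x (a i))) {y | (fun i => (x (a i), y i)) ∈ A}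
      ∂(Measure.pi fun _ : ι' => P) = (Measure.pi fun _ : ι => P ⊗ₘ κ) A := by
  have hm : Measurable fun (p : (ι → α) × (ι → β)) (i : ι) => (p.1 i, p.2 i) := by fun_prop
  rw [← pi_compProd_piKernel, Measure.map_apply hm hA, Measure.compProd_apply (hm hA),
    ← pi_map_injective (fun _ : ι' => P) ha,
    lintegral_map (Kernel.measurable_kernel_prodMk_left (hm hA)) (by fun_prop)]
  rfl

theorem measurable_pi_channel {α β ι ι' : Type*} [MeasurableSpace α] [MeasurableSpace β] [Fintype ι]
    (κ : Kernel α β) [IsMarkovKernel κ] (a : ι → ι') {A : Set (ι → α × β)} (hA : MeasurableSet A) :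
    Measurable fun x : ι' → α =>
      (Measure.pi fun i => κ (x (a i))) {y | (fun i => (x (a i), y i)) ∈ A} := by
  have hm : Measurable fun (p : (ι → α) × (ι → β)) (i : ι) => (p.1 i, p.2 i) := by fun_prop
  exact (Kernel.measurable_kernel_prodMk_left (κ := piKernel ι κ) (hm hA)).comp
    (g := fun y => piKernel ι κ y _) (f := fun (x : ι' → α) i => x (a i)) (by fun_prop)

/-- Gibbs' inequality: `E h ≤ 0` if `E exp h ≤ 1`, with equality only for `h = 0`. -/
theorem integral_nonpos_of_lintegral_exp_le {Ω : Type*} [MeasurableSpace Ω] {J : Measure Ω}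
    [IsProbabilityMeasure J] {h : Ω → ℝ} (hh : Integrable h J)
    (hexp : ∫⁻ ω, ENNReal.ofReal (Real.exp (h ω)) ∂J ≤ 1) :
    ∫ ω, h ω ∂J ≤ 0 ∧ (0 ≤ ∫ ω, h ω ∂J → h =ᵐ[J] 0) := by
  have hm : AEStronglyMeasurable (fun ω => Real.exp (h ω)) J :=
    Real.continuous_exp.comp_aestronglyMeasurable hh.aestronglyMeasurable
  have hi : Integrable (fun ω => Real.exp (h ω)) J := by
    refine ⟨hm, ?_⟩
    rw [hasFiniteIntegral_iff_ofReal (Filter.Eventually.of_forall fun ω => (Real.exp_pos _).le)]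
    exact hexp.trans_lt ENNReal.one_lt_top
  have h1 : ∫ ω, Real.exp (h ω) ∂J ≤ 1 := by
    rw [integral_eq_lintegral_of_nonneg_ae (Filter.Eventually.of_forall fun ω => (Real.exp_pos _).le)
      hm]
    exact ENNReal.toReal_le_of_le_ofReal zero_le_one (by simpa using hexp)
  have hi1 : Integrable (fun ω => Real.exp (h ω) - 1) J := hi.sub (integrable_const 1)
  have hi2 : Integrable (fun ω => Real.exp (h ω) - 1 - h ω) J := hi1.sub hh
  have hnn : ∀ ω, 0 ≤ Real.exp (h ω) - 1 - h ω := fun ω => by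
    linarith [Real.add_one_le_exp (h ω)]
  have he : ∫ ω, (Real.exp (h ω) - 1 - h ω) ∂J = ∫ ω, Real.exp (h ω) ∂J - 1 - ∫ ω, h ω ∂J := by
    rw [integral_sub hi1 hh, integral_sub hi (integrable_const 1)]
    simp
  have h2 : 0 ≤ ∫ ω, (Real.exp (h ω) - 1 - h ω) ∂J := integral_nonneg hnn
  refine ⟨by linarith, fun h0 => ?_⟩
  have h3 : ∫ ω, (Real.exp (h ω) - 1 - h ω) ∂J = 0 := le_antisymm (by linarith) h2
  have h4 := (integral_eq_zero_iff_of_nonneg hnn hi2).1 h3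
  filter_upwards [h4] with ω hω
  by_contra hne
  have := Real.add_one_lt_exp hne
  simp only [Pi.zero_apply] at hω
  linarith

/-- Divergence of a measure given by its density. -/
theorem klDiv_withDensity {Ω : Type*} [MeasurableSpace Ω] {J ν : Measure Ω}
    [IsProbabilityMeasure J] [IsProbabilityMeasure ν] {f : Ω → ℝ≥0∞} (hf : Measurable f)
    (hJ : J = ν.withDensity f) {h : Ω → ℝ} (hh : Integrable h J)
    (hfh : ∀ᵐ ω ∂J, Real.log (f ω).toReal = h ω) :
    InformationTheory.klDiv J ν = ENNReal.ofReal (∫ ω, h ω ∂J) := by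
  have hac : J ≪ ν := hJ ▸ withDensity_absolutelyContinuous ν f
  have hr : J.rnDeriv ν =ᵐ[ν] f := hJ ▸ Measure.rnDeriv_withDensity ν hf
  have hllr : llr J ν =ᵐ[J] h := by
    filter_upwards [hac.ae_le hr, hfh] with ω h1 h2
    rw [llr, h1, h2]
  have hint : Integrable (llr J ν) J := hh.congr hllr.symm
  rw [InformationTheory.klDiv_of_ac_of_integrable hac hint, integral_congr_ae hllr]
  simp

end

/-! ### Marginal densities and submodularity of mutual information -/

noncomputable section

section Marginal

variable {ι X Y : Type*} [Fintype ι] [DecidableEq ι] [MeasurableSpace X] [MeasurableSpace Y]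

/-- The density `D` of a law on `(ι → X) × Y` with respect to a product measure, with the coordinates
outside `S` integrated out: the density of the coordinates in `S` together with `Y`. -/
def margDensity (P : Measure X) (D : (ι → X) → Y → ℝ≥0∞) (S : Finset ι) (x : ι → X) (y : Y) :
    ℝ≥0∞ :=
  ∫⁻ x', D (S.piecewise x x') y ∂(Measure.pi fun _ : ι => P)

variable (P : Measure X) [IsProbabilityMeasure P]

theorem measurable_piecewise (S : Finset ι) :
    Measurable fun p : (ι → X) × (ι → X) => S.piecewise p.1 p.2 := by
  refine measurable_pi_lambda _ fun i => ?_
  by_cases h : i ∈ S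
  · simp only [Finset.piecewise, h, if_true]; fun_prop
  · simp only [Finset.piecewise, h, if_false]; fun_prop

theorem map_piecewise (S : Finset ι) :
    ((Measure.pi fun _ : ι => P).prod (Measure.pi fun _ : ι => P)).map
      (fun p => S.piecewise p.1 p.2) = Measure.pi fun _ : ι => P := by
  have h := prod_pi_map_elim (κ := ι) (κ' := ι) P
    (c := fun i => if i ∈ S then Sum.inl i else Sum.inr i) (by
      intro i j h
      simp only at h
      split_ifs at h <;> simpa using h)
  refine Eq.trans ?_ h
  congr 1
  funext p i
  by_cases h : i ∈ S <;> simp [Finset.piecewise, h]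

theorem lintegral_piecewise (S : Finset ι) {f : (ι → X) → ℝ≥0∞} (hf : Measurable f) :
    ∫⁻ x, ∫⁻ x', f (S.piecewise x x') ∂(Measure.pi fun _ : ι => P) ∂(Measure.pi fun _ : ι => P)
      = ∫⁻ x, f x ∂(Measure.pi fun _ : ι => P) := by
  conv_rhs => rw [← map_piecewise P S, lintegral_map hf (measurable_piecewise S)]
  exact (lintegral_prod (fun p : (ι → X) × (ι → X) => f (S.piecewise p.1 p.2))
    (hf.comp (measurable_piecewise S)).aemeasurable).symm

/-- A function of the coordinates in `S`. -/
def DependsOnCoords (S : Finset ι) (f : (ι → X) → ℝ≥0∞) : Prop :=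
  ∀ x x', f (S.piecewise x x') = f x

theorem lintegral_mul_piecewise {S : Finset ι} {f g : (ι → X) → ℝ≥0∞} (hf : Measurable f)
    (hg : Measurable g) (hS : DependsOnCoords S f) :
    ∫⁻ x, f x * g x ∂(Measure.pi fun _ : ι => P) = ∫⁻ x, f x *
      ∫⁻ x', g (S.piecewise x x') ∂(Measure.pi fun _ : ι => P) ∂(Measure.pi fun _ : ι => P) := by
  rw [← lintegral_piecewise P S (f := fun x => f x * g x) (hf.mul hg)]
  refine lintegral_congr fun x => ?_
  simp_rw [hS x]
  exact lintegral_const_mul _ (hg.comp ((measurable_piecewise S).comp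
    (by fun_prop : Measurable fun x' : ι → X => (x, x'))))

theorem DependsOnCoords.mono {S T : Finset ι} (h : S ⊆ T) {f : (ι → X) → ℝ≥0∞}
    (hf : DependsOnCoords S f) : DependsOnCoords T f := by
  intro x x'
  rw [← hf (T.piecewise x x') x, ← hf x x]
  congr 1
  funext i
  by_cases hi : i ∈ S
  · simp [Finset.piecewise, hi, h hi]
  · simp [Finset.piecewise, hi]

theorem DependsOnCoords.mul {S : Finset ι} {f g : (ι → X) → ℝ≥0∞}
    (hf : DependsOnCoords S f) (hg : DependsOnCoords S g) :
    DependsOnCoords S fun x => f x * g x := fun x x' => by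
  simp only [hf x x', hg x x']

theorem DependsOnCoords.inv {S : Finset ι} {f : (ι → X) → ℝ≥0∞} (hf : DependsOnCoords S f) :
    DependsOnCoords S fun x => (f x)⁻¹ := fun x x' => by
  simp only [hf x x']

variable {P} {D : (ι → X) → Y → ℝ≥0∞} (hD : Measurable (Function.uncurry D))
include hD

theorem measurable_margDensity (S : Finset ι) :
    Measurable fun p : (ι → X) × Y => margDensity P D S p.1 p.2 := by
  unfold margDensity
  have : Measurable fun q : ((ι → X) × Y) × (ι → X) => D (S.piecewise q.1.1 q.2) q.1.2 :=
    hD.comp (((measurable_piecewise S).comp (by fun_prop :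
      Measurable fun q : ((ι → X) × Y) × (ι → X) => (q.1.1, q.2))).prodMk (by fun_prop))
  exact this.lintegral_prod_right'

theorem measurable_margDensity_left (S : Finset ι) (y : Y) :
    Measurable fun x => margDensity P D S x y :=
  (measurable_margDensity hD S).comp (by fun_prop : Measurable fun x : ι → X => (x, y))

/-- Integrating more coordinates out of a marginal density. -/
theorem lintegral_margDensity_piecewise (S T : Finset ι) (x : ι → X) (y : Y) :
    ∫⁻ x', margDensity P D T (S.piecewise x x') y ∂(Measure.pi fun _ : ι => P)
      = margDensity P D (S ∩ T) x y := by
  unfold margDensity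
  have h := lintegral_piecewise P T (f := fun x' => D ((S ∩ T).piecewise x x') y)
    (hD.comp (((measurable_piecewise (S ∩ T)).comp (by fun_prop :
      Measurable fun q : ι → X => (x, q))).prodMk (by fun_prop)))
  rw [← h]
  refine lintegral_congr fun x' => lintegral_congr fun x'' => ?_
  congr 1
  funext i
  by_cases h1 : i ∈ S <;> by_cases h2 : i ∈ T <;> simp [Finset.piecewise, h1, h2]

omit hD in
theorem dependsOnCoords_margDensity (S : Finset ι) (y : Y) :
    DependsOnCoords S fun x => margDensity P D S x y := by
  intro x x'
  unfold margDensity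
  refine lintegral_congr fun x'' => ?_
  congr 1
  funext i
  by_cases h1 : i ∈ S <;> simp [Finset.piecewise, h1]

theorem lintegral_mul_margDensity {S : Finset ι} {f : (ι → X) → ℝ≥0∞} (hf : Measurable f)
    (hS : DependsOnCoords S f) (y : Y) :
    ∫⁻ x, f x * D x y ∂(Measure.pi fun _ : ι => P)
      = ∫⁻ x, f x * margDensity P D S x y ∂(Measure.pi fun _ : ι => P) :=
  lintegral_mul_piecewise P hf (hD.comp (by fun_prop : Measurable fun x : ι → X => (x, y))) hS

omit hD in
theorem margDensity_univ (x : ι → X) (y : Y) : margDensity P D Finset.univ x y = D x y := by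
  simp [margDensity]

omit hD in
theorem margDensity_empty (x : ι → X) (y : Y) :
    margDensity P D ∅ x y = ∫⁻ x', D x' y ∂(Measure.pi fun _ : ι => P) := by
  simp [margDensity]

variable {ν : Measure Y} [IsProbabilityMeasure ν]
  {J : Measure ((ι → X) × Y)} [IsProbabilityMeasure J]
  (hJ : J = ((Measure.pi fun _ : ι => P).prod ν).withDensity (Function.uncurry D))
include hJ

theorem lintegral_joint {f : (ι → X) × Y → ℝ≥0∞} (hf : Measurable f) :
    ∫⁻ p, f p ∂J = ∫⁻ y, ∫⁻ x, f (x, y) * D x y ∂(Measure.pi fun _ : ι => P) ∂ν := by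
  rw [hJ, lintegral_withDensity_eq_lintegral_mul _ hD hf,
    lintegral_prod_symm _ (hD.mul hf).aemeasurable]
  refine lintegral_congr fun y => lintegral_congr fun x => ?_
  simp [Function.uncurry, mul_comm]

theorem lintegral_joint_of_depends {S : Finset ι} {f : (ι → X) × Y → ℝ≥0∞} (hf : Measurable f)
    (hS : ∀ y, DependsOnCoords S fun x => f (x, y)) :
    ∫⁻ p, f p ∂J = ∫⁻ p, f p * margDensity P D S p.1 p.2 ∂((Measure.pi fun _ : ι => P).prod ν) := by
  rw [lintegral_joint hD hJ hf,
    lintegral_prod_symm (fun p : (ι → X) × Y => f p * margDensity P D S p.1 p.2)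
      (hf.mul (measurable_margDensity hD S)).aemeasurable]
  refine lintegral_congr fun y => ?_
  exact lintegral_mul_margDensity hD (hf.comp (by fun_prop)) (hS y) y

theorem ae_margDensity_ne_zero (S : Finset ι) : ∀ᵐ p ∂J, margDensity P D S p.1 p.2 ≠ 0 := by
  have hm := measurable_margDensity (P := P) hD S
  have hs : MeasurableSet {p : (ι → X) × Y | margDensity P D S p.1 p.2 = 0} :=
    hm (measurableSet_singleton 0)
  rw [ae_iff]
  simp only [not_not]
  rw [← lintegral_indicator_one hs, lintegral_joint_of_depends hD hJ (S := S)
    (measurable_one.indicator hs)]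
  · refine (lintegral_congr fun p => ?_).trans lintegral_zero
    by_cases h : margDensity P D S p.1 p.2 = 0 <;> simp [h]
  · intro y x x'
    have := dependsOnCoords_margDensity (P := P) (D := D) S y x x'
    simp only at this
    simp [Set.indicator_apply, this]

theorem joint_absolutelyContinuous : J ≪ (Measure.pi fun _ : ι => P).prod ν :=
  hJ ▸ withDensity_absolutelyContinuous _ _

theorem lintegral_margDensity_prod (S : Finset ι) :
    ∫⁻ p, margDensity P D S p.1 p.2 ∂((Measure.pi fun _ : ι => P).prod ν) = 1 := by
  have := lintegral_joint_of_depends hD hJ (S := S) (f := fun _ => 1) measurable_const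
    (fun _ _ _ => rfl)
  simpa using this.symm

theorem ae_margDensity_ne_top (S : Finset ι) :
    ∀ᵐ p ∂((Measure.pi fun _ : ι => P).prod ν), margDensity P D S p.1 p.2 ≠ ∞ := by
  have := ae_lt_top (measurable_margDensity (P := P) hD S)
    (μ := (Measure.pi fun _ : ι => P).prod ν) (by rw [lintegral_margDensity_prod hD hJ]; simp)
  filter_upwards [this] with p hp using hp.ne

/-- Submodularity of mutual information, with the case of equality. -/
theorem integral_log_margDensity_submodular (S T : Finset ι)
    (hi : ∀ U : Finset ι, Integrable (fun p => Real.log (margDensity P D U p.1 p.2).toReal) J)  :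
    ∫ p, Real.log (margDensity P D S p.1 p.2).toReal ∂J
      + ∫ p, Real.log (margDensity P D T p.1 p.2).toReal ∂J
      ≤ ∫ p, Real.log (margDensity P D (S ∪ T) p.1 p.2).toReal ∂J
      + ∫ p, Real.log (margDensity P D (S ∩ T) p.1 p.2).toReal ∂J ∧
    (∫ p, Real.log (margDensity P D (S ∪ T) p.1 p.2).toReal ∂J
      + ∫ p, Real.log (margDensity P D (S ∩ T) p.1 p.2).toReal ∂J
      ≤ ∫ p, Real.log (margDensity P D S p.1 p.2).toReal ∂J
      + ∫ p, Real.log (margDensity P D T p.1 p.2).toReal ∂J →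
      ∀ᵐ p ∂J, margDensity P D S p.1 p.2 * margDensity P D T p.1 p.2
        = margDensity P D (S ∪ T) p.1 p.2 * margDensity P D (S ∩ T) p.1 p.2) := by
  set m : Finset ι → (ι → X) × Y → ℝ≥0∞ := fun U p => margDensity P D U p.1 p.2 with hm
  have hmm : ∀ U, Measurable (m U) := fun U => measurable_margDensity hD U
  have h0 : ∀ U, ∀ᵐ p ∂J, m U p ≠ 0 := fun U => ae_margDensity_ne_zero hD hJ U
  have ht : ∀ U, ∀ᵐ p ∂J, m U p ≠ ∞ := fun U =>
    (joint_absolutelyContinuous hD hJ).ae_le (ae_margDensity_ne_top hD hJ U)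
  set h : (ι → X) × Y → ℝ := fun p => Real.log (m S p).toReal + Real.log (m T p).toReal
    - (Real.log (m (S ∪ T) p).toReal + Real.log (m (S ∩ T) p).toReal) with hh
  have hint : Integrable h J := ((hi S).add (hi T)).sub ((hi _).add (hi _))
  have hI : ∫ p, h p ∂J = ∫ p, Real.log (m S p).toReal ∂J + ∫ p, Real.log (m T p).toReal ∂J
      - (∫ p, Real.log (m (S ∪ T) p).toReal ∂J + ∫ p, Real.log (m (S ∩ T) p).toReal ∂J) := by
    rw [← integral_add (hi S) (hi T), ← integral_add (hi _) (hi _)]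
    exact integral_sub ((hi S).add (hi T)) ((hi _).add (hi _))
  have hpos : ∀ U, ∀ᵐ p ∂J, 0 < (m U p).toReal := fun U => by
    filter_upwards [h0 U, ht U] with p a b using ENNReal.toReal_pos a b
  have hexp : ∀ᵐ p ∂J, Real.exp (h p)
      = (m S p).toReal * (m T p).toReal * ((m (S ∪ T) p).toReal * (m (S ∩ T) p).toReal)⁻¹ := by
    filter_upwards [hpos S, hpos T, hpos (S ∪ T), hpos (S ∩ T)] with p a b c d
    rw [hh]
    simp only
    rw [Real.exp_sub, Real.exp_add, Real.exp_add, Real.exp_log a, Real.exp_log b, Real.exp_log c,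
      Real.exp_log d, div_eq_mul_inv]
  set R : (ι → X) × Y → ℝ≥0∞ := fun p => m S p * m T p * (m (S ∩ T) p)⁻¹ * (m (S ∪ T) p)⁻¹ with hR
  have hRm : Measurable R := (((hmm S).mul (hmm T)).mul (hmm _).inv).mul (hmm _).inv
  have hRe : ∀ᵐ p ∂J, ENNReal.ofReal (Real.exp (h p)) = R p := by
    filter_upwards [hexp, h0 S, h0 T, h0 (S ∪ T), h0 (S ∩ T), ht S, ht T, ht (S ∪ T), ht (S ∩ T)]
      with p e a b c d a' b' c' d'
    rw [e, hR]
    simp only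
    rw [← ENNReal.ofReal_toReal (a := m S p * m T p * (m (S ∩ T) p)⁻¹ * (m (S ∪ T) p)⁻¹)]
    · congr 1
      simp [ENNReal.toReal_mul, ENNReal.toReal_inv]; ring
    · exact ENNReal.mul_ne_top (ENNReal.mul_ne_top (ENNReal.mul_ne_top a' b')
        (ENNReal.inv_ne_top.2 d)) (ENNReal.inv_ne_top.2 c)
  have dS := fun y => dependsOnCoords_margDensity (P := P) (D := D) S y
  have dT := fun y => dependsOnCoords_margDensity (P := P) (D := D) T y
  have dU := fun y => dependsOnCoords_margDensity (P := P) (D := D) (S ∪ T) y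
  have dI := fun y => dependsOnCoords_margDensity (P := P) (D := D) (S ∩ T) y
  have hle : ∫⁻ p, ENNReal.ofReal (Real.exp (h p)) ∂J ≤ 1 := by
    rw [lintegral_congr_ae hRe, lintegral_joint_of_depends hD hJ (S := S ∪ T) hRm]
    · calc _ ≤ ∫⁻ p, m S p * (m (S ∩ T) p)⁻¹ * m T p ∂((Measure.pi fun _ : ι => P).prod ν) := by
            refine lintegral_mono fun p => ?_
            calc R p * m (S ∪ T) p
                = (m S p * (m (S ∩ T) p)⁻¹ * m T p) * ((m (S ∪ T) p)⁻¹ * m (S ∪ T) p) := by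
                  simp only [hR]; ring
              _ ≤ (m S p * (m (S ∩ T) p)⁻¹ * m T p) * 1 := by
                  gcongr; exact ENNReal.inv_mul_le_one _
              _ = _ := mul_one _
        _ = ∫⁻ y, ∫⁻ x, m S (x, y) * (m (S ∩ T) (x, y))⁻¹ * m T (x, y)
              ∂(Measure.pi fun _ : ι => P) ∂ν :=
            lintegral_prod_symm _ (((hmm S).mul (hmm _).inv).mul (hmm T)).aemeasurable
        _ ≤ ∫⁻ y, ∫⁻ x, m S (x, y) ∂(Measure.pi fun _ : ι => P) ∂ν := by
            refine lintegral_mono fun y => ?_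
            simp only
            rw [lintegral_mul_piecewise P (S := S) (f := fun x => m S (x, y) * (m (S ∩ T) (x, y))⁻¹)
              (g := fun x => m T (x, y)) (((hmm S).mul (hmm _).inv).comp (by fun_prop))
              ((hmm T).comp (by fun_prop))
              ((dS y).mul ((dI y).inv.mono Finset.inter_subset_left))]
            refine lintegral_mono fun x => ?_
            simp only [hm]
            rw [lintegral_margDensity_piecewise hD]
            calc _ = margDensity P D S x y *
                  ((margDensity P D (S ∩ T) x y)⁻¹ * margDensity P D (S ∩ T) x y) := by ring
              _ ≤ margDensity P D S x y * 1 := by gcongr; exact ENNReal.inv_mul_le_one _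
              _ = _ := mul_one _
        _ = 1 := by
            rw [← lintegral_prod_symm _ (hmm S).aemeasurable]
            exact lintegral_margDensity_prod hD hJ S
    · intro y
      exact (((dS y).mono Finset.subset_union_left).mul
        ((dT y).mono Finset.subset_union_right)).mul ((dI y).inv.mono
          (Finset.inter_subset_left.trans Finset.subset_union_left)) |>.mul (dU y).inv
  obtain ⟨g1, g2⟩ := integral_nonpos_of_lintegral_exp_le hint hle
  rw [hI] at g1 g2
  refine ⟨by linarith, fun heq => ?_⟩
  filter_upwards [g2 (by linarith), hexp, h0 (S ∪ T), h0 (S ∩ T), ht S, ht T, ht (S ∪ T),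
    ht (S ∩ T)] with p e1 e2 a b c d a' b'
  rw [e1] at e2
  simp only [Pi.zero_apply, Real.exp_zero] at e2
  have hne : (m (S ∪ T) p).toReal * (m (S ∩ T) p).toReal ≠ 0 :=
    mul_ne_zero (ENNReal.toReal_ne_zero.2 ⟨a, a'⟩) (ENNReal.toReal_ne_zero.2 ⟨b, b'⟩)
  have e3 := (eq_mul_inv_iff_mul_eq₀ hne).1 e2
  rw [one_mul, ← ENNReal.toReal_mul, ← ENNReal.toReal_mul,
    ENNReal.toReal_eq_toReal_iff' (ENNReal.mul_ne_top a' b') (ENNReal.mul_ne_top c d)] at e3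
  exact e3.symm

end Marginal

end

/-! ### Conditional independence and symmetry in terms of densities -/

noncomputable section

section MarginalCond

variable {ι X Y : Type*} [Fintype ι] [DecidableEq ι] [MeasurableSpace X] [MeasurableSpace Y]
  {P : Measure X} [IsProbabilityMeasure P] {D : (ι → X) → Y → ℝ≥0∞}
  (hD : Measurable (Function.uncurry D))
  {ν : Measure Y} [IsProbabilityMeasure ν]
  {J : Measure ((ι → X) × Y)} [IsProbabilityMeasure J]
  (hJ : J = ((Measure.pi fun _ : ι => P).prod ν).withDensity (Function.uncurry D))
  (hν : ∀ᵐ y ∂ν, ∫⁻ x, D x y ∂(Measure.pi fun _ : ι => P) = 1)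
include hD hJ hν

/-- The conditional probability of an event about the inputs, given the output, in terms of the
density. -/
theorem condExp_joint_ae_eq {E : Set (ι → X)} (hE : MeasurableSet E) :
    (fun p : (ι → X) × Y =>
        (∫⁻ x, E.indicator 1 x * D x p.2 ∂(Measure.pi fun _ : ι => P)).toReal)
      =ᵐ[J] J[(Prod.fst ⁻¹' E).indicator fun _ => (1 : ℝ) |
        MeasurableSpace.comap (Prod.snd : (ι → X) × Y → Y) inferInstance] := by
  set h : Y → ℝ≥0∞ := fun y => ∫⁻ x, E.indicator 1 x * D x y ∂(Measure.pi fun _ : ι => P) with hh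
  have hm : Measurable h := by
    have : Measurable fun p : Y × (ι → X) => E.indicator (1 : (ι → X) → ℝ≥0∞) p.2 * D p.2 p.1 :=
      ((measurable_one.indicator hE).comp measurable_snd).mul
        (hD.comp (by fun_prop : Measurable fun p : Y × (ι → X) => (p.2, p.1)))
    exact this.lintegral_prod_right'
  have hle : ∀ᵐ y ∂ν, h y ≤ 1 := by
    filter_upwards [hν] with y hy
    rw [← hy]
    refine lintegral_mono fun x => ?_
    calc E.indicator 1 x * D x y ≤ 1 * D x y := by
          gcongr; exact Set.indicator_le_self' (fun _ _ => zero_le) x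
      _ = D x y := one_mul _
  have hleJ : ∀ᵐ p ∂J, h p.2 ≤ 1 := by
    refine (joint_absolutelyContinuous hD hJ).ae_le ?_
    exact Measure.quasiMeasurePreserving_snd.ae hle
  have hint : Integrable (fun p : (ι → X) × Y => (h p.2).toReal) J := by
    refine Integrable.of_bound (hm.comp measurable_snd).ennreal_toReal.aestronglyMeasurable 1 ?_
    filter_upwards [hleJ] with p hp
    rw [Real.norm_of_nonneg ENNReal.toReal_nonneg]
    exact ENNReal.toReal_le_of_le_ofReal zero_le_one (by simpa using hp)
  refine ae_eq_condExp_of_forall_setIntegral_eq measurable_snd.comap_le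
    ((integrable_const 1).indicator (measurable_fst hE)) (fun _ _ _ => hint.integrableOn) ?_ ?_
  · rintro _ ⟨C, hC, rfl⟩ -
    have hC' : MeasurableSet (Prod.snd ⁻¹' C : Set ((ι → X) × Y)) := measurable_snd hC
    have hE' : MeasurableSet (Prod.fst ⁻¹' E : Set ((ι → X) × Y)) := measurable_fst hE
    have e1 : ∫ p in Prod.snd ⁻¹' C, (h p.2).toReal ∂J
        = (∫⁻ p in Prod.snd ⁻¹' C, h p.2 ∂J).toReal := by
      refine integral_toReal (f := fun p : (ι → X) × Y => h p.2) (hm.comp measurable_snd).aemeasurable ?_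
      filter_upwards [ae_restrict_of_ae hleJ] with p hp using hp.trans_lt ENNReal.one_lt_top
    have e2 : ∫ p in Prod.snd ⁻¹' C, (Prod.fst ⁻¹' E).indicator (fun _ => (1 : ℝ)) p ∂J
        = (J (Prod.fst ⁻¹' E ∩ Prod.snd ⁻¹' C)).toReal := by
      rw [integral_indicator hE', Measure.restrict_restrict hE']
      simp [Measure.real]
    rw [e1, e2]
    congr 1
    rw [← lintegral_indicator hC', lintegral_joint hD hJ
        (f := (Prod.snd ⁻¹' C).indicator fun p => h p.2) ((hm.comp measurable_snd).indicator hC'),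
      ← lintegral_indicator_one (hE'.inter hC'),
      lintegral_joint hD hJ (measurable_one.indicator (hE'.inter hC'))]
    refine lintegral_congr_ae ?_
    filter_upwards [hν] with y hy
    by_cases hyC : y ∈ C
    · have a1 : ∀ x, (Prod.snd ⁻¹' C : Set ((ι → X) × Y)).indicator (fun p => h p.2) (x, y) * D x y
          = h y * D x y := fun x => by simp [hyC]
      have a2 : ∀ x, (Prod.fst ⁻¹' E ∩ Prod.snd ⁻¹' C : Set ((ι → X) × Y)).indicator 1 (x, y)
          * D x y = E.indicator 1 x * D x y := fun x => by
        by_cases hx : x ∈ E <;> simp [hyC, hx]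
      simp_rw [a1, a2]
      rw [lintegral_const_mul (f := fun x => D x y) _
        (hD.comp (by fun_prop : Measurable fun x : ι → X => (x, y))), hy,
        mul_one]
    · have a1 : ∀ x, (Prod.snd ⁻¹' C : Set ((ι → X) × Y)).indicator (fun p => h p.2) (x, y) * D x y
          = 0 := fun x => by simp [hyC]
      have a2 : ∀ x, (Prod.fst ⁻¹' E ∩ Prod.snd ⁻¹' C : Set ((ι → X) × Y)).indicator 1 (x, y)
          * D x y = 0 := fun x => by simp [hyC]
      simp_rw [a1, a2]
  · refine StronglyMeasurable.aestronglyMeasurable ?_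
    exact (hm.ennreal_toReal.comp (comap_measurable _)).stronglyMeasurable

/-- A factorization of the density that holds almost surely for the joint law also holds where that
law puts no mass, since both sides have integral one. -/
theorem ae_margDensity_eq_mul (S T : Finset ι) (hST : S ∩ T = ∅)
    (hprod : ∀ᵐ p ∂J, margDensity P D S p.1 p.2 * margDensity P D T p.1 p.2
        = margDensity P D (S ∪ T) p.1 p.2 * margDensity P D (S ∩ T) p.1 p.2) :
    ∀ᵐ p ∂((Measure.pi fun _ : ι => P).prod ν), margDensity P D (S ∪ T) p.1 p.2
      = margDensity P D S p.1 p.2 * margDensity P D T p.1 p.2 := by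
  set m : Finset ι → (ι → X) × Y → ℝ≥0∞ := fun U p => margDensity P D U p.1 p.2 with hm
  have hmm : ∀ U, Measurable (m U) := fun U => measurable_margDensity hD U
  have dep := fun U y => dependsOnCoords_margDensity (P := P) (D := D) U y
  have hν' : ∀ᵐ p ∂((Measure.pi fun _ : ι => P).prod ν), m ∅ p = 1 := by
    have := (Measure.quasiMeasurePreserving_snd (μ := Measure.pi fun _ : ι => P) (ν := ν)).ae hν
    filter_upwards [this] with p hp
    simp only [hm, margDensity_empty]; exact hp
  set Bad : Set ((ι → X) × Y) := {p | m S p * m T p ≠ m (S ∪ T) p} with hBad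
  have hBm : MeasurableSet Bad := (measurableSet_eq_fun ((hmm S).mul (hmm T)) (hmm _)).compl
  have hB0 : J Bad = 0 := by
    rw [measure_eq_zero_iff_ae_notMem]
    filter_upwards [hprod, (joint_absolutelyContinuous hD hJ).ae_le hν'] with p h1 h2
    simp only [hBad, Set.mem_ofPred_eq, not_not]
    have h2' : margDensity P D (S ∩ T) p.1 p.2 = 1 := by rw [hST]; exact h2
    rw [h2', mul_one] at h1
    exact h1
  have hzero : ∀ᵐ p ∂((Measure.pi fun _ : ι => P).prod ν),
      Bad.indicator 1 p * m (S ∪ T) p = 0 := by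
    rw [← lintegral_indicator_one hBm, lintegral_joint_of_depends hD hJ (S := S ∪ T)
      (measurable_one.indicator hBm)] at hB0
    · exact (lintegral_eq_zero_iff ((measurable_one.indicator hBm).mul (hmm _))).1 hB0
    · intro y x x'
      have a := (dep S y).mono Finset.subset_union_left (T := S ∪ T) x x'
      have b := (dep T y).mono Finset.subset_union_right (T := S ∪ T) x x'
      have c := dep (S ∪ T) y x x'
      simp only at a b c
      simp only [Set.indicator_apply, hBad, Set.mem_ofPred_eq, hm, a, b, c, Pi.one_apply]
  have hle : m (S ∪ T) ≤ᵐ[(Measure.pi fun _ : ι => P).prod ν] fun p => m S p * m T p := by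
    filter_upwards [hzero] with p hp
    by_cases hb : p ∈ Bad
    · simp only [Set.indicator_of_mem hb, Pi.one_apply, one_mul] at hp
      rw [hp]; exact zero_le
    · simp only [hBad, Set.mem_ofPred_eq, not_not] at hb
      exact hb.ge
  have hI : ∫⁻ p, m S p * m T p ∂((Measure.pi fun _ : ι => P).prod ν)
      ≤ ∫⁻ p, m (S ∪ T) p ∂((Measure.pi fun _ : ι => P).prod ν) := by
    have e := lintegral_margDensity_prod hD hJ
    simp only [hm]
    rw [e (S ∪ T), ← e S, lintegral_prod_symm (fun p => m S p * m T p)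
        ((hmm S).mul (hmm T)).aemeasurable, lintegral_prod_symm (m S) (hmm S).aemeasurable]
    refine lintegral_mono_ae ?_
    filter_upwards [hν] with y hy
    rw [lintegral_mul_piecewise P (S := S) (f := fun x => m S (x, y))
      (g := fun x => m T (x, y)) ((hmm S).comp (by fun_prop)) ((hmm T).comp (by fun_prop)) (dep S y)]
    refine le_of_eq (lintegral_congr fun x => ?_)
    simp only [hm]
    rw [lintegral_margDensity_piecewise hD, hST, margDensity_empty, hy, mul_one]
  exact ae_eq_of_ae_le_of_lintegral_le hle
    (by rw [lintegral_margDensity_prod hD hJ]; simp) ((hmm S).mul (hmm T)).aemeasurable hI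

omit hJ hν [IsProbabilityMeasure J] [IsProbabilityMeasure ν] in
theorem lintegral_mul_mul_of_factorization {S T : Finset ι} (hST : S ∩ T = ∅) {y : Y}
    (hfac : ∀ᵐ x ∂(Measure.pi fun _ : ι => P), margDensity P D (S ∪ T) x y
      = margDensity P D S x y * margDensity P D T x y)
    {f g : (ι → X) → ℝ≥0∞} (hf : Measurable f) (hg : Measurable g) (dS : DependsOnCoords S f)
    (dT : DependsOnCoords T g) :
    ∫⁻ x, f x * g x * D x y ∂(Measure.pi fun _ : ι => P)
      = (∫⁻ x, f x * D x y ∂(Measure.pi fun _ : ι => P))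
        * ∫⁻ x, g x * D x y ∂(Measure.pi fun _ : ι => P) := by
  have mS := measurable_margDensity_left (P := P) hD S y
  have mT := measurable_margDensity_left (P := P) hD T y
  have depS := dependsOnCoords_margDensity (P := P) (D := D) S y
  have depT := dependsOnCoords_margDensity (P := P) (D := D) T y
  rw [lintegral_mul_margDensity hD (S := S ∪ T) (f := fun x => f x * g x) (hf.mul hg)
    ((dS.mono Finset.subset_union_left).mul (dT.mono Finset.subset_union_right)),
    lintegral_mul_margDensity hD hf dS, lintegral_mul_margDensity hD hg dT]
  have e1 : ∫⁻ x, f x * g x * margDensity P D (S ∪ T) x y ∂(Measure.pi fun _ : ι => P)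
      = ∫⁻ x, (f x * margDensity P D S x y) * (g x * margDensity P D T x y)
        ∂(Measure.pi fun _ : ι => P) := by
    refine lintegral_congr_ae ?_
    filter_upwards [hfac] with x hx
    rw [hx]; ring
  rw [e1, lintegral_mul_piecewise P (S := S) (f := fun x => f x * margDensity P D S x y)
    (g := fun x => g x * margDensity P D T x y) (hf.mul mS) (hg.mul mT) (dS.mul depS)]
  have e2 : ∀ x, ∫⁻ x', g (S.piecewise x x') * margDensity P D T (S.piecewise x x') y
      ∂(Measure.pi fun _ : ι => P)
      = ∫⁻ x', g x' * margDensity P D T x' y ∂(Measure.pi fun _ : ι => P) := by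
    intro x
    refine lintegral_congr fun x' => ?_
    have key : ∀ F : (ι → X) → ℝ≥0∞, DependsOnCoords T F → F (S.piecewise x x') = F x' := by
      intro F hF
      rw [← hF (S.piecewise x x') x']
      congr 1
      funext i
      by_cases hi : i ∈ T
      · have : i ∉ S := fun h => by
          have := Finset.mem_inter.2 ⟨h, hi⟩
          rw [hST] at this; simp at this
        simp [Finset.piecewise, hi, this]
      · simp [Finset.piecewise, hi]
    exact key _ (dT.mul depT)
  simp_rw [e2]
  rw [lintegral_mul_const (f := fun x => f x * margDensity P D S x y) _ (hf.mul mS)]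

/-- If the density of the coordinates in `S ∪ T` and `Y` factors, then the coordinates in `S` and
those in `T` are conditionally independent given `Y`. -/
theorem condIndepFun_of_margDensity_mul [StandardBorelSpace X] [StandardBorelSpace Y]
    (p q : ι → Prop) [DecidablePred p] [DecidablePred q]
    (hST : Finset.univ.filter p ∩ Finset.univ.filter q = ∅)
    (hprod : ∀ᵐ ω ∂J, margDensity P D (Finset.univ.filter p) ω.1 ω.2
        * margDensity P D (Finset.univ.filter q) ω.1 ω.2
      = margDensity P D (Finset.univ.filter p ∪ Finset.univ.filter q) ω.1 ω.2
        * margDensity P D (Finset.univ.filter p ∩ Finset.univ.filter q) ω.1 ω.2) :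
    CondIndepFun (MeasurableSpace.comap (Prod.snd : (ι → X) × Y → Y) inferInstance)
      measurable_snd.comap_le (fun ω (i : {i : ι // p i}) => ω.1 i.1)
      (fun ω (i : {i : ι // q i}) => ω.1 i.1) J := by
  rw [condIndepFun_iff_condExp_inter_preimage_eq_mul (by fun_prop) (by fun_prop)]
  intro s t hs ht
  have hfac := ae_margDensity_eq_mul hD hJ hν _ _ hST hprod
  set E : Set (ι → X) := {x | (fun i : {i : ι // p i} => x i.1) ∈ s}
  set F : Set (ι → X) := {x | (fun i : {i : ι // q i} => x i.1) ∈ t}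
  have hE : MeasurableSet E := (by fun_prop :
    Measurable fun (x : ι → X) (i : {i : ι // p i}) => x i.1) hs
  have hF : MeasurableSet F := (by fun_prop :
    Measurable fun (x : ι → X) (i : {i : ι // q i}) => x i.1) ht
  have eE : (fun (ω : (ι → X) × Y) (i : {i : ι // p i}) => ω.1 i.1) ⁻¹' s = Prod.fst ⁻¹' E := rfl
  have eF : (fun (ω : (ι → X) × Y) (i : {i : ι // q i}) => ω.1 i.1) ⁻¹' t = Prod.fst ⁻¹' F := rfl
  rw [eE, eF, ← Set.preimage_inter]
  have key : ∀ᵐ y ∂ν, (∫⁻ x, (E ∩ F).indicator 1 x * D x y ∂(Measure.pi fun _ : ι => P))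
      = (∫⁻ x, E.indicator 1 x * D x y ∂(Measure.pi fun _ : ι => P))
        * ∫⁻ x, F.indicator 1 x * D x y ∂(Measure.pi fun _ : ι => P) := by
    have hfac' := (Measure.ae_ae_comm (by
      exact measurableSet_eq_fun (measurable_margDensity hD _)
        ((measurable_margDensity hD _).mul (measurable_margDensity hD _)))).1
      (Measure.ae_ae_of_ae_prod hfac)
    filter_upwards [hfac'] with y hf
    rw [← lintegral_mul_mul_of_factorization hD hST hf (measurable_one.indicator hE)
      (measurable_one.indicator hF)]
    · refine lintegral_congr fun x => ?_
      by_cases h1 : x ∈ E <;> by_cases h2 : x ∈ F <;> simp [h1, h2]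
    · intro x x'
      have : (Finset.univ.filter p).piecewise x x' ∈ E ↔ x ∈ E := by
        simp only [E, Set.mem_ofPred_eq]
        have : (fun i : {i : ι // p i} => (Finset.univ.filter p).piecewise x x' i.1)
            = fun i : {i : ι // p i} => x i.1 := by
          funext i; simp [Finset.piecewise, i.2]
        rw [this]
      classical
      change E.indicator 1 _ = E.indicator 1 x
      simp only [Set.indicator_apply, this, Pi.one_apply]
    · intro x x'
      have : (Finset.univ.filter q).piecewise x x' ∈ F ↔ x ∈ F := by
        simp only [F, Set.mem_ofPred_eq]
        have : (fun i : {i : ι // q i} => (Finset.univ.filter q).piecewise x x' i.1)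
            = fun i : {i : ι // q i} => x i.1 := by
          funext i; simp [Finset.piecewise, i.2]
        rw [this]
      classical
      change F.indicator 1 _ = F.indicator 1 x
      simp only [Set.indicator_apply, this, Pi.one_apply]
  have key' : ∀ᵐ ω ∂J, _ := (joint_absolutelyContinuous hD hJ).ae_le
    ((Measure.quasiMeasurePreserving_snd (μ := Measure.pi fun _ : ι => P) (ν := ν)).ae key)
  filter_upwards [key', condExp_joint_ae_eq hD hJ hν hE, condExp_joint_ae_eq hD hJ hν hF,
    condExp_joint_ae_eq hD hJ hν (hE.inter hF)] with ω h1 h2 h3 h4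
  rw [← h2, ← h3, ← h4, h1, ENNReal.toReal_mul]

end MarginalCond

section Symmetric

variable {ι X Y : Type*} [Fintype ι] [DecidableEq ι] [MeasurableSpace X] [MeasurableSpace Y]
  {P : Measure X} [IsProbabilityMeasure P] {D : (ι → X) → Y → ℝ≥0∞}
  (hD : Measurable (Function.uncurry D))
  {ν : Measure Y} [IsProbabilityMeasure ν]
  (hperm : ∀ (σ : Equiv.Perm ι) x, ∀ᵐ y ∂ν, D (x ∘ σ) y = D x y)
include hD hperm

/-- A permutation of the inputs permutes the sets of coordinates of the marginal densities. -/
theorem margDensity_comp_perm (σ : Equiv.Perm ι) (S : Finset ι) (x : ι → X) :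
    ∀ᵐ y ∂ν, margDensity P D S (x ∘ σ) y = margDensity P D (S.map σ.toEmbedding) x y := by
  have hm : MeasurableSet {q : (ι → X) × Y |
      D ((S.map σ.toEmbedding).piecewise x q.1 ∘ σ) q.2
        = D ((S.map σ.toEmbedding).piecewise x q.1) q.2} := by
    have h1 : Measurable fun q : (ι → X) × Y => (S.map σ.toEmbedding).piecewise x q.1 :=
      (measurable_piecewise _).comp (by fun_prop : Measurable fun q : (ι → X) × Y => (x, q.1))
    have h2 : Measurable fun q : (ι → X) × Y => (S.map σ.toEmbedding).piecewise x q.1 ∘ σ :=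
      measurable_pi_lambda _ fun i => (measurable_pi_apply _).comp h1
    exact measurableSet_eq_fun (hD.comp (h2.prodMk measurable_snd))
      (hD.comp (h1.prodMk measurable_snd))
  have := (Measure.ae_ae_comm (μ := Measure.pi fun _ : ι => P) (ν := ν)
    (p := fun x' y => D ((S.map σ.toEmbedding).piecewise x x' ∘ σ) y
      = D ((S.map σ.toEmbedding).piecewise x x') y) hm).1
    (Filter.Eventually.of_forall fun x' => hperm σ _)
  filter_upwards [this] with y hy
  unfold margDensity
  have h := pi_map_injective (fun _ : ι => P) σ.injective
  have hmD : Measurable fun x' : ι → X => D (S.piecewise (x ∘ σ) x') y :=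
    hD.comp (((measurable_piecewise S).comp (by fun_prop :
      Measurable fun x' : ι → X => (x ∘ σ, x'))).prodMk measurable_const)
  conv_lhs => rw [← h]
  rw [lintegral_map hmD (by fun_prop)]
  refine lintegral_congr_ae ?_
  filter_upwards [hy] with x' hx'
  rw [← hx']
  congr 1
  funext i
  by_cases hi : i ∈ S <;> simp [Finset.piecewise, hi]

variable {J : Measure ((ι → X) × Y)} [IsProbabilityMeasure J]
  (hJ : J = ((Measure.pi fun _ : ι => P).prod ν).withDensity (Function.uncurry D))
include hJ

theorem ae_margDensity_comp_perm (σ : Equiv.Perm ι) (S : Finset ι) :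
    ∀ᵐ p ∂((Measure.pi fun _ : ι => P).prod ν), margDensity P D S (p.1 ∘ σ) p.2
      = margDensity P D (S.map σ.toEmbedding) p.1 p.2 := by
  have hc : Measurable fun p : (ι → X) × Y => (p.1 ∘ σ, p.2) :=
    (measurable_pi_lambda _ fun i => by fun_prop : Measurable fun p : (ι → X) × Y => p.1 ∘ σ).prodMk
      measurable_snd
  refine (Measure.ae_prod_iff_ae_ae ?_).2 (Filter.Eventually.of_forall fun x =>
    margDensity_comp_perm hD hperm σ S x)
  exact measurableSet_eq_fun ((measurable_margDensity (P := P) hD S).comp hc)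
    (measurable_margDensity hD _)

theorem map_perm_joint (σ : Equiv.Perm ι) : J.map (fun p => (p.1 ∘ σ, p.2)) = J := by
  have hc : Measurable fun p : (ι → X) × Y => (p.1 ∘ σ, p.2) :=
    (measurable_pi_lambda _ fun i => by fun_prop : Measurable fun p : (ι → X) × Y => p.1 ∘ σ).prodMk
      measurable_snd
  have hQ : ((Measure.pi fun _ : ι => P).prod ν).map (fun p => (p.1 ∘ σ, p.2))
      = (Measure.pi fun _ : ι => P).prod ν := by
    have h := pi_map_injective (fun _ : ι => P) σ.injective
    have := Measure.map_prod_map (Measure.pi fun _ : ι => P) ν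
      (f := fun x i => x (σ i)) (g := id) (by fun_prop) measurable_id
    rw [h, Measure.map_id] at this
    exact this.symm
  ext A hA
  have hDu : ∀ᵐ p ∂((Measure.pi fun _ : ι => P).prod ν), D (p.1 ∘ σ) p.2 = D p.1 p.2 := by
    have := ae_margDensity_comp_perm (P := P) hD hperm hJ σ Finset.univ
    filter_upwards [this] with p hp
    simpa [margDensity_univ] using hp
  rw [Measure.map_apply hc hA, hJ, withDensity_apply _ (hc hA), withDensity_apply _ hA,
    ← lintegral_indicator (hc hA), ← lintegral_indicator hA]
  conv_rhs => rw [← hQ, lintegral_map (hD.indicator hA) hc]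
  refine lintegral_congr_ae ?_
  filter_upwards [hDu] with p hp
  classical
  simp only [Set.indicator_apply, Set.mem_preimage, Function.uncurry, hp]

/-- For a symmetric law the information about `Y` in the coordinates of `S` depends on the size of
`S` only. -/
theorem log_margDensity_card_eq {S T : Finset ι} (hc : S.card = T.card) :
    ∫ p, Real.log (margDensity P D S p.1 p.2).toReal ∂J
      = ∫ p, Real.log (margDensity P D T p.1 p.2).toReal ∂J ∧
    (Integrable (fun p => Real.log (margDensity P D T p.1 p.2).toReal) J →
      Integrable (fun p => Real.log (margDensity P D S p.1 p.2).toReal) J) := by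
  obtain ⟨σ, hσ⟩ : ∃ σ : Equiv.Perm ι, S.map σ.toEmbedding = T := by
    refine ⟨(Finset.equivOfCardEq hc).extendSubtype, Finset.eq_of_subset_of_card_le ?_ ?_⟩
    · intro i hi
      obtain ⟨j, hj, rfl⟩ := Finset.mem_map.1 hi
      exact (Finset.equivOfCardEq hc).extendSubtype_mem j hj
    · rw [Finset.card_map, hc]
  have hcm : Measurable fun p : (ι → X) × Y => (p.1 ∘ σ, p.2) :=
    (measurable_pi_lambda _ fun i => by fun_prop : Measurable fun p : (ι → X) × Y => p.1 ∘ σ).prodMk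
      measurable_snd
  have hmS : Measurable fun p : (ι → X) × Y => Real.log (margDensity P D S p.1 p.2).toReal :=
    (measurable_margDensity hD S).ennreal_toReal.log
  have hae : (fun p : (ι → X) × Y => Real.log (margDensity P D S (p.1 ∘ σ) p.2).toReal) =ᵐ[J]
      fun p => Real.log (margDensity P D T p.1 p.2).toReal := by
    filter_upwards [(joint_absolutelyContinuous hD hJ).ae_le
      (ae_margDensity_comp_perm (P := P) hD hperm hJ σ S)] with p hp
    rw [hp, hσ]
  have hmap := map_perm_joint (P := P) hD hperm hJ σ
  constructor
  · conv_lhs => rw [← hmap]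
    rw [integral_map hcm.aemeasurable hmS.aestronglyMeasurable]
    exact integral_congr_ae hae
  · intro hT
    rw [← hmap, integrable_map_measure hmS.aestronglyMeasurable hcm.aemeasurable]
    exact hT.congr hae.symm

end Symmetric

end

/-! ### Densities of a random access channel -/

noncomputable section

/-- A mixture of absolutely continuous laws has the mixture of their densities as density. -/
theorem comp_map_eq_withDensity {A Z Y : Type*} [MeasurableSpace A] [MeasurableSpace Z]
    [MeasurableSpace Y] [StandardBorelSpace Y] (κ : Kernel A Y) [IsMarkovKernel κ] (μ : Measure Y)
    [IsFiniteMeasure μ] (m : Measure Z) [IsProbabilityMeasure m] {f : Z → A} (hf : Measurable f)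
    (hac : ∀ᵐ z ∂m, κ (f z) ≪ μ) :
    κ ∘ₘ m.map f = μ.withDensity fun y => ∫⁻ z, Kernel.rnDeriv κ (Kernel.const A μ) (f z) y ∂m := by
  have hm : Measurable fun p : Z × Y => Kernel.rnDeriv κ (Kernel.const A μ) (f p.1) p.2 :=
    (Kernel.measurable_rnDeriv κ (Kernel.const A μ)).comp (by fun_prop :
      Measurable fun p : Z × Y => (f p.1, p.2))
  ext s hs
  rw [Measure.bind_apply hs κ.aemeasurable, lintegral_map (κ.measurable_coe hs) hf,
    withDensity_apply _ hs, lintegral_lintegral_swap (by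
      exact (hm.comp measurable_swap).aemeasurable)]
  refine lintegral_congr_ae ?_
  filter_upwards [hac] with z hz
  exact (Kernel.setLIntegral_rnDeriv (η := Kernel.const A μ) (by simpa using hz) hs).symm

namespace RAC

variable {X Y : Type*} [MeasurableSpace X] [MeasurableSpace Y]

section Laws

variable (R : RAC X Y) (P : Measure X) [IsProbabilityMeasure P]

instance (k : ℕ) : IsProbabilityMeasure (R.outLaw P k) := by
  unfold outLaw; infer_instance

instance (K : ℕ) : IsFiniteMeasure (R.refLaw P K) := by
  unfold refLaw; infer_instance

theorem measurable_splice_right {s t : ℕ} (x : Fin s → X) :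
    Measurable fun z : Fin t → X => splice x z :=
  measurable_splice.comp (measurable_const.prodMk measurable_id)

instance (s t : ℕ) : IsMarkovKernel (R.outGivenHead P s t) := by
  have := Kernel.IsMarkovKernel.map (Kernel.id ×ₖ Kernel.const (Fin s → X) (inputLaw P t))
    (measurable_splice (s := s) (t := t) (X := X))
  unfold outGivenHead
  infer_instance

theorem outGivenHead_apply (s t : ℕ) (x : Fin s → X) :
    R.outGivenHead P s t x = R.W t ∘ₘ (inputLaw P t).map (splice x) := by
  rw [outGivenHead, Kernel.comp_apply, Kernel.map_apply _ measurable_splice, Kernel.prod_apply,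
    Kernel.id_apply, Kernel.const_apply, Measure.dirac_prod,
    Measure.map_map measurable_splice measurable_prodMk_left]
  rfl

theorem outGivenHead_self (t : ℕ) : R.outGivenHead P t t = R.W t := by
  ext1 x
  have : (splice x : (Fin t → X) → Fin t → X) = fun _ => x := by
    funext z i; simp [splice]
  rw [outGivenHead_apply, this, Measure.map_const, measure_univ, one_smul,
    Measure.dirac_bind (R.W t).measurable]

theorem map_splice {s t : ℕ} :
    ((inputLaw P s).prod (inputLaw P t)).map (fun p => splice p.1 p.2) = inputLaw P t := by
  have h := prod_pi_map_elim (κ := Fin s) (κ' := Fin t) P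
    (c := fun i : Fin t => if h : i.1 < s then Sum.inl ⟨i.1, h⟩ else Sum.inr i) (by
      intro i j h
      simp only at h
      split_ifs at h <;> simp_all [Fin.ext_iff])
  refine Eq.trans ?_ h
  unfold inputLaw
  congr 1
  funext p i
  by_cases h : i.1 < s <;> simp [splice, h]

theorem lintegral_splice {s t : ℕ} {f : (Fin t → X) → ℝ≥0∞} (hf : Measurable f) :
    ∫⁻ x, ∫⁻ z, f (splice x z) ∂(inputLaw P t) ∂(inputLaw P s) = ∫⁻ x, f x ∂(inputLaw P t) := by
  conv_rhs => rw [← map_splice (s := s) P, lintegral_map hf measurable_splice]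
  exact (lintegral_prod (fun p : (Fin s → X) × (Fin t → X) => f (splice p.1 p.2))
    (hf.comp measurable_splice).aemeasurable).symm

theorem ae_ae_splice {s t : ℕ} {p : (Fin t → X) → Prop} (hp : ∀ᵐ x ∂(inputLaw P t), p x) :
    ∀ᵐ x ∂(inputLaw P s), ∀ᵐ z ∂(inputLaw P t), p (splice x z) := by
  rw [← map_splice (s := s) P] at hp
  exact Measure.ae_ae_of_ae_prod (ae_of_ae_map measurable_splice.aemeasurable hp)

/-- Restriction to the first `s` inputs. -/
def head {s k : ℕ} (h : s ≤ k) (p : (Fin k → X) × Y) : (Fin s → X) × Y :=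
  (fun i => p.1 (Fin.castLE h i), p.2)

omit [IsProbabilityMeasure P] in
theorem measurable_head {s k : ℕ} (h : s ≤ k) :
    Measurable (head h : (Fin k → X) × Y → (Fin s → X) × Y) := by
  unfold head; fun_prop

theorem splice_castLE {s k : ℕ} (h : s ≤ k) (x : Fin s → X) (z : Fin k → X) :
    (fun i => splice x z (Fin.castLE h i)) = x := by
  funext i; simp [splice]

theorem headLaw_eq_map {s k : ℕ} (h : s ≤ k) :
    R.headLaw P s k = (inputLaw P k ⊗ₘ R.W k).map (head h) := by
  ext A hA
  have hA' := measurable_head h hA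
  rw [Measure.map_apply (measurable_head h) hA, Measure.compProd_apply hA', headLaw,
    Measure.compProd_apply hA,
    ← lintegral_splice (s := s) P (Kernel.measurable_kernel_prodMk_left hA')]
  refine lintegral_congr fun x => ?_
  rw [outGivenHead_apply, Measure.bind_apply (measurable_prodMk_left hA) (R.W k).aemeasurable,
    lintegral_map ((R.W k).measurable_coe (measurable_prodMk_left hA)) (measurable_splice_right x)]
  refine lintegral_congr fun z => ?_
  congr 1
  ext y
  simp only [Set.mem_preimage, head, splice_castLE]

theorem outLaw_absolutelyContinuous {t K : ℕ} (h : t ≤ K) : R.outLaw P t ≪ R.refLaw P K := by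
  refine Measure.absolutelyContinuous_of_le ?_
  unfold refLaw
  exact Finset.single_le_sum (f := fun j => R.outLaw P j) (fun _ _ => bot_le)
    (Finset.mem_range.2 (Nat.lt_succ_of_le h))

end Laws

section Densities

variable [StandardBorelSpace Y] (R : RAC X Y) (P : Measure X) [IsProbabilityMeasure P] (K : ℕ)

/-- `exp` of the information density. -/
def dens (s t : ℕ) (x : Fin s → X) (y : Y) : ℝ≥0∞ :=
  Kernel.rnDeriv (R.outGivenHead P s t) (Kernel.const _ (R.refLaw P K)) x y /
    (R.outLaw P t).rnDeriv (R.refLaw P K) y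

omit [IsProbabilityMeasure P] in
theorem infoDensity_eq (s t : ℕ) (x : Fin s → X) (y : Y) :
    R.infoDensity P K s t x y = ENNReal.log (R.dens P K s t x y) := rfl

theorem measurable_dens (s t : ℕ) : Measurable (Function.uncurry (R.dens P K s t)) := by
  have h1 := Kernel.measurable_rnDeriv (R.outGivenHead P s t) (Kernel.const _ (R.refLaw P K))
  have h2 := Measure.measurable_rnDeriv (R.outLaw P t) (R.refLaw P K)
  exact h1.div (h2.comp measurable_snd)

/-- The density of `t` inputs, averaged over the last `t - s` of them. -/
def headDens (s t : ℕ) (x : Fin s → X) (y : Y) : ℝ≥0∞ :=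
  ∫⁻ z, R.dens P K t t (splice x z) y ∂(inputLaw P t)

theorem measurable_headDens (s t : ℕ) : Measurable (Function.uncurry (R.headDens P K s t)) := by
  have : Measurable fun q : ((Fin s → X) × Y) × (Fin t → X) =>
      R.dens P K t t (splice q.1.1 q.2) q.1.2 :=
    (R.measurable_dens P K t t).comp ((measurable_splice.comp (by fun_prop :
      Measurable fun q : ((Fin s → X) × Y) × (Fin t → X) => (q.1.1, q.2))).prodMk (by fun_prop))
  exact this.lintegral_prod_right'

theorem dens_comp_perm (hperm : R.PermutationInvariant K) {t : ℕ} (ht : t ≤ K)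
    (σ : Equiv.Perm (Fin t)) (x : Fin t → X) :
    ∀ᵐ y ∂(R.refLaw P K), R.dens P K t t (x ∘ σ) y = R.dens P K t t x y := by
  have h := fun x : Fin t → X => Kernel.rnDeriv_eq_rnDeriv_measure (κ := R.outGivenHead P t t)
    (η := Kernel.const _ (R.refLaw P K)) (a := x)
  simp only [Kernel.const_apply] at h
  filter_upwards [h x, h (x ∘ σ)] with y h1 h2
  rw [dens, dens, h1, h2, outGivenHead_self, hperm t ht]

/-- `headDens` is the marginal density of the first `s` coordinates. -/
theorem margDensity_dens {s t : ℕ} (h : s ≤ t) (x : Fin t → X) (y : Y) :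
    margDensity P (R.dens P K t t) (Finset.univ.filter fun i : Fin t => i.1 < s) x y
      = R.headDens P K s t (fun i => x (Fin.castLE h i)) y := by
  unfold margDensity headDens inputLaw
  refine lintegral_congr fun z => ?_
  congr 1
  funext i
  by_cases hi : i.1 < s <;> simp [Finset.piecewise, splice, hi]

theorem lintegral_headDens (s t : ℕ) (y : Y) :
    ∫⁻ x, R.headDens P K s t x y ∂(inputLaw P s) = ∫⁻ x, R.dens P K t t x y ∂(inputLaw P t) :=
  lintegral_splice P ((R.measurable_dens P K t t).comp
    (by fun_prop : Measurable fun x : Fin t → X => (x, y)))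

variable {R P K} (hac : ∀ k, 1 ≤ k → k ≤ K →
    (inputLaw P k ⊗ₘ R.W k) ≪ (inputLaw P k).prod (R.outLaw P k)) {t : ℕ} (h1 : 1 ≤ t) (ht : t ≤ K)
include hac h1 ht

theorem ae_W_absolutelyContinuous : ∀ᵐ x ∂(inputLaw P t), R.W t x ≪ R.outLaw P t := by
  have h := hac t h1 ht
  rw [← Measure.compProd_const] at h
  simpa using h.kernel_of_compProd

theorem ae_W_ref : ∀ᵐ x ∂(inputLaw P t), R.W t x ≪ R.refLaw P K := by
  filter_upwards [ae_W_absolutelyContinuous hac h1 ht] with x hx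
  exact hx.trans (R.outLaw_absolutelyContinuous P ht)

theorem ae_rnDeriv_outLaw : ∀ᵐ y ∂(R.refLaw P K), (R.outLaw P t).rnDeriv (R.refLaw P K) y
    = ∫⁻ x, Kernel.rnDeriv (R.outGivenHead P t t) (Kernel.const _ (R.refLaw P K)) x y
      ∂(inputLaw P t) := by
  have h := comp_map_eq_withDensity (R.outGivenHead P t t) (R.refLaw P K) (inputLaw P t)
    measurable_id (by rw [outGivenHead_self]; exact ae_W_ref hac h1 ht)
  rw [Measure.map_id] at h
  have e : R.outGivenHead P t t ∘ₘ inputLaw P t = R.outLaw P t := by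
    rw [outGivenHead_self]; rfl
  rw [e] at h
  have hm := (Kernel.measurable_rnDeriv (R.outGivenHead P t t)
    (Kernel.const _ (R.refLaw P K))).comp measurable_swap
  nth_rewrite 1 [h]
  exact Measure.rnDeriv_withDensity _ (Measurable.lintegral_prod_right'
    (f := fun p : Y × (Fin t → X) => Kernel.rnDeriv (R.outGivenHead P t t)
      (Kernel.const _ (R.refLaw P K)) p.2 p.1) hm)

/-- The quotient is one where the density of the output law is positive and finite, and the value
`0 / 0 = 0` elsewhere may occur at outputs of the other channels of the family. -/
theorem lintegral_dens_eq_div : ∀ᵐ y ∂(R.refLaw P K), ∫⁻ x, R.dens P K t t x y ∂(inputLaw P t)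
    = (R.outLaw P t).rnDeriv (R.refLaw P K) y / (R.outLaw P t).rnDeriv (R.refLaw P K) y := by
  filter_upwards [ae_rnDeriv_outLaw hac h1 ht] with y hy
  have : ∀ x, R.dens P K t t x y
      = Kernel.rnDeriv (R.outGivenHead P t t) (Kernel.const _ (R.refLaw P K)) x y *
        ((R.outLaw P t).rnDeriv (R.refLaw P K) y)⁻¹ := fun x => rfl
  simp_rw [this]
  rw [lintegral_mul_const (f := fun x => Kernel.rnDeriv (R.outGivenHead P t t)
    (Kernel.const _ (R.refLaw P K)) x y) _
    ((Kernel.measurable_rnDeriv (R.outGivenHead P t t) (Kernel.const _ (R.refLaw P K))).comp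
      (by fun_prop : Measurable fun x : Fin t → X => (x, y))), ← hy]
  rfl

theorem lintegral_dens_le_one :
    ∀ᵐ y ∂(R.refLaw P K), ∫⁻ x, R.dens P K t t x y ∂(inputLaw P t) ≤ 1 := by
  filter_upwards [lintegral_dens_eq_div hac h1 ht] with y hy
  rw [hy]
  exact ENNReal.div_self_le_one

theorem lintegral_dens_eq_one :
    ∀ᵐ y ∂(R.outLaw P t), ∫⁻ x, R.dens P K t t x y ∂(inputLaw P t) = 1 := by
  have hac' := R.outLaw_absolutelyContinuous P ht
  filter_upwards [hac'.ae_le (lintegral_dens_eq_div hac h1 ht), Measure.rnDeriv_pos hac',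
    hac'.ae_le ((R.outLaw P t).rnDeriv_ne_top (R.refLaw P K))] with y hy h0 ht
  rw [hy, ENNReal.div_self h0.ne' ht]

theorem ae_W_eq_withDensity : ∀ᵐ x ∂(inputLaw P t),
    R.W t x = (R.outLaw P t).withDensity (R.dens P K t t x) := by
  have hac' := R.outLaw_absolutelyContinuous P ht
  filter_upwards [ae_W_absolutelyContinuous hac h1 ht] with x hx
  have hr := Kernel.rnDeriv_eq_rnDeriv_measure (κ := R.outGivenHead P t t)
    (η := Kernel.const _ (R.refLaw P K)) (a := x)
  simp only [Kernel.const_apply, outGivenHead_self] at hr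
  have e : (R.W t x).rnDeriv (R.outLaw P t) =ᵐ[R.outLaw P t] R.dens P K t t x := by
    filter_upwards [hac'.ae_le hr, Measure.rnDeriv_pos hac',
      hac'.ae_le ((R.outLaw P t).rnDeriv_ne_top (R.refLaw P K)),
      hac'.ae_le (Measure.rnDeriv_mul_rnDeriv hx (κ := R.refLaw P K))] with y h1 h2 h3 h4
    rw [dens, outGivenHead_self, h1, ← h4, Pi.mul_apply,
      ENNReal.mul_div_cancel_right h2.ne' h3]
  rw [← withDensity_congr_ae e, Measure.withDensity_rnDeriv_eq _ _ hx]

/-- The density of inputs and output with respect to the product of their laws. -/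
theorem joint_eq_withDensity : inputLaw P t ⊗ₘ R.W t
    = ((inputLaw P t).prod (R.outLaw P t)).withDensity (Function.uncurry (R.dens P K t t)) := by
  ext A hA
  rw [Measure.compProd_apply hA, withDensity_apply _ hA, ← lintegral_indicator hA,
    lintegral_prod _ ((R.measurable_dens P K t t).indicator hA).aemeasurable]
  refine lintegral_congr_ae ?_
  filter_upwards [ae_W_eq_withDensity hac h1 ht] with x hx
  have hA' : MeasurableSet (Prod.mk x ⁻¹' A) := measurable_prodMk_left hA
  rw [hx, withDensity_apply _ hA', ← lintegral_indicator hA']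
  rfl

/-- Averaging over the unknown inputs commutes with taking densities, for outputs of all channels of
the family. -/
theorem ae_dens_eq_headDens {s : ℕ} : ∀ᵐ x ∂(inputLaw P s), ∀ᵐ y ∂(R.refLaw P K),
    R.dens P K s t x y = R.headDens P K s t x y := by
  filter_upwards [ae_ae_splice (s := s) P (ae_W_ref hac h1 ht)] with x hx
  have h := comp_map_eq_withDensity (R.outGivenHead P t t) (R.refLaw P K) (inputLaw P t)
    (measurable_splice_right x) (by rw [outGivenHead_self]; exact hx)
  have e : R.outGivenHead P t t ∘ₘ (inputLaw P t).map (fun z => splice x z)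
      = R.outGivenHead P s t x := by
    rw [outGivenHead_self, outGivenHead_apply]
  rw [e] at h
  have hm := (Kernel.measurable_rnDeriv (R.outGivenHead P t t)
    (Kernel.const _ (R.refLaw P K))).comp (((measurable_splice_right x).comp
      measurable_snd).prodMk measurable_fst : Measurable fun p : Y × (Fin t → X) =>
        ((splice x p.2 : Fin t → X), p.1))
  have hr := Kernel.rnDeriv_eq_rnDeriv_measure (κ := R.outGivenHead P s t)
    (η := Kernel.const _ (R.refLaw P K)) (a := x)
  simp only [Kernel.const_apply] at hr
  rw [h] at hr
  have hd := Measure.rnDeriv_withDensity (R.refLaw P K) (Measurable.lintegral_prod_right'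
    (f := fun p : Y × (Fin t → X) => Kernel.rnDeriv (R.outGivenHead P t t)
      (Kernel.const _ (R.refLaw P K)) (splice x p.2) p.1) (ν := inputLaw P t) hm)
  filter_upwards [hr, hd] with y h1 h2
  rw [dens, h1, h2, headDens]
  exact (lintegral_mul_const (f := fun z => Kernel.rnDeriv (R.outGivenHead P t t)
    (Kernel.const _ (R.refLaw P K)) (splice x z) y) _ (hm.comp (by fun_prop :
      Measurable fun z : Fin t → X => (y, z)))).symm

/-- The information density of the first `s` of `t` inputs, at the inputs and the output of the
channel with `k` transmitters. -/
theorem dens_eq_headDens_headLaw {s k : ℕ} (hst : s ≤ t) (htk : t ≤ k) (hk : k ≤ K) :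
    ∀ᵐ p ∂(R.headLaw P s k), R.dens P K s t p.1 p.2 = R.headDens P K s t p.1 p.2 := by
  have hs : MeasurableSet {p : (Fin s → X) × Y | R.dens P K s t p.1 p.2 = R.headDens P K s t p.1 p.2} :=
    measurableSet_eq_fun (R.measurable_dens P K s t) (R.measurable_headDens P K s t)
  have h := (Measure.ae_prod_iff_ae_ae (μ := inputLaw P s) (ν := R.outLaw P k) hs).2 (by
    filter_upwards [ae_dens_eq_headDens hac h1 ht (s := s)] with x hx
    exact (R.outLaw_absolutelyContinuous P hk).ae_le hx)
  have hJ := hac k (h1.trans htk) hk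
  have hmap : ((inputLaw P k).prod (R.outLaw P k)).map (head (hst.trans htk))
      = (inputLaw P s).prod (R.outLaw P k) := by
    have := Measure.map_prod_map (inputLaw P k) (R.outLaw P k)
      (f := fun x (i : Fin s) => x (Fin.castLE (hst.trans htk) i)) (g := id) (by fun_prop)
      measurable_id
    have e := pi_map_injective (fun _ : Fin k => P) (Fin.castLE_injective (hst.trans htk))
    unfold inputLaw at *
    rw [Measure.map_id, e] at this
    exact this.symm
  rw [headLaw_eq_map R P (hst.trans htk)]
  refine (hJ.map (measurable_head _)).ae_le ?_
  rw [hmap]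
  exact h

end Densities

end RAC

end

/-! ### Convexity of the information in the number of inputs -/

noncomputable section

/-- For a sequence with `2 a 1 < a 2` that is convex, the ratio `a j / j` increases
strictly. -/
theorem mul_lt_mul_of_convex {a : ℕ → ℝ} {k : ℕ}
    (hc : ∀ j, j + 2 ≤ k → 2 * a (j + 1) ≤ a j + a (j + 2)) (hs : 2 ≤ k → 2 * a 1 < a 2)
    {s t : ℕ} (h1 : 1 ≤ s) (hst : s < t) (htk : t ≤ k) : t * a s < s * a t := by
  -- the increments are monotone, and the first one is the smallest, strictly
  have hstep : ∀ s, 1 ≤ s → s + 1 ≤ k → a s < s * (a (s + 1) - a s) := by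
    intro s h1
    induction s, h1 using Nat.le_induction with
    | base => intro hk; have := hs hk; norm_num; linarith
    | succ s h1 ih =>
      intro hk
      have h := ih (by omega)
      have h2 := hc s hk
      push_cast
      have h3 : (s : ℝ) * (a (s + 1) - a s) ≤ s * (a (s + 2) - a (s + 1)) :=
        mul_le_mul_of_nonneg_left (by linarith) (Nat.cast_nonneg s)
      have e : s + 1 + 1 = s + 2 := rfl
      rw [e]
      linarith
  induction t, (hst : s + 1 ≤ t) using Nat.le_induction with
  | base =>
    have := hstep s h1 htk
    push_cast
    linarith
  | succ t hst' ih =>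
    have h := ih (by omega)
    have h2 := hstep t (by omega) htk
    have ht : (0 : ℝ) < t := by exact_mod_cast (by omega : 0 < t)
    have hs' : (0 : ℝ) < s := by exact_mod_cast (by omega : 0 < s)
    push_cast
    have h3 : (t + 1) * (t * a s) < (t + 1) * (s * a t) :=
      mul_lt_mul_of_pos_left h (by linarith)
    have h4 : s * (a t) < s * (t * (a (t + 1) - a t)) := mul_lt_mul_of_pos_left h2 hs'
    have h5 : t * ((t + 1) * a s) < t * (s * a (t + 1)) := by nlinarith
    exact lt_of_mul_lt_mul_left h5 ht.le

theorem toReal_log_eq_log_toReal (x : ℝ≥0∞) : (ENNReal.log x).toReal = Real.log x.toReal := by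
  rcases eq_or_ne x 0 with rfl | h0
  · simp
  rcases eq_or_ne x ∞ with rfl | ht
  · simp
  rw [← ENNReal.ofReal_toReal ht, ENNReal.log_ofReal_of_pos (ENNReal.toReal_pos h0 ht)]
  simp

namespace RAC

variable {X Y : Type*} [MeasurableSpace X] [MeasurableSpace Y] [StandardBorelSpace Y]

/-- The coordinates below `m`. -/
abbrev below (k m : ℕ) : Finset (Fin k) := Finset.univ.filter fun i => i.1 < m

theorem card_below {k m : ℕ} (h : m ≤ k) : (below k m).card = m := by
  have : below k m = (Finset.univ : Finset (Fin m)).map (Fin.castLEEmb h) := by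
    ext i
    simp only [below, Finset.mem_filter, Finset.mem_univ, true_and, Finset.mem_map]
    constructor
    · intro hi
      exact ⟨⟨i.1, hi⟩, rfl⟩
    · rintro ⟨j, rfl⟩
      exact j.2
  rw [this, Finset.card_map, Finset.card_univ, Fintype.card_fin]

/-- The information about the output in the inputs of `S`. -/
def infoOf (R : RAC X Y) (P : Measure X) (K k : ℕ) (S : Finset (Fin k)) : ℝ :=
  ∫ p, Real.log (margDensity P (R.dens P K k k) S p.1 p.2).toReal ∂(inputLaw P k ⊗ₘ R.W k)

/-- The information about `Y_k` in `m` of the `k` inputs. -/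
def info (R : RAC X Y) (P : Measure X) (K k m : ℕ) : ℝ := R.infoOf P K k (below k m)

variable {R : RAC X Y} {P : Measure X} [IsProbabilityMeasure P] {K : ℕ}

instance (s t : ℕ) : IsProbabilityMeasure (R.headLaw P s t) := by
  unfold headLaw; infer_instance

theorem sumDensity_eq {k : ℕ} (p : (Fin k → X) × Y) :
    R.sumDensity P K k p = Real.log (R.dens P K k k p.1 p.2).toReal := by
  rw [sumDensity, infoDensity_eq, toReal_log_eq_log_toReal]

theorem I_eq_info (k : ℕ) : R.I P K k = R.info P K k k := by
  have : below k k = Finset.univ := by ext i; simp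
  unfold I info infoOf
  rw [this]
  simp_rw [margDensity_univ, sumDensity_eq]

section Joint

variable (hmom : R.MomentConditions P K) {k : ℕ} (h1 : 1 ≤ k) (hk : k ≤ K)
include hmom h1 hk

theorem joint_eq_withDensity_pi : inputLaw P k ⊗ₘ R.W k
    = ((Measure.pi fun _ : Fin k => P).prod (R.outLaw P k)).withDensity
      (Function.uncurry (R.dens P K k k)) := joint_eq_withDensity hmom.abs_cont h1 hk

theorem lintegral_dens_pi : ∀ᵐ y ∂(R.outLaw P k),
    ∫⁻ x, R.dens P K k k x y ∂(Measure.pi fun _ : Fin k => P) = 1 :=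
  lintegral_dens_eq_one hmom.abs_cont h1 hk

omit hmom in
theorem dens_perm_out (hperm : R.PermutationInvariant K) (σ : Equiv.Perm (Fin k)) (x : Fin k → X) :
    ∀ᵐ y ∂(R.outLaw P k), R.dens P K k k (x ∘ σ) y = R.dens P K k k x y :=
  (R.outLaw_absolutelyContinuous P hk).ae_le (R.dens_comp_perm P K hperm hk σ x)

theorem infoOf_empty : R.infoOf P K k ∅ = 0 := by
  refine integral_eq_zero_of_ae ?_
  have h := (Measure.quasiMeasurePreserving_snd (μ := Measure.pi fun _ : Fin k => P)).ae
    (lintegral_dens_pi hmom h1 hk)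
  filter_upwards [(joint_absolutelyContinuous (R.measurable_dens P K k k)
    (joint_eq_withDensity_pi hmom h1 hk)).ae_le h] with p hp
  rw [margDensity_empty, hp]
  simp

theorem integrable_log_margDensity (hperm : R.PermutationInvariant K) (S : Finset (Fin k)) :
    Integrable (fun p => Real.log (margDensity P (R.dens P K k k) S p.1 p.2).toReal)
      (inputLaw P k ⊗ₘ R.W k) := by
  have hD := R.measurable_dens P K k k
  have hJ := joint_eq_withDensity_pi hmom h1 hk
  have hm : S.card ≤ k := by simpa using S.card_le_univ
  rcases Nat.eq_zero_or_pos S.card with h0 | hpos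
  · rw [Finset.card_eq_zero] at h0
    subst h0
    refine (integrable_zero _ _ _).congr ?_
    have h := (Measure.quasiMeasurePreserving_snd (μ := Measure.pi fun _ : Fin k => P)).ae
      (lintegral_dens_pi hmom h1 hk)
    filter_upwards [(joint_absolutelyContinuous hD hJ).ae_le h] with p hp
    rw [margDensity_empty, hp]
    simp
  · refine (log_margDensity_card_eq hD (dens_perm_out h1 hk hperm) hJ
      (card_below hm).symm).2 ?_
    have hmap := headLaw_eq_map R P hm
    have heq := dens_eq_headDens_headLaw hmom.abs_cont h1 hk (s := S.card) hm le_rfl hk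
    have hne : ∀ᵐ p ∂(R.headLaw P S.card k), R.headDens P K S.card k p.1 p.2 ≠ 0 := by
      rw [hmap, ae_map_iff (measurable_head hm).aemeasurable]
      · filter_upwards [ae_margDensity_ne_zero hD hJ (below k S.card)] with p hp
        rw [margDensity_dens R P K hm] at hp
        exact hp
      · exact (R.measurable_headDens P K S.card k (measurableSet_singleton 0)).compl
    have hL := hmom.var_finite S.card k k hpos hm le_rfl hk (by
      filter_upwards [heq, hne] with p h2 h3
      rw [infoDensity_eq, h2]
      simpa using h3)
    have hi := hL.integrable (by norm_num)
    rw [hmap, integrable_map_measure] at hi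
    · refine hi.congr ?_
      rw [hmap] at heq
      filter_upwards [ae_of_ae_map (measurable_head hm).aemeasurable heq] with p hp
      rw [Function.comp_apply, infoDensity_eq, hp, toReal_log_eq_log_toReal,
        margDensity_dens R P K hm]
      rfl
    · rw [← hmap]; exact hL.1
    · exact (measurable_head hm).aemeasurable

theorem infoOf_eq_info (hperm : R.PermutationInvariant K) (S : Finset (Fin k)) :
    R.infoOf P K k S = R.info P K k S.card :=
  (log_margDensity_card_eq (R.measurable_dens P K k k) (dens_perm_out h1 hk hperm)
    (joint_eq_withDensity_pi hmom h1 hk)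
    (card_below (by simpa using S.card_le_univ)).symm).1

/-- Submodularity for two sets of `j + 1` inputs that share `j` of them. -/
theorem info_convex (hperm : R.PermutationInvariant K) (j : ℕ) (hj : j + 2 ≤ k) :
    2 * R.info P K k (j + 1) ≤ R.info P K k j + R.info P K k (j + 2) := by
  have h := (integral_log_margDensity_submodular (R.measurable_dens P K k k)
    (joint_eq_withDensity_pi hmom h1 hk) (below k (j + 1))
    (insert ⟨j + 1, by omega⟩ (below k j)) (integrable_log_margDensity hmom h1 hk hperm)).1
  have eU : below k (j + 1) ∪ insert ⟨j + 1, by omega⟩ (below k j) = below k (j + 2) := by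
    ext i
    simp only [below, Finset.mem_union, Finset.mem_filter, Finset.mem_univ, true_and,
      Finset.mem_insert, Fin.ext_iff]
    omega
  have eI : below k (j + 1) ∩ insert ⟨j + 1, by omega⟩ (below k j) = below k j := by
    ext i
    simp only [below, Finset.mem_inter, Finset.mem_filter, Finset.mem_univ, true_and,
      Finset.mem_insert, Fin.ext_iff]
    omega
  have ec : (insert ⟨j + 1, by omega⟩ (below k j) : Finset (Fin k)).card = j + 1 := by
    rw [Finset.card_insert_of_notMem (by simp [below]), card_below (by omega)]
  rw [eU, eI] at h
  have e2 := infoOf_eq_info hmom h1 hk hperm (insert ⟨j + 1, by omega⟩ (below k j))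
  rw [ec] at e2
  unfold infoOf at e2
  rw [e2] at h
  change R.info P K k (j + 1) + _ ≤ R.info P K k (j + 2) + R.info P K k j at h
  linarith

/-- Interference excludes equality in submodularity for two single inputs. -/
theorem two_mul_info_one_lt [StandardBorelSpace X] (hperm : R.PermutationInvariant K)
    (hinterf : R.Interfering P K) (h2 : 2 ≤ k) : 2 * R.info P K k 1 < R.info P K k 2 := by
  by_contra hcon
  push Not at hcon
  have hD := R.measurable_dens P K k k
  have hJ := joint_eq_withDensity_pi hmom h1 hk
  set q : Fin k → Prop := fun i => 1 ≤ i.1 ∧ i.1 < 2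
  have eU : below k 1 ∪ Finset.univ.filter q = below k 2 := by
    ext i
    simp only [below, Finset.mem_union, Finset.mem_filter, Finset.mem_univ, true_and, q]
    omega
  have eI : below k 1 ∩ Finset.univ.filter q = ∅ := by
    ext i
    simp only [below, Finset.mem_inter, Finset.mem_filter, Finset.mem_univ, true_and, q,
      Finset.notMem_empty, iff_false]
    omega
  have ec : (Finset.univ.filter q).card = 1 := by
    rw [Finset.card_eq_one]
    refine ⟨⟨1, h2⟩, ?_⟩
    ext i
    simp only [Finset.mem_filter, Finset.mem_univ, true_and, q, Finset.mem_singleton, Fin.ext_iff]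
    omega
  have h := (integral_log_margDensity_submodular hD hJ (below k 1) (Finset.univ.filter q)
    (integrable_log_margDensity hmom h1 hk hperm)).2 (by
      change R.infoOf P K k _ + R.infoOf P K k _ ≤ R.infoOf P K k _ + R.infoOf P K k _
      rw [eU, eI, infoOf_eq_info hmom h1 hk hperm (Finset.univ.filter q), ec,
        infoOf_empty hmom h1 hk]
      change R.info P K k 2 + 0 ≤ R.info P K k 1 + _
      linarith)
  exact hinterf k hk 1 2 le_rfl one_lt_two h2
    (condIndepFun_of_margDensity_mul hD hJ (lintegral_dens_pi hmom h1 hk) (fun i => i.1 < 1) q eI h)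

/-- The information per input increases strictly with the number of inputs. -/
theorem mul_info_lt [StandardBorelSpace X] (hperm : R.PermutationInvariant K)
    (hinterf : R.Interfering P K) {s t : ℕ} (hs : 1 ≤ s) (hst : s < t) (htk : t ≤ k) :
    t * R.info P K k s < s * R.info P K k t :=
  mul_lt_mul_of_convex (info_convex hmom h1 hk hperm)
    (two_mul_info_one_lt hmom h1 hk hperm hinterf) hs hst htk

/-- If `I_k` vanished, then the information density would be constant, with variance zero. -/
theorem I_pos (hperm : R.PermutationInvariant K) : 0 < R.I P K k := by
  have hD := R.measurable_dens P K k k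
  have hJ := joint_eq_withDensity_pi hmom h1 hk
  have hi : Integrable (R.sumDensity P K k) (inputLaw P k ⊗ₘ R.W k) := by
    have := integrable_log_margDensity hmom h1 hk hperm Finset.univ
    simp_rw [margDensity_univ, ← sumDensity_eq] at this
    exact this
  have h0 := ae_margDensity_ne_zero hD hJ Finset.univ
  have ht := (joint_absolutelyContinuous hD hJ).ae_le (ae_margDensity_ne_top hD hJ Finset.univ)
  have hexp : ∫⁻ p, ENNReal.ofReal (Real.exp (-R.sumDensity P K k p)) ∂(inputLaw P k ⊗ₘ R.W k)
      ≤ 1 := by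
    calc ∫⁻ p, ENNReal.ofReal (Real.exp (-R.sumDensity P K k p)) ∂(inputLaw P k ⊗ₘ R.W k)
        = ∫⁻ p, (R.dens P K k k p.1 p.2)⁻¹ ∂(inputLaw P k ⊗ₘ R.W k) := by
          refine lintegral_congr_ae ?_
          filter_upwards [h0, ht] with p hp0 hpt
          rw [margDensity_univ] at hp0 hpt
          rw [sumDensity_eq, Real.exp_neg, Real.exp_log (ENNReal.toReal_pos hp0 hpt),
            ← ENNReal.toReal_inv, ENNReal.ofReal_toReal (by simpa using hp0)]
      _ = ∫⁻ y, ∫⁻ x, (R.dens P K k k x y)⁻¹ * R.dens P K k k x y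
            ∂(Measure.pi fun _ : Fin k => P) ∂(R.outLaw P k) :=
          lintegral_joint hD hJ (f := fun p => (R.dens P K k k p.1 p.2)⁻¹) hD.inv
      _ ≤ ∫⁻ _, ∫⁻ _, 1 ∂(Measure.pi fun _ : Fin k => P) ∂(R.outLaw P k) :=
          lintegral_mono fun y => lintegral_mono fun x => ENNReal.inv_mul_le_one _
      _ = 1 := by simp
  have hG := integral_nonpos_of_lintegral_exp_le (h := fun p => -R.sumDensity P K k p) hi.neg hexp
  rw [integral_neg] at hG
  refine lt_of_le_of_ne (by unfold I; linarith [hG.1]) fun hI => ?_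
  have hz := hG.2 (by unfold I at hI; rw [← hI]; simp)
  have hv := hmom.var_pos k h1 hk
  refine hv.ne' ?_
  have : R.sumDensity P K k =ᵐ[inputLaw P k ⊗ₘ R.W k] fun _ => 0 := by
    filter_upwards [hz] with p hp
    simpa using hp
  rw [V, variance_congr this]
  exact variance_zero _

end Joint

end RAC

end

/-! ### Rates for different numbers of transmitters -/

noncomputable section

namespace RAC

variable {X Y : Type*} [MeasurableSpace X] [MeasurableSpace Y]

theorem measurable_mixHead_left {t : ℕ} (s : ℕ) (x : Fin t → X) :
    Measurable fun z : Fin t → X => mixHead s z x :=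
  (measurable_mixHead s).comp (measurable_const.prodMk measurable_id)

theorem outGivenTail_apply (R : RAC X Y) (P : Measure X) [IsProbabilityMeasure P] (s k : ℕ)
    (x : Fin k → X) :
    R.outGivenTail P s k x = R.W k ∘ₘ (inputLaw P k).map fun z => mixHead s z x := by
  rw [outGivenTail, Kernel.comp_apply, Kernel.map_apply _ (measurable_mixHead s), Kernel.prod_apply,
    Kernel.id_apply, Kernel.const_apply, Measure.dirac_prod,
    Measure.map_map (measurable_mixHead s) measurable_prodMk_left]
  rfl

instance (R : RAC X Y) (P : Measure X) [IsProbabilityMeasure P] (s k : ℕ) :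
    IsMarkovKernel (R.outGivenTail P s k) := by
  have := Kernel.IsMarkovKernel.map (Kernel.id ×ₖ Kernel.const (Fin k → X) (inputLaw P k))
    (measurable_mixHead s (t := k) (X := X))
  unfold outGivenTail
  infer_instance

variable [StandardBorelSpace Y] {R : RAC X Y} {P : Measure X} [IsProbabilityMeasure P] {K : ℕ}
  (hmom : R.MomentConditions P K)
include hmom

/-- The law of the inputs, and of an output that depends on the last inputs only. -/
theorem tailLaw_eq_withDensity {k : ℕ} (h1 : 1 ≤ k) (hk : k ≤ K) (t : ℕ) :
    inputLaw P k ⊗ₘ R.outGivenTail P t k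
      = ((Measure.pi fun _ : Fin k => P).prod (R.outLaw P k)).withDensity fun p =>
        margDensity P (R.dens P K k k) (Finset.univ.filter fun i : Fin k => t ≤ i.1) p.1 p.2 := by
  set S : Finset (Fin k) := Finset.univ.filter fun i : Fin k => t ≤ i.1
  have hD := R.measurable_dens P K k k
  have hpw : ∀ x z : Fin k → X, mixHead t z x = S.piecewise x z := fun x z => by
    funext i
    by_cases hi : t ≤ i.1 <;> simp [mixHead, Finset.piecewise, S, hi]
  have hW : ∀ᵐ x ∂(inputLaw P k), ∀ᵐ z ∂(inputLaw P k), R.W k (S.piecewise x z)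
      = (R.outLaw P k).withDensity (R.dens P K k k (S.piecewise x z)) := by
    have h := ae_W_eq_withDensity hmom.abs_cont h1 hk
    unfold inputLaw at *
    rw [← map_piecewise P S] at h
    exact Measure.ae_ae_of_ae_prod (ae_of_ae_map (measurable_piecewise S).aemeasurable h)
  ext A hA
  rw [Measure.compProd_apply hA, withDensity_apply _ hA, ← lintegral_indicator hA,
    lintegral_prod _ ((measurable_margDensity hD S).indicator hA).aemeasurable]
  refine lintegral_congr_ae ?_
  filter_upwards [hW] with x hx
  have hA' : MeasurableSet (Prod.mk x ⁻¹' A) := measurable_prodMk_left hA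
  have hm : Measurable fun q : (Fin k → X) × Y => R.dens P K k k (S.piecewise x q.1) q.2 :=
    hD.comp (((measurable_piecewise S).comp (by fun_prop :
      Measurable fun q : (Fin k → X) × Y => (x, q.1))).prodMk measurable_snd)
  rw [outGivenTail_apply, Measure.bind_apply hA' (R.W k).aemeasurable,
    lintegral_map ((R.W k).measurable_coe hA') (measurable_mixHead_left t x)]
  have e : ∫⁻ y, A.indicator (fun p => margDensity P (R.dens P K k k) S p.1 p.2) (x, y)
      ∂(R.outLaw P k) = ∫⁻ y in Prod.mk x ⁻¹' A, ∫⁻ z, R.dens P K k k (S.piecewise x z) y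
        ∂(inputLaw P k) ∂(R.outLaw P k) := by
    rw [← lintegral_indicator hA']
    rfl
  rw [e, lintegral_lintegral_swap (by exact (hm.comp measurable_swap).aemeasurable)]
  refine lintegral_congr_ae ?_
  filter_upwards [hx] with z hz
  rw [hpw, hz, withDensity_apply _ hA']

/-- Friendliness bounds the information in `t` inputs, given the `k - t` others, by `I_t`. -/
theorem info_sub_info_le_I [Zero X] (hperm : R.PermutationInvariant K) (hred : R.Reducible K)
    (hfr : R.Friendly P K) {t k : ℕ} (ht : 1 ≤ t) (htk : t < k) (hk : k ≤ K) :
    R.info P K k k - R.info P K k (k - t) ≤ R.I P K t := by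
  have h1 : 1 ≤ k := ht.trans htk.le
  set S : Finset (Fin k) := Finset.univ.filter fun i : Fin k => t ≤ i.1 with hS
  have hcard : S.card = k - t := by
    have h : S = (below k t)ᶜ := by ext i; simp [S, below]
    rw [h, Finset.card_compl, card_below htk.le, Fintype.card_fin]
  have hD := R.measurable_dens P K k k
  have hJ := joint_eq_withDensity_pi hmom h1 hk
  have hmm : Measurable fun p : (Fin k → X) × Y => margDensity P (R.dens P K k k) S p.1 p.2 :=
    measurable_margDensity hD S
  have hf : Measurable fun p : (Fin k → X) × Y =>
      R.dens P K k k p.1 p.2 / margDensity P (R.dens P K k k) S p.1 p.2 := Measurable.div hD hmm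
  have hne := ae_margDensity_ne_zero hD hJ S
  have hnt := ae_margDensity_ne_top hD hJ S
  have hi := integrable_log_margDensity hmom h1 hk hperm
  have hJ' : inputLaw P k ⊗ₘ R.W k = (inputLaw P k ⊗ₘ R.outGivenTail P t k).withDensity
      (fun p => R.dens P K k k p.1 p.2 / margDensity P (R.dens P K k k) S p.1 p.2) := by
    rw [tailLaw_eq_withDensity hmom h1 hk t, ← withDensity_mul _ hmm hf]
    nth_rewrite 1 [hJ]
    refine withDensity_congr_ae ?_
    rw [hJ, ae_withDensity_iff hD] at hne
    filter_upwards [hne, hnt] with p h2 h3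
    rw [Pi.mul_apply]
    by_cases h0 : R.dens P K k k p.1 p.2 = 0
    · simp [Function.uncurry, h0]
    · exact (ENNReal.mul_div_cancel (h2 h0) h3).symm
  have hL := klDiv_withDensity hf hJ' (h := fun p =>
    Real.log (margDensity P (R.dens P K k k) Finset.univ p.1 p.2).toReal
    - Real.log (margDensity P (R.dens P K k k) S p.1 p.2).toReal) ((hi _).sub (hi _)) (by
      have hac := joint_absolutelyContinuous hD hJ
      filter_upwards [hne, hac.ae_le hnt, ae_margDensity_ne_zero hD hJ Finset.univ,
        hac.ae_le (ae_margDensity_ne_top hD hJ Finset.univ)] with p a b c d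
      rw [margDensity_univ] at c d ⊢
      rw [ENNReal.toReal_div, Real.log_div (ENNReal.toReal_pos c d).ne'
        (ENNReal.toReal_pos a b).ne'])
  rw [integral_sub (hi _) (hi _)] at hL
  have eS : ∫ p, Real.log (margDensity P (R.dens P K k k) S p.1 p.2).toReal
      ∂(inputLaw P k ⊗ₘ R.W k) = R.info P K k (k - t) := by
    rw [← hcard]; exact infoOf_eq_info hmom h1 hk hperm S
  have eU : ∫ p, Real.log (margDensity P (R.dens P K k k) Finset.univ p.1 p.2).toReal
      ∂(inputLaw P k ⊗ₘ R.W k) = R.info P K k k := by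
    have : below k k = Finset.univ := by ext i; simp
    rw [info, this]; rfl
  rw [eS, eU] at hL
  have htK : t ≤ K := htk.le.trans hk
  have hi' : Integrable (R.sumDensity P K t) (inputLaw P t ⊗ₘ R.W t) := by
    have := integrable_log_margDensity hmom ht htK hperm Finset.univ
    simp_rw [margDensity_univ, ← sumDensity_eq] at this
    exact this
  have hR : mutualInfo (inputLaw P t) (R.outSilentTail t k) = ENNReal.ofReal (R.I P K t) := by
    have e : R.outSilentTail t k = R.W t := by
      ext1 x
      rw [outSilentTail, Kernel.comap_apply]
      exact (hred k hk t htk x).symm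
    rw [e]
    exact klDiv_withDensity (R.measurable_dens P K t t) (joint_eq_withDensity hmom.abs_cont ht htK)
      hi' (Filter.Eventually.of_forall fun p => (sumDensity_eq p).symm)
  have h := hfr k hk t ht htk.le
  rw [hL, hR] at h
  exact (ENNReal.ofReal_le_ofReal_iff (I_pos hmom ht htK hperm).le).1 h

/-- `t` inputs carry less information among `k > t` active transmitters than alone. -/
theorem info_lt_I [StandardBorelSpace X] [Zero X] (hperm : R.PermutationInvariant K)
    (hred : R.Reducible K) (hfr : R.Friendly P K) (hinterf : R.Interfering P K) {t k : ℕ}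
    (ht : 1 ≤ t) (htk : t < k) (hk : k ≤ K) : R.info P K k t < R.I P K t := by
  have h1 : 1 ≤ k := ht.trans htk.le
  have h := info_sub_info_le_I hmom hperm hred hfr ht htk hk
  have a := mul_info_lt hmom h1 hk hperm hinterf ht htk le_rfl
  have b := mul_info_lt hmom h1 hk hperm hinterf (s := k - t) (t := k) (by omega) (by omega) le_rfl
  rw [Nat.cast_sub htk.le] at b
  have hk0 : (0 : ℝ) < k := by exact_mod_cast h1
  nlinarith

/-- The rate per transmitter decreases with the number of transmitters. -/
theorem mul_I_lt [StandardBorelSpace X] [Zero X] (hperm : R.PermutationInvariant K)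
    (hred : R.Reducible K) (hfr : R.Friendly P K) (hinterf : R.Interfering P K) {t k : ℕ}
    (ht : 1 ≤ t) (htk : t < k) (hk : k ≤ K) : t * R.I P K k < k * R.I P K t := by
  have h1 : 1 ≤ k := ht.trans htk.le
  have h := info_lt_I hmom hperm hred hfr hinterf ht htk hk
  have h' := info_sub_info_le_I hmom hperm hred hfr ht htk hk
  have b := mul_info_lt hmom h1 hk hperm hinterf (s := k - t) (t := k) (by omega) (by omega) le_rfl
  rw [Nat.cast_sub htk.le] at b
  have hk0 : (0 : ℝ) < k := by exact_mod_cast h1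
  rw [I_eq_info]
  nlinarith

/-- At outputs of another channel than the `t`-th the integral may be less than one, but never more. -/
theorem lintegral_headDens_le_one {s t : ℕ} (h1 : 1 ≤ t) (ht : t ≤ K) {k : ℕ} (hk : k ≤ K) :
    ∀ᵐ y ∂(R.outLaw P k), ∫⁻ x, R.headDens P K s t x y ∂(inputLaw P s) ≤ 1 := by
  filter_upwards [(R.outLaw_absolutelyContinuous P hk).ae_le
    (lintegral_dens_le_one hmom.abs_cont h1 ht)] with y hy
  rwa [lintegral_headDens]

theorem lintegral_headDens_prod_le_one {s t : ℕ} (h1 : 1 ≤ t) (ht : t ≤ K) {k : ℕ} (hk : k ≤ K) :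
    ∫⁻ p, R.headDens P K s t p.1 p.2 ∂((inputLaw P s).prod (R.outLaw P k)) ≤ 1 := by
  rw [lintegral_prod_symm (fun p : (Fin s → X) × Y => R.headDens P K s t p.1 p.2)
    (R.measurable_headDens P K s t).aemeasurable]
  refine (lintegral_mono_ae (lintegral_headDens_le_one hmom h1 ht hk)).trans ?_
  simp

theorem headLaw_eq_withDensity {s k : ℕ} (h1 : 1 ≤ k) (hk : k ≤ K) (hsk : s ≤ k) :
    R.headLaw P s k = ((inputLaw P s).prod (R.outLaw P k)).withDensity
      (Function.uncurry (R.headDens P K s k)) := by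
  have hD := R.measurable_dens P K k k
  have hJ := joint_eq_withDensity_pi hmom h1 hk
  ext A hA
  have hm := measurable_head (X := X) (Y := Y) hsk
  rw [headLaw_eq_map R P hsk, Measure.map_apply hm hA, ← lintegral_indicator_one (hm hA),
    lintegral_joint_of_depends hD hJ (S := below k s) (measurable_one.indicator (hm hA)),
    withDensity_apply _ hA, ← lintegral_indicator hA]
  · have hQ : ((Measure.pi fun _ : Fin k => P).prod (R.outLaw P k)).map (head hsk)
        = (inputLaw P s).prod (R.outLaw P k) := by
      have := Measure.map_prod_map (inputLaw P k) (R.outLaw P k)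
        (f := fun x (i : Fin s) => x (Fin.castLE hsk i)) (g := id) (by fun_prop) measurable_id
      have e := pi_map_injective (fun _ : Fin k => P) (Fin.castLE_injective hsk)
      unfold inputLaw at *
      rw [Measure.map_id, e] at this
      exact this.symm
    rw [← hQ, lintegral_map ((R.measurable_headDens P K s k).indicator hA) hm]
    refine lintegral_congr fun p => ?_
    rw [margDensity_dens R P K hsk]
    by_cases hp : head hsk p ∈ A
    · rw [Set.indicator_of_mem (by exact hp), Set.indicator_of_mem hp]
      exact one_mul _
    · rw [Set.indicator_of_notMem (by exact hp), Set.indicator_of_notMem hp, zero_mul]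
  · intro y x x'
    have : head (Y := Y) hsk ((below k s).piecewise x x', y) = head hsk (x, y) := by
      simp only [head, Prod.mk.injEq, and_true]
      funext i
      simp [Finset.piecewise]
    classical
    simp only [Set.indicator_apply, Set.mem_preimage, this]
    rfl

theorem ae_headDens_ne_top {s t k : ℕ} (h1 : 1 ≤ t) (ht : t ≤ K) (h1k : 1 ≤ k) (hk : k ≤ K)
    (hsk : s ≤ k) : ∀ᵐ p ∂(R.headLaw P s k), R.headDens P K s t p.1 p.2 ≠ ∞ := by
  rw [headLaw_eq_withDensity hmom h1k hk hsk]
  refine (withDensity_absolutelyContinuous _ _).ae_le ?_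
  have := ae_lt_top (R.measurable_headDens P K s t) (μ := (inputLaw P s).prod (R.outLaw P k))
    ((lintegral_headDens_prod_le_one hmom h1 ht hk).trans_lt ENNReal.one_lt_top).ne
  filter_upwards [this] with p hp using hp.ne

/-- The information about `Y_k` in `s` inputs is at least the mean of any information density. -/
theorem integral_log_headDens_le {s t k : ℕ} (h1 : 1 ≤ t) (hst : s ≤ t) (htk : t ≤ k) (hk : k ≤ K)
    (hperm : R.PermutationInvariant K)
    (hne : ∀ᵐ p ∂(R.headLaw P s k), R.headDens P K s t p.1 p.2 ≠ 0)
    (hi : Integrable (fun p => Real.log (R.headDens P K s t p.1 p.2).toReal) (R.headLaw P s k)) :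
    ∫ p, Real.log (R.headDens P K s t p.1 p.2).toReal ∂(R.headLaw P s k) ≤ R.info P K k s := by
  have h1k : 1 ≤ k := h1.trans htk
  have hsk : s ≤ k := hst.trans htk
  have hH := headLaw_eq_withDensity hmom h1k hk hsk
  have hu := R.measurable_headDens P K s t
  have hw := R.measurable_headDens P K s k
  have hw0 : ∀ᵐ p ∂(R.headLaw P s k), R.headDens P K s k p.1 p.2 ≠ 0 := by
    rw [hH, ae_withDensity_iff hw]
    exact Filter.Eventually.of_forall fun p hp => hp
  have hmeas : Measurable fun p : (Fin s → X) × Y => Real.log (R.headDens P K s k p.1 p.2).toReal :=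
    hw.ennreal_toReal.log
  have hinf := integrable_log_margDensity hmom h1k hk hperm (below k s)
  have hwi : Integrable (fun p => Real.log (R.headDens P K s k p.1 p.2).toReal)
      (R.headLaw P s k) := by
    rw [headLaw_eq_map R P hsk, integrable_map_measure hmeas.aestronglyMeasurable
      (measurable_head hsk).aemeasurable]
    refine hinf.congr (Filter.Eventually.of_forall fun p => ?_)
    simp only [margDensity_dens R P K hsk]
    rfl
  have hinfo : R.info P K k s
      = ∫ p, Real.log (R.headDens P K s k p.1 p.2).toReal ∂(R.headLaw P s k) := by
    rw [headLaw_eq_map R P hsk, integral_map (measurable_head hsk).aemeasurable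
      hmeas.aestronglyMeasurable]
    refine integral_congr_ae (Filter.Eventually.of_forall fun p => ?_)
    simp only [margDensity_dens R P K hsk]
    rfl
  have hexp : ∫⁻ p, ENNReal.ofReal (Real.exp (Real.log (R.headDens P K s t p.1 p.2).toReal
      - Real.log (R.headDens P K s k p.1 p.2).toReal)) ∂(R.headLaw P s k) ≤ 1 := by
    calc _ = ∫⁻ p, R.headDens P K s t p.1 p.2 / R.headDens P K s k p.1 p.2 ∂(R.headLaw P s k) := by
          refine lintegral_congr_ae ?_
          filter_upwards [hne, hw0, ae_headDens_ne_top hmom h1 (htk.trans hk) h1k hk hsk,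
            ae_headDens_ne_top hmom h1k hk h1k hk hsk] with p a b c d
          rw [Real.exp_sub, Real.exp_log (ENNReal.toReal_pos a c),
            Real.exp_log (ENNReal.toReal_pos b d), ← ENNReal.toReal_div, ENNReal.ofReal_toReal]
          exact ENNReal.div_ne_top c b
      _ = ∫⁻ p, R.headDens P K s k p.1 p.2 *
            (R.headDens P K s t p.1 p.2 / R.headDens P K s k p.1 p.2)
            ∂((inputLaw P s).prod (R.outLaw P k)) := by
          nth_rewrite 1 [hH]
          exact lintegral_withDensity_eq_lintegral_mul _ hw (hu.div hw)
      _ ≤ ∫⁻ p, R.headDens P K s t p.1 p.2 ∂((inputLaw P s).prod (R.outLaw P k)) :=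
          lintegral_mono fun p => ENNReal.mul_div_le
      _ ≤ 1 := lintegral_headDens_prod_le_one hmom h1 (htk.trans hk) hk
  have hG := (integral_nonpos_of_lintegral_exp_le (hi.sub hwi) hexp).1
  have : ∫ p, (Real.log (R.headDens P K s t p.1 p.2).toReal
      - Real.log (R.headDens P K s k p.1 p.2).toReal) ∂(R.headLaw P s k) ≤ 0 := hG
  rw [integral_sub hi hwi] at this
  rw [hinfo]
  linarith

end RAC

end

/-! ### Tails of the density of the shared messages -/

noncomputable section

/-- The probability that `n` independent trials all avoid an event of probability `q > 0`. -/
theorem one_sub_pow_le_div_sqrt {q : ℝ} (h0 : 0 < q) (h1 : q ≤ 1) {n : ℕ} (hn : 1 ≤ n) :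
    (1 - q) ^ n ≤ q⁻¹ / √n := by
  have hn' : (1 : ℝ) ≤ n := by exact_mod_cast hn
  have a : (1 + n * q) * (1 - q) ^ n ≤ 1 := by
    have b : 1 + n * q ≤ (1 + q) ^ n := one_add_mul_le_pow (by linarith) n
    calc (1 + n * q) * (1 - q) ^ n ≤ (1 + q) ^ n * (1 - q) ^ n := by
          gcongr
      _ = (1 - q ^ 2) ^ n := by rw [← mul_pow]; ring_nf
      _ ≤ 1 := pow_le_one₀ (by nlinarith) (by nlinarith)
  have hs : √(n : ℝ) ≤ n := by
    rw [Real.sqrt_le_left (by linarith)]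
    nlinarith
  have hs0 : 0 < √(n : ℝ) := Real.sqrt_pos.2 (by linarith)
  have hp : 0 ≤ (1 - q) ^ n := pow_nonneg (by linarith) n
  rw [le_div_iff₀ hs0, ← one_div, le_div_iff₀ h0]
  calc (1 - q) ^ n * √n * q ≤ (1 - q) ^ n * n * q := by gcongr
    _ ≤ (1 + n * q) * (1 - q) ^ n := by nlinarith
    _ ≤ 1 := a

/-- A product of i.i.d. likelihood ratios exceeds an exponential rate above its mean with
probability `O(n^(-1/2))`; a ratio that may vanish makes the product vanish with high probability. -/
theorem exists_tail_bound_of_integral_log_lt {Ω : Type*} [MeasurableSpace Ω] (J : Measure Ω)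
    [IsProbabilityMeasure J] {u : Ω → ℝ≥0∞} (hu : Measurable u) (hfin : ∀ᵐ ω ∂J, u ω ≠ ∞) {a : ℝ}
    (h : (∀ᵐ ω ∂J, u ω ≠ 0) → MemLp (fun ω => Real.log (u ω).toReal) 2 J ∧
      ∫ ω, Real.log (u ω).toReal ∂J < a) :
    ∃ c < a, ∃ G, 0 ≤ G ∧ ∀ n : ℕ, 1 ≤ n →
      (Measure.pi fun _ : Fin n => J).real {ω | ENNReal.ofReal (Real.exp (n * c)) < ∏ i, u (ω i)}
        ≤ G / √n := by
  have hcoord : ∀ n : ℕ, ∀ {p : Ω → Prop}, (∀ᵐ ω ∂J, p ω) →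
      ∀ᵐ ω ∂(Measure.pi fun _ : Fin n => J), ∀ i, p (ω i) := fun n p hp => by
    rw [ae_all_iff]
    intro i
    exact (measurePreserving_eval (fun _ : Fin n => J) i).quasiMeasurePreserving.ae hp
  by_cases hz : ∀ᵐ ω ∂J, u ω ≠ 0
  · obtain ⟨hL, hE⟩ := h hz
    set f : Ω → ℝ := fun ω => Real.log (u ω).toReal with hf
    set E := ∫ ω, f ω ∂J with hEdef
    have hd : 0 < (a - E) / 2 := by linarith
    -- Chebyshev at the rate half way between the mean and `a`
    refine ⟨(a + E) / 2, by linarith, variance f J / ((a - E) / 2) ^ 2,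
      div_nonneg (variance_nonneg _ _) (sq_nonneg _), fun n hn => ?_⟩
    have hn' : (1 : ℝ) ≤ n := by exact_mod_cast hn
    have hn0 : (0 : ℝ) < n := by linarith
    have hch := pi_chebyshev J hL n (c := n * ((a - E) / 2)) (by positivity)
    have hsub : (Measure.pi fun _ : Fin n => J)
        {ω | ENNReal.ofReal (Real.exp (n * ((a + E) / 2))) < ∏ i, u (ω i)}
        ≤ (Measure.pi fun _ : Fin n => J)
          {ω | n * ((a - E) / 2) ≤ |∑ i, f (ω i) - n * ∫ x, f x ∂J|} := by
      refine measure_mono_ae ?_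
      filter_upwards [hcoord n hz, hcoord n hfin] with ω h0 ht hω
      have hpos : ∀ i, 0 < (u (ω i)).toReal := fun i => ENNReal.toReal_pos (h0 i) (ht i)
      have hω' : ENNReal.ofReal (Real.exp (n * ((a + E) / 2))) < ∏ i, u (ω i) := hω
      have e : ∏ i, u (ω i) = ENNReal.ofReal (∏ i, (u (ω i)).toReal) := by
        rw [ENNReal.ofReal_prod_of_nonneg fun i _ => (hpos i).le]
        exact Finset.prod_congr rfl fun i _ => (ENNReal.ofReal_toReal (ht i)).symm
      rw [e, ENNReal.ofReal_lt_ofReal_iff (Finset.prod_pos fun i _ => hpos i),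
        ← Real.lt_log_iff_exp_lt (Finset.prod_pos fun i _ => hpos i),
        Real.log_prod (fun i _ => (hpos i).ne')] at hω'
      change n * ((a - E) / 2) ≤ |∑ i, f (ω i) - n * E|
      refine le_trans ?_ (le_abs_self _)
      have : ∑ i, f (ω i) = ∑ i, Real.log (u (ω i)).toReal := rfl
      rw [this]
      nlinarith
    have hreal := (ENNReal.toReal_mono (measure_ne_top _ _) hsub).trans hch
    refine hreal.trans ?_
    have hs0 : 0 < √(n : ℝ) := Real.sqrt_pos.2 hn0
    have hs : √(n : ℝ) ≤ n := by
      rw [Real.sqrt_le_left (by linarith)]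
      nlinarith
    have e : (n : ℝ) * variance f J / (n * ((a - E) / 2)) ^ 2
        = variance f J / ((a - E) / 2) ^ 2 / n := by
      field_simp
    rw [e]
    have := variance_nonneg f J
    gcongr
  · set N : Set Ω := {ω | u ω = 0}
    have hN : MeasurableSet N := hu (measurableSet_singleton 0)
    have hq : 0 < J.real N := by
      rw [measureReal_def, ENNReal.toReal_pos_iff]
      refine ⟨pos_iff_ne_zero.2 fun h0 => hz ?_, measure_lt_top _ _⟩
      rwa [ae_iff, show {ω | ¬u ω ≠ 0} = N by ext; simp [N]]
    -- the product vanishes as soon as one factor does, so that any rate will do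
    refine ⟨a - 1, by linarith, (J.real N)⁻¹, inv_nonneg.2 hq.le, fun n hn => ?_⟩
    refine le_trans ?_ (one_sub_pow_le_div_sqrt hq measureReal_le_one hn)
    have hsub : {ω : Fin n → Ω | ENNReal.ofReal (Real.exp (n * (a - 1))) < ∏ i, u (ω i)}
        ⊆ Set.univ.pi fun _ => Nᶜ := by
      intro ω hω i _ hi
      have h0 : ∏ i, u (ω i) = 0 := Finset.prod_eq_zero (Finset.mem_univ i) hi
      rw [Set.mem_ofPred_eq, h0] at hω
      exact not_lt_bot hω
    refine (measureReal_mono hsub).trans ?_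
    rw [measureReal_def, Measure.pi_pi, ENNReal.toReal_prod]
    simp only [Finset.prod_const, Finset.card_univ, Fintype.card_fin]
    have := probReal_compl_eq_one_sub (μ := J) hN
    rw [measureReal_def] at this
    rw [this]

namespace RAC

variable {X Y : Type*} [MeasurableSpace X] [MeasurableSpace Y]
variable [StandardBorelSpace Y] {R : RAC X Y} {P : Measure X} [IsProbabilityMeasure P] {K : ℕ}
  (hmom : R.MomentConditions P K)
include hmom

/-- If `s` of the `t` decoded messages are among the `k` transmitted ones, then with high probability
they contribute less than their share `s / t` of `n I_t` to the information density. -/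
theorem exists_headDens_tail_bound [StandardBorelSpace X] [Zero X]
    (hperm : R.PermutationInvariant K)
    (hred : R.Reducible K) (hfr : R.Friendly P K) (hinterf : R.Interfering P K) {s t k : ℕ}
    (hs : 1 ≤ s) (hst : s ≤ t) (htk : t ≤ k) (hk : k ≤ K) (hsk : s < k) :
    ∃ c < s / t * R.I P K t, ∃ G, 0 ≤ G ∧ ∀ n : ℕ, 1 ≤ n →
      (Measure.pi fun _ : Fin n => R.headLaw P s k).real
        {ω | ENNReal.ofReal (Real.exp (n * c)) < ∏ i, R.headDens P K s t (ω i).1 (ω i).2}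
        ≤ G / √n := by
  have ht : 1 ≤ t := hs.trans hst
  have h1k : 1 ≤ k := ht.trans htk
  have ht0 : (0 : ℝ) < t := by exact_mod_cast ht
  have hs0 : (0 : ℝ) < s := by exact_mod_cast hs
  have heq := dens_eq_headDens_headLaw hmom.abs_cont ht (htk.trans hk) hst htk hk
  refine exists_tail_bound_of_integral_log_lt (R.headLaw P s k) (R.measurable_headDens P K s t)
    (ae_headDens_ne_top hmom ht (htk.trans hk) h1k hk hsk.le) fun hne => ?_
  have hL : MemLp (fun p => Real.log (R.headDens P K s t p.1 p.2).toReal) 2 (R.headLaw P s k) := by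
    refine (memLp_congr_ae ?_).1 (hmom.var_finite s t k hs hst htk hk (by
      filter_upwards [heq, hne] with p h2 h3
      rw [infoDensity_eq, h2]
      simpa [Function.uncurry] using h3))
    filter_upwards [heq] with p hp
    rw [infoDensity_eq, hp, toReal_log_eq_log_toReal]
  refine ⟨hL, ?_⟩
  refine (integral_log_headDens_le hmom ht hst htk hk hperm hne (hL.integrable (by norm_num))).trans_lt
    ?_
  rw [div_mul_eq_mul_div, lt_div_iff₀ ht0]
  rcases htk.lt_or_eq with h | rfl
  · have a : t * R.info P K k s ≤ s * R.info P K k t := by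
      rcases hst.lt_or_eq with h' | rfl
      · exact (mul_info_lt hmom h1k hk hperm hinterf hs h' htk).le
      · exact le_rfl
    have b := info_lt_I hmom hperm hred hfr hinterf ht h hk
    nlinarith
  · have a := mul_info_lt hmom h1k hk hperm hinterf hs hsk le_rfl
    rw [I_eq_info]
    linarith

end RAC

end

/-! ### Random codewords -/

noncomputable section

/-- An injection between finite sets of coordinates extends to a permutation. -/
theorem exists_perm_castLE {s k : ℕ} (h : s ≤ k) {v : Fin s → Fin k} (hv : Function.Injective v) :
    ∃ σ : Equiv.Perm (Fin k), ∀ i, σ (Fin.castLE h i) = v i := by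
  classical
  refine ⟨((Equiv.ofInjective _ (Fin.castLE_injective h)).symm.trans
    (Equiv.ofInjective v hv)).extendSubtype, fun i => ?_⟩
  rw [Equiv.extendSubtype_apply_of_mem _ _ (Set.mem_range_self i)]
  have : (⟨Fin.castLE h i, Set.mem_range_self i⟩ : Set.range (Fin.castLE h))
      = Equiv.ofInjective _ (Fin.castLE_injective h) i := rfl
  rw [Equiv.trans_apply, this, Equiv.symm_apply_apply]
  rfl

/-- Markov's inequality for a product of i.i.d. ratios `f / u` of mean at most `1`. -/
theorem pi_prod_ratio_le {Ω : Type*} [MeasurableSpace Ω] (J : Measure Ω) [IsProbabilityMeasure J]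
    {u f : Ω → ℝ≥0∞} (hu : Measurable u) (hf : Measurable f) (h1 : ∫⁻ ω, f ω / u ω ∂J ≤ 1)
    (h0 : ∀ᵐ ω ∂J, u ω = 0 → f ω = 0) (ht : ∀ᵐ ω ∂J, u ω ≠ ∞) (n : ℕ) {a g : ℝ≥0∞}
    (hg : g ≠ 0) (hg' : g ≠ ∞) (ha : a ≠ ∞) :
    (Measure.pi fun _ : Fin n => J) {ω | ∏ i, u (ω i) ≤ a ∧ g < ∏ i, f (ω i)} ≤ a / g := by
  have hcoord : ∀ᵐ ω ∂(Measure.pi fun _ : Fin n => J), ∀ i, f (ω i) = u (ω i) * (f (ω i) / u (ω i)) := by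
    rw [ae_all_iff]
    intro i
    refine (measurePreserving_eval (fun _ : Fin n => J) i).quasiMeasurePreserving.ae
      (p := fun x => f x = u x * (f x / u x)) ?_
    filter_upwards [h0, ht] with ω a b
    by_cases h : u ω = 0
    · rw [a h, h]; simp
    · rw [ENNReal.mul_div_cancel h b]
  have hm : ∀ i : Fin n, Measurable fun x => f x / u x := fun _ => hf.div hu
  have hI : ∫⁻ ω, ∏ i, (f (ω i) / u (ω i)) ∂(Measure.pi fun _ : Fin n => J) ≤ 1 := by
    rw [lintegral_pi_prod (fun _ : Fin n => J) (f := fun _ x => f x / u x) hm]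
    simpa using pow_le_one' h1 n
  rcases eq_or_ne a 0 with rfl | ha0
  · refine (measure_mono_null_ae ?_ measure_empty).le.trans bot_le
    filter_upwards [hcoord] with ω h hω
    have hω' : ∏ i, u (ω i) ≤ 0 ∧ g < ∏ i, f (ω i) := hω
    have h2 : ∏ i, f (ω i) = 0 := by
      rw [Finset.prod_congr rfl fun i _ => h i, Finset.prod_mul_distrib, nonpos_iff_eq_zero.1 hω'.1,
        zero_mul]
    rw [h2] at hω'
    exact absurd hω'.2 not_lt_bot
  have hsub : (Measure.pi fun _ : Fin n => J) {ω | ∏ i, u (ω i) ≤ a ∧ g < ∏ i, f (ω i)}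
      ≤ (Measure.pi fun _ : Fin n => J) {ω | g / a ≤ ∏ i, (f (ω i) / u (ω i))} := by
    refine measure_mono_ae ?_
    filter_upwards [hcoord] with ω h hω
    have hω' : ∏ i, u (ω i) ≤ a ∧ g < ∏ i, f (ω i) := hω
    change g / a ≤ ∏ i, (f (ω i) / u (ω i))
    rw [ENNReal.div_le_iff ha0 ha]
    calc g ≤ ∏ i, f (ω i) := hω'.2.le
      _ = (∏ i, u (ω i)) * ∏ i, (f (ω i) / u (ω i)) := by
          rw [← Finset.prod_mul_distrib]
          exact Finset.prod_congr rfl fun i _ => h i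
      _ ≤ _ := by rw [mul_comm]; gcongr; exact hω'.1
  refine hsub.trans ?_
  have hmeas : AEMeasurable (fun ω : Fin n → Ω => ∏ i, (f (ω i) / u (ω i)))
      (Measure.pi fun _ : Fin n => J) :=
    (Finset.measurable_prod _ fun i _ => (hm i).comp (measurable_pi_apply i)).aemeasurable
  refine (meas_ge_le_lintegral_div hmeas (ENNReal.div_pos hg ha).ne'
    (ENNReal.div_ne_top hg' ha0)).trans ?_
  refine (ENNReal.div_le_div_right hI _).trans ?_
  rw [one_div, ENNReal.inv_div (Or.inl ha) (Or.inl ha0)]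

/-- Letters of an i.i.d. sequence, mapped one by one. -/
theorem pi_map_comp {ι κ α β : Type*} [Fintype ι] [Fintype κ] [MeasurableSpace α]
    [MeasurableSpace β] (J : Measure α) [IsProbabilityMeasure J] {a : ι → κ}
    (ha : Function.Injective a) {f : α → β} (hf : Measurable f) :
    (Measure.pi fun _ : κ => J).map (fun q i => f (q (a i))) = Measure.pi fun _ : ι => J.map f := by
  have := Measure.isProbabilityMeasure_map (μ := J) hf.aemeasurable
  rw [← Measure.pi_map_pi (fun _ => hf.aemeasurable), ← pi_map_injective (fun _ : κ => J) ha,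
    Measure.map_map (by fun_prop) (by fun_prop)]
  rfl

namespace RAC

variable {X Y : Type*} [MeasurableSpace X] [MeasurableSpace Y]

section LetterLaw

variable (R : RAC X Y) (P : Measure X) [IsProbabilityMeasure P] {M : ℕ}

/-- The letters of all `M` codewords at one time, and the output of the channel when the messages
`w` are sent; the codewords have i.i.d. letters. -/
def letterLaw {k : ℕ} (w : Fin k → Fin M) : Measure ((Fin M → X) × Y) :=
  inputLaw P M ⊗ₘ (R.W k).comap (fun ξ : Fin M → X => ξ ∘ w)
    (measurable_pi_lambda _ fun _ => measurable_pi_apply _)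

instance {k : ℕ} (w : Fin k → Fin M) : IsProbabilityMeasure (R.letterLaw P w) := by
  unfold letterLaw; infer_instance

theorem measurable_comp_prod {s k : ℕ} (v : Fin s → Fin k) :
    Measurable fun p : (Fin k → X) × Y => (p.1 ∘ v, p.2) :=
  (measurable_pi_lambda _ fun i => by fun_prop : Measurable fun p : (Fin k → X) × Y => p.1 ∘ v).prodMk
    measurable_snd

theorem map_letterLaw {k : ℕ} {w : Fin k → Fin M} (hw : Function.Injective w) :
    (R.letterLaw P w).map (fun p => (p.1 ∘ w, p.2)) = inputLaw P k ⊗ₘ R.W k := by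
  have hm := measurable_comp_prod (X := X) (Y := Y) w
  ext A hA
  have e := pi_map_injective (fun _ : Fin M => P) hw
  unfold letterLaw inputLaw
  rw [Measure.map_apply hm hA, Measure.compProd_apply (hm hA), Measure.compProd_apply hA, ← e,
    lintegral_map (Kernel.measurable_kernel_prodMk_left hA) (by fun_prop)]
  rfl

/-- Joint law of the codewords of `w` and of those of `w'`, whose first `s` messages are among `w`. -/
theorem map_codewords {k s t : ℕ} {w : Fin k → Fin M} {w' : Fin t → Fin M} {v : Fin s → Fin k}
    (hw : Function.Injective w) (hw' : Function.Injective w')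
    (hs : ∀ (j : Fin t) (hj : j.1 < s), w' j = w (v ⟨j.1, hj⟩))
    (hns : ∀ j : Fin t, ¬ j.1 < s → w' j ∉ Set.range w) :
    (inputLaw P M).map (fun ξ => (ξ ∘ w, ξ ∘ w'))
      = ((inputLaw P k).prod (inputLaw P t)).map fun p => (p.1, splice (p.1 ∘ v) p.2) := by
  set a : Fin k ⊕ {j : Fin t // ¬ j.1 < s} → Fin M := Sum.elim w fun j => w' j.1
  set c : Fin k ⊕ {j : Fin t // ¬ j.1 < s} → Fin k ⊕ Fin t := Sum.map id Subtype.val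
  have ha : Function.Injective a := hw.sumElim (hw'.comp Subtype.val_injective)
    fun i j h => hns j.1 j.2 ⟨i, h⟩
  have hc : Function.Injective c := Function.injective_id.sumMap Subtype.val_injective
  set Φ : (Fin k ⊕ {j : Fin t // ¬ j.1 < s} → X) → (Fin k → X) × (Fin t → X) := fun ζ =>
    (fun i => ζ (Sum.inl i), fun j => if h : j.1 < s then ζ (Sum.inl (v ⟨j.1, h⟩))
      else ζ (Sum.inr ⟨j, h⟩)) with hΦ
  have hΦm : Measurable Φ := by
    refine (by fun_prop : Measurable fun (ζ : Fin k ⊕ {j : Fin t // ¬ j.1 < s} → X) (i : Fin k) =>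
      ζ (Sum.inl i)).prodMk (measurable_pi_lambda _ fun j => ?_)
    by_cases h : j.1 < s
    · simp only [h, dite_true]; fun_prop
    · simp only [h, dite_false]; fun_prop
  have e1 := pi_map_injective (fun _ : Fin M => P) ha
  have e2 := prod_pi_map_elim P hc
  unfold inputLaw
  have m2 : Measurable fun (p : (Fin k → X) × (Fin t → X))
      (i : Fin k ⊕ {j : Fin t // ¬ j.1 < s}) => Sum.elim p.1 p.2 (c i) := by
    refine measurable_pi_lambda _ fun i => ?_
    rcases i with i | i
    · exact (measurable_pi_apply i).comp measurable_fst
    · exact (measurable_pi_apply i.1).comp measurable_snd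
  have h := congrArg (Measure.map Φ) (e1.trans e2.symm)
  rw [Measure.map_map hΦm (by fun_prop), Measure.map_map hΦm m2] at h
  refine Eq.trans ?_ (h.trans ?_)
  · congr 1
    funext ξ
    refine Prod.ext rfl (funext fun j => ?_)
    by_cases hj : j.1 < s
    · simp [hΦ, hj, a, hs j hj]
    · simp [hΦ, hj, a]
  · congr 1

end LetterLaw

variable [StandardBorelSpace Y] {R : RAC X Y} {P : Measure X} [IsProbabilityMeasure P] {K : ℕ}
  (hmom : R.MomentConditions P K)
include hmom

/-- Any `s` inputs have the joint law of the first `s` inputs and the output. -/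
theorem map_joint_comp {k : ℕ} (h1 : 1 ≤ k) (hk : k ≤ K) (hperm : R.PermutationInvariant K) {s : ℕ}
    {v : Fin s → Fin k} (hv : Function.Injective v) :
    (inputLaw P k ⊗ₘ R.W k).map (fun p => (p.1 ∘ v, p.2)) = R.headLaw P s k := by
  have hsk : s ≤ k := by simpa using Fintype.card_le_of_injective v hv
  obtain ⟨σ, hσ⟩ := exists_perm_castLE hsk hv
  have h := map_perm_joint (R.measurable_dens P K k k) (dens_perm_out h1 hk hperm)
    (joint_eq_withDensity_pi hmom h1 hk) σ
  rw [headLaw_eq_map R P hsk]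
  nth_rewrite 2 [← h]
  rw [Measure.map_map (measurable_head hsk) (measurable_comp_prod σ)]
  congr 1
  funext p
  simp only [head, Function.comp_def, hσ]

theorem map_letterLaw_comp {k : ℕ} (h1 : 1 ≤ k) (hk : k ≤ K) (hperm : R.PermutationInvariant K)
    {M s : ℕ} {w : Fin k → Fin M} (hw : Function.Injective w) {v : Fin s → Fin k}
    (hv : Function.Injective v) :
    (R.letterLaw P w).map (fun p => (p.1 ∘ (w ∘ v), p.2)) = R.headLaw P s k := by
  rw [← map_joint_comp hmom h1 hk hperm hv, ← map_letterLaw R P hw,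
    Measure.map_map (measurable_comp_prod v) (measurable_comp_prod w)]
  rfl

/-- The messages `w'` have the density of any of their permutations. -/
theorem ae_dens_letterLaw_perm {k : ℕ} (h1 : 1 ≤ k) (hk : k ≤ K) (hperm : R.PermutationInvariant K)
    {M t : ℕ} (htK : t ≤ K) {w : Fin k → Fin M} (hw : Function.Injective w) (w' : Fin t → Fin M)
    (τ : Equiv.Perm (Fin t)) : ∀ᵐ p ∂(R.letterLaw P w),
      R.dens P K t t (p.1 ∘ (w' ∘ τ)) p.2 = R.dens P K t t (p.1 ∘ w') p.2 := by
  have hD := R.measurable_dens P K t t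
  have hset : MeasurableSet {p : (Fin M → X) × Y |
      R.dens P K t t (p.1 ∘ (w' ∘ τ)) p.2 = R.dens P K t t (p.1 ∘ w') p.2} :=
    measurableSet_eq_fun (hD.comp (measurable_comp_prod (w' ∘ τ)))
      (hD.comp (measurable_comp_prod w'))
  rw [letterLaw, Measure.ae_compProd_iff hset]
  have hac := ae_W_ref hmom.abs_cont h1 hk
  have e := pi_map_injective (fun _ : Fin M => P) hw
  unfold inputLaw at *
  rw [← e] at hac
  filter_upwards [ae_of_ae_map
    (measurable_pi_lambda _ fun i => measurable_pi_apply _ : Measurable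
      fun (x : Fin M → X) i => x (w i)).aemeasurable hac] with ξ hξ
  rw [Kernel.comap_apply]
  exact hξ.ae_le (R.dens_comp_perm P K hperm htK τ (ξ ∘ w'))

/-- Messages `w'` of which exactly `s` are among the transmitted messages `w` pass the test against
the threshold `g` with probability at most `a / g`, if the shared messages alone stay below `a`.
Given the shared codewords and the output, the other codewords of `w'` are independent of both, so that
the density of `w'` divided by that of the shared messages has mean at most one. -/
theorem exists_shared_bound {k : ℕ} (h1 : 1 ≤ k) (hk : k ≤ K) (hperm : R.PermutationInvariant K)
    {M t s : ℕ} (ht : 1 ≤ t) (htK : t ≤ K) {w : Fin k → Fin M} (hw : Function.Injective w)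
    {w' : Fin t → Fin M} (hw' : Function.Injective w')
    (hs : (Finset.univ.filter fun j => w' j ∈ Set.range w).card = s) :
    ∃ v : Fin s → Fin k, Function.Injective v ∧ (∀ i, w (v i) ∈ Set.range w') ∧
      ∀ (n : ℕ) {a g : ℝ≥0∞}, g ≠ 0 → g ≠ ∞ → a ≠ ∞ →
      (Measure.pi fun _ : Fin n => R.letterLaw P w)
        {q | ∏ i, R.headDens P K s t ((q i).1 ∘ (w ∘ v)) (q i).2 ≤ a ∧
          g < ∏ i, R.dens P K t t ((q i).1 ∘ w') (q i).2} ≤ a / g := by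
  classical
  set S : Finset (Fin t) := Finset.univ.filter fun j => w' j ∈ Set.range w with hS
  have hst : s ≤ t := by rw [← hs]; simpa using S.card_le_univ
  have hc : (below t s).card = S.card := by rw [card_below hst, hs]
  obtain ⟨τ, hτ⟩ : ∃ τ : Equiv.Perm (Fin t), ∀ j, τ j ∈ S ↔ j.1 < s := by
    refine ⟨(Finset.equivOfCardEq hc).extendSubtype, fun j => ⟨fun h => ?_, fun h => ?_⟩⟩
    · by_contra hj
      exact (Finset.equivOfCardEq hc).extendSubtype_not_mem j (by simpa [below] using hj) h
    · exact (Finset.equivOfCardEq hc).extendSubtype_mem j (by simpa [below] using h)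
  have hex : ∀ i : Fin s, ∃ l, w l = w' (τ (Fin.castLE hst i)) := fun i => by
    have := (hτ (Fin.castLE hst i)).2 i.2
    rw [hS, Finset.mem_filter] at this
    exact this.2
  choose v hv using hex
  have hvi : Function.Injective v := fun i j h => by
    have : w' (τ (Fin.castLE hst i)) = w' (τ (Fin.castLE hst j)) := by rw [← hv, ← hv, h]
    exact Fin.castLE_injective hst (τ.injective (hw' this))
  have hsk : s ≤ k := by simpa using Fintype.card_le_of_injective v hvi
  refine ⟨v, hvi, fun i => ⟨_, (hv i).symm⟩, fun n a g hg hg' ha => ?_⟩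
  have hD := R.measurable_dens P K t t
  have hU := R.measurable_headDens P K s t
  have hu : Measurable fun p : (Fin M → X) × Y => R.headDens P K s t (p.1 ∘ (w ∘ v)) p.2 :=
    hU.comp (measurable_comp_prod (w ∘ v))
  have hf : Measurable fun p : (Fin M → X) × Y => R.dens P K t t (p.1 ∘ w') p.2 :=
    hD.comp (measurable_comp_prod w')
  have hperm' := ae_dens_letterLaw_perm hmom h1 hk hperm htK hw w' τ
  have hcw := map_codewords P (w' := w' ∘ τ) (v := v) hw (hw'.comp τ.injective)
    (fun j hj => (hv ⟨j.1, hj⟩).symm) (fun j hj h => hj ((hτ j).1 (by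
      rw [hS, Finset.mem_filter]; exact ⟨Finset.mem_univ _, h⟩)))
  -- expectation of a function of the codewords of `w`, of those of `w'`, and of the output
  have key : ∀ F : (Fin s → X) → (Fin t → X) → Y → ℝ≥0∞,
      Measurable (fun q : (Fin s → X) × (Fin t → X) × Y => F q.1 q.2.1 q.2.2) →
      ∫⁻ p, F (p.1 ∘ (w ∘ v)) (p.1 ∘ (w' ∘ τ)) p.2 ∂(R.letterLaw P w)
        = ∫⁻ p, ∫⁻ z, F (p.1 ∘ v) (splice (p.1 ∘ v) z) p.2 ∂(inputLaw P t)
          ∂(inputLaw P k ⊗ₘ R.W k) := by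
    intro F hF
    have hF1 : Measurable fun p : ((Fin k → X) × (Fin t → X)) × Y => F (p.1.1 ∘ v) p.1.2 p.2 :=
      hF.comp (f := fun p : ((Fin k → X) × (Fin t → X)) × Y => (p.1.1 ∘ v, p.1.2, p.2))
        ((measurable_pi_lambda _ fun i => by fun_prop : Measurable
          fun p : ((Fin k → X) × (Fin t → X)) × Y => p.1.1 ∘ v).prodMk (by fun_prop))
    set H : (Fin k → X) × (Fin t → X) → ℝ≥0∞ := fun p => ∫⁻ y, F (p.1 ∘ v) p.2 y ∂(R.W k p.1) with hH
    have hHm : Measurable H := by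
      have := Measurable.lintegral_kernel_prod_right'
        (κ := (R.W k).comap (fun p : (Fin k → X) × (Fin t → X) => p.1) measurable_fst) hF1
      exact this
    have hmw : Measurable fun ξ : Fin M → X => (ξ ∘ w, ξ ∘ (w' ∘ τ)) :=
      (measurable_pi_lambda _ fun i => measurable_pi_apply _).prodMk
        (measurable_pi_lambda _ fun i => measurable_pi_apply _)
    have hms : Measurable fun p : (Fin k → X) × (Fin t → X) => (splice (p.1 ∘ v) p.2 : Fin t → X) :=
      measurable_splice.comp ((measurable_pi_lambda _ fun i => by fun_prop : Measurable
        fun p : (Fin k → X) × (Fin t → X) => p.1 ∘ v).prodMk measurable_snd)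
    have hF2 : Measurable fun p : ((Fin k → X) × Y) × (Fin t → X) =>
        F (p.1.1 ∘ v) (splice (p.1.1 ∘ v) p.2) p.1.2 :=
      hF1.comp (f := fun p : ((Fin k → X) × Y) × (Fin t → X) =>
        ((p.1.1, (splice (p.1.1 ∘ v) p.2 : Fin t → X)), p.1.2))
        (((by fun_prop : Measurable fun p : ((Fin k → X) × Y) × (Fin t → X) => p.1.1).prodMk
          (hms.comp (by fun_prop : Measurable
            fun p : ((Fin k → X) × Y) × (Fin t → X) => (p.1.1, p.2)))).prodMk (by fun_prop))
    have e1 : ∫⁻ p, F (p.1 ∘ (w ∘ v)) (p.1 ∘ (w' ∘ τ)) p.2 ∂(R.letterLaw P w)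
        = ∫⁻ ξ, H (ξ ∘ w, ξ ∘ (w' ∘ τ)) ∂(inputLaw P M) := by
      rw [letterLaw, Measure.lintegral_compProd
        (f := fun p : (Fin M → X) × Y => F (p.1 ∘ (w ∘ v)) (p.1 ∘ (w' ∘ τ)) p.2)
        (hF1.comp (f := fun p : (Fin M → X) × Y => ((p.1 ∘ w, p.1 ∘ (w' ∘ τ)), p.2))
          ((hmw.comp measurable_fst).prodMk measurable_snd))]
      rfl
    rw [e1, ← lintegral_map hHm hmw, hcw, lintegral_map hHm (measurable_fst.prodMk hms),
      lintegral_prod (fun p : (Fin k → X) × (Fin t → X) => H (p.1, splice (p.1 ∘ v) p.2))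
        (hHm.comp (measurable_fst.prodMk hms)).aemeasurable,
      Measure.lintegral_compProd (f := fun p : (Fin k → X) × Y =>
        ∫⁻ z, F (p.1 ∘ v) (splice (p.1 ∘ v) z) p.2 ∂(inputLaw P t)) hF2.lintegral_prod_right']
    refine lintegral_congr fun x => ?_
    simp only [hH]
    exact lintegral_lintegral_swap (hF2.comp (f := fun q : (Fin t → X) × Y => ((x, q.2), q.1))
      (by fun_prop)).aemeasurable
  have hDs : ∀ (x : Fin s → X) y, Measurable fun z : Fin t → X => R.dens P K t t (splice x z) y :=
    fun x y => hD.comp ((measurable_splice_right x).prodMk measurable_const)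
  refine pi_prod_ratio_le (R.letterLaw P w) hu hf ?_ ?_ ?_ n hg hg' ha
  · calc ∫⁻ p, R.dens P K t t (p.1 ∘ w') p.2 / R.headDens P K s t (p.1 ∘ (w ∘ v)) p.2
          ∂(R.letterLaw P w)
        = ∫⁻ p, R.dens P K t t (p.1 ∘ (w' ∘ τ)) p.2 / R.headDens P K s t (p.1 ∘ (w ∘ v)) p.2
          ∂(R.letterLaw P w) := by
          refine lintegral_congr_ae ?_
          filter_upwards [hperm'] with p hp
          rw [hp]
      _ = ∫⁻ p, ∫⁻ z, R.dens P K t t (splice (p.1 ∘ v) z) p.2 / R.headDens P K s t (p.1 ∘ v) p.2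
          ∂(inputLaw P t) ∂(inputLaw P k ⊗ₘ R.W k) :=
          key (fun x x' y => R.dens P K t t x' y / R.headDens P K s t x y)
            (Measurable.div (hD.comp measurable_snd) (hU.comp (by fun_prop : Measurable
              fun q : (Fin s → X) × (Fin t → X) × Y => (q.1, q.2.2))))
      _ ≤ ∫⁻ p, 1 ∂(inputLaw P k ⊗ₘ R.W k) := by
          refine lintegral_mono fun p => ?_
          simp only [div_eq_mul_inv]
          rw [lintegral_mul_const (f := fun z => R.dens P K t t (splice (p.1 ∘ v) z) p.2) _
            (hDs _ _), ← div_eq_mul_inv]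
          exact ENNReal.div_self_le_one
      _ = 1 := by simp
  · have hind : Measurable fun q : (Fin s → X) × (Fin t → X) × Y =>
        {a : (Fin s → X) × Y | R.headDens P K s t a.1 a.2 = 0}.indicator 1 (q.1, q.2.2)
          * R.dens P K t t q.2.1 q.2.2 :=
      ((measurable_one.indicator (hU (measurableSet_singleton 0))).comp (by fun_prop : Measurable
        fun q : (Fin s → X) × (Fin t → X) × Y => (q.1, q.2.2))).mul (hD.comp measurable_snd)
    have h := key (fun x x' y => {a : (Fin s → X) × Y | R.headDens P K s t a.1 a.2 = 0}.indicator 1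
      (x, y) * R.dens P K t t x' y) hind
    have hz : ∀ p : (Fin k → X) × Y, ∫⁻ z, {a : (Fin s → X) × Y | R.headDens P K s t a.1 a.2 = 0}.indicator 1
      (p.1 ∘ v, p.2) * R.dens P K t t (splice (p.1 ∘ v) z) p.2 ∂(inputLaw P t) = 0 := fun p => by
      rw [lintegral_const_mul (f := fun z => R.dens P K t t (splice (p.1 ∘ v) z) p.2) _ (hDs _ _)]
      by_cases h0 : R.headDens P K s t (p.1 ∘ v) p.2 = 0
      · have h0' : ∫⁻ z, R.dens P K t t (splice (p.1 ∘ v) z) p.2 ∂(inputLaw P t) = 0 := h0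
        rw [h0', mul_zero]
      · rw [Set.indicator_of_notMem (by exact h0), zero_mul]
    simp_rw [hz, lintegral_zero] at h
    have hmp : Measurable fun p : (Fin M → X) × Y => (p.1 ∘ (w ∘ v), p.1 ∘ (w' ∘ τ), p.2) :=
      (measurable_pi_lambda _ fun i => by fun_prop : Measurable
        fun p : (Fin M → X) × Y => p.1 ∘ (w ∘ v)).prodMk
        ((measurable_pi_lambda _ fun i => by fun_prop : Measurable
          fun p : (Fin M → X) × Y => p.1 ∘ (w' ∘ τ)).prodMk measurable_snd)
    have h' := (lintegral_eq_zero_iff (f := fun p : (Fin M → X) × Y =>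
      {a : (Fin s → X) × Y | R.headDens P K s t a.1 a.2 = 0}.indicator 1 (p.1 ∘ (w ∘ v), p.2)
        * R.dens P K t t (p.1 ∘ (w' ∘ τ)) p.2) (hind.comp hmp)).1 h
    filter_upwards [h', hperm'] with p hp hp' h0
    rw [Set.indicator_of_mem (by exact h0)] at hp
    rw [← hp']
    simpa using hp
  · have := ae_headDens_ne_top hmom ht htK h1 hk hsk
    rw [← map_letterLaw_comp hmom h1 hk hperm hw hvi] at this
    exact ae_of_ae_map (measurable_comp_prod (w ∘ v)).aemeasurable this

end RAC

end

/-! ### The decoder and the union bound -/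

noncomputable section

/-- The number of message vectors with `s` entries among the `k` messages `w` is
`O(M ^ (t - s))`: a generating function with the weight `M` for each entry among `w`. -/
theorem card_shared_mul_pow_le {k t M : ℕ} (w : Fin k → Fin M) (s : ℕ) :
    (Finset.univ.filter fun w' : Fin t → Fin M =>
      (Finset.univ.filter fun j => w' j ∈ Set.range w).card = s).card * M ^ s
      ≤ ((k + 1) * M) ^ t := by
  classical
  set f : Fin M → ℕ := fun m => if m ∈ Set.range w then M else 1 with hf
  have e : ∀ w' : Fin t → Fin M,
      ∏ j, f (w' j) = M ^ (Finset.univ.filter fun j => w' j ∈ Set.range w).card := fun w' => by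
    simp only [hf]
    rw [Finset.prod_ite, Finset.prod_const, Finset.prod_const_one, mul_one]
  have hsum : ∑ m, f m ≤ (k + 1) * M := by
    have h1 : (Finset.univ.filter fun m => m ∈ Set.range w).card ≤ k := by
      have : (Finset.univ.filter fun m => m ∈ Set.range w) = Finset.univ.image w := by
        ext m; simp
      rw [this]
      exact Finset.card_image_le.trans (by simp)
    simp only [hf]
    rw [Finset.sum_ite, Finset.sum_const, Finset.sum_const, smul_eq_mul, smul_eq_mul, mul_one,
      add_mul, one_mul]
    refine add_le_add (Nat.mul_le_mul_right M h1) ?_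
    exact (Finset.card_le_univ _).trans (by simp)
  calc _ = ∑ w' ∈ Finset.univ.filter fun w' : Fin t → Fin M =>
        (Finset.univ.filter fun j => w' j ∈ Set.range w).card = s, ∏ j, f (w' j) := by
        rw [Finset.sum_congr rfl fun w' h => (e w').trans (by rw [(Finset.mem_filter.1 h).2]),
          Finset.sum_const, smul_eq_mul]
    _ ≤ ∑ w' : Fin t → Fin M, ∏ j, f (w' j) :=
        Finset.sum_le_sum_of_subset (Finset.filter_subset _ _)
    _ = (∑ m, f m) ^ t := (Fintype.sum_pow f t).symm
    _ ≤ _ := Nat.pow_le_pow_left hsum t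

theorem pi_map_apply {ι α β : Type*} [Fintype ι] [MeasurableSpace α] [MeasurableSpace β]
    (J : Measure α) [IsProbabilityMeasure J] {f : α → β} (hf : Measurable f) {s : Set (ι → β)}
    (hs : MeasurableSet s) :
    (Measure.pi fun _ : ι => J.map f) s
      = (Measure.pi fun _ : ι => J) ((fun q i => f (q i)) ⁻¹' s) := by
  rw [← pi_map_comp J (a := (id : ι → ι)) Function.injective_id hf, Measure.map_apply ?_ hs]
  · rfl
  · exact measurable_pi_lambda _ fun i => hf.comp (measurable_pi_apply i)

theorem exists_perm_of_range_eq {k M : ℕ} {w w' : Fin k → Fin M} (hw : Function.Injective w)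
    (hw' : Function.Injective w') (h : Set.range w' = Set.range w) :
    ∃ σ : Equiv.Perm (Fin k), w' = w ∘ σ := by
  refine ⟨(Equiv.ofInjective w' hw').trans ((Equiv.setCongr h).trans (Equiv.ofInjective w hw).symm),
    ?_⟩
  funext i
  simp only [Function.comp_apply, Equiv.trans_apply]
  rw [Equiv.apply_ofInjective_symm hw]
  rfl

namespace RAC

variable {X Y : Type*} [MeasurableSpace X] [MeasurableSpace Y]
variable [StandardBorelSpace Y] {R : RAC X Y} {P : Measure X} [IsProbabilityMeasure P] {K : ℕ}
  (hmom : R.MomentConditions P K)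

include hmom in
/-- Union bound for the event that some message vector other than the transmitted one passes the
test; `a s` separates the contribution of `s` shared messages. -/
theorem confusion_le {k : ℕ} (h1 : 1 ≤ k) (hk : k ≤ K) (hperm : R.PermutationInvariant K)
    {M t : ℕ} (ht : 1 ≤ t) (htk : t ≤ k) {w : Fin k → Fin M} (hw : Function.Injective w) (n : ℕ)
    {a : ℕ → ℝ≥0∞} (ha : ∀ s, a s ≠ ∞) {g : ℝ≥0∞} (hg : g ≠ 0) (hg' : g ≠ ∞) :
    (Measure.pi fun _ : Fin n => R.letterLaw P w) {q | ∃ w' : Fin t → Fin M, Function.Injective w' ∧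
        (t = k → Set.range w' ≠ Set.range w) ∧ g < ∏ i, R.dens P K t t ((q i).1 ∘ w') (q i).2}
      ≤ ∑ s ∈ (Finset.range (t + 1)).filter (· < k),
        (k ^ s * (Measure.pi fun _ : Fin n => R.headLaw P s k)
            {ω | a s < ∏ i, R.headDens P K s t (ω i).1 (ω i).2}
          + (Finset.univ.filter fun w' : Fin t → Fin M =>
            (Finset.univ.filter fun j => w' j ∈ Set.range w).card = s).card * (a s / g)) := by
  classical
  have htK : t ≤ K := htk.trans hk
  have hex := fun (s : ℕ) (w' : {w' : Fin t → Fin M // Function.Injective w' ∧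
      (Finset.univ.filter fun j => w' j ∈ Set.range w).card = s}) =>
    exists_shared_bound hmom h1 hk hperm ht htK hw w'.2.1 w'.2.2
  choose V hV1 hV2 hV3 using hex
  have hsub : {q : Fin n → (Fin M → X) × Y | ∃ w' : Fin t → Fin M, Function.Injective w' ∧
      (t = k → Set.range w' ≠ Set.range w) ∧ g < ∏ i, R.dens P K t t ((q i).1 ∘ w') (q i).2}
      ⊆ ⋃ s ∈ (Finset.range (t + 1)).filter (· < k),
        ((⋃ v ∈ Finset.univ.filter fun v : Fin s → Fin k => Function.Injective v,
          {q | a s < ∏ i, R.headDens P K s t ((q i).1 ∘ (w ∘ v)) (q i).2}) ∪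
        ⋃ w' ∈ (Finset.univ : Finset {w' : Fin t → Fin M // Function.Injective w' ∧
            (Finset.univ.filter fun j => w' j ∈ Set.range w).card = s}),
          {q | ∏ i, R.headDens P K s t ((q i).1 ∘ (w ∘ V s w')) (q i).2 ≤ a s ∧
            g < ∏ i, R.dens P K t t ((q i).1 ∘ w'.1) (q i).2}) := by
    rintro q ⟨w', hw', hne, hq⟩
    set s := (Finset.univ.filter fun j => w' j ∈ Set.range w).card with hs
    have hst : s ≤ t := by
      rw [hs]; exact (Finset.card_le_univ _).trans (by simp)
    have hsk : s < k := by
      refine lt_of_le_of_ne (hst.trans htk) fun hsk => ?_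
      have htk' : t = k := le_antisymm htk (hsk ▸ hst)
      refine hne htk' (Set.Subset.antisymm ?_ ?_)
      · rintro _ ⟨j, rfl⟩
        have : (Finset.univ.filter fun j => w' j ∈ Set.range w) = Finset.univ := by
          rw [← Finset.card_eq_iff_eq_univ, ← hs, hsk, htk', Fintype.card_fin]
        have hj : j ∈ Finset.univ.filter fun j => w' j ∈ Set.range w := by
          rw [this]; exact Finset.mem_univ j
        exact (Finset.mem_filter.1 hj).2
      · rintro _ ⟨i, rfl⟩
        have hsurj := ((Fintype.bijective_iff_injective_and_card (V s ⟨w', hw', hs.symm⟩)).2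
          ⟨hV1 s _, by simp [hsk]⟩).2
        obtain ⟨j, rfl⟩ := hsurj i
        exact hV2 s ⟨w', hw', hs.symm⟩ j
    simp only [Set.mem_iUnion]
    refine ⟨s, Finset.mem_filter.2 ⟨Finset.mem_range.2 (by omega), hsk⟩, ?_⟩
    by_cases hle : ∏ i, R.headDens P K s t ((q i).1 ∘ (w ∘ V s ⟨w', hw', hs.symm⟩)) (q i).2 ≤ a s
    · right
      simp only [Set.mem_iUnion]
      exact ⟨⟨w', hw', hs.symm⟩, Finset.mem_univ _, hle, hq⟩
    · left
      simp only [Set.mem_iUnion]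
      exact ⟨V s ⟨w', hw', hs.symm⟩, Finset.mem_filter.2 ⟨Finset.mem_univ _, hV1 s _⟩,
        not_le.1 hle⟩
  refine (measure_mono hsub).trans ((measure_biUnion_finset_le _ _).trans
    (Finset.sum_le_sum fun s _ => (measure_union_le _ _).trans (add_le_add ?_ ?_)))
  · refine (measure_biUnion_finset_le _ _).trans ?_
    have hm : MeasurableSet {ω : Fin n → (Fin s → X) × Y |
        a s < ∏ i, R.headDens P K s t (ω i).1 (ω i).2} :=
      measurableSet_lt measurable_const (Finset.measurable_prod _ fun i _ =>
        (R.measurable_headDens P K s t).comp (measurable_pi_apply i))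
    have e : ∀ v ∈ Finset.univ.filter fun v : Fin s → Fin k => Function.Injective v,
        (Measure.pi fun _ : Fin n => R.letterLaw P w)
          {q | a s < ∏ i, R.headDens P K s t ((q i).1 ∘ (w ∘ v)) (q i).2}
        = (Measure.pi fun _ : Fin n => R.headLaw P s k)
            {ω | a s < ∏ i, R.headDens P K s t (ω i).1 (ω i).2} := by
      intro v hv
      have hmc := measurable_comp_prod (X := X) (Y := Y) (w ∘ v)
      rw [← map_letterLaw_comp hmom h1 hk hperm hw (Finset.mem_filter.1 hv).2,
        pi_map_apply (R.letterLaw P w) hmc hm]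
      rfl
    rw [Finset.sum_congr rfl e, Finset.sum_const, nsmul_eq_mul]
    gcongr
    have : (Finset.univ.filter fun v : Fin s → Fin k => Function.Injective v).card ≤ k ^ s :=
      (Finset.card_le_univ _).trans (by simp)
    exact_mod_cast this
  · refine (measure_biUnion_finset_le _ _).trans ((Finset.sum_le_sum fun w' _ =>
      hV3 s w' n hg hg' (ha s)).trans ?_)
    rw [Finset.sum_const, nsmul_eq_mul]
    gcongr
    rw [Finset.card_univ, Fintype.card_subtype]
    exact Finset.card_le_card fun w' h => Finset.mem_filter.2
      ⟨Finset.mem_univ _, (Finset.mem_filter.1 h).2.2⟩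

end RAC

section Select

open Classical in
/-- An element with the property `p`, if there is one. -/
def selectWord {W : Type*} (p : W → Prop) : Option W :=
  if h : ∃ w, p w then some h.choose else none

theorem selectWord_some {W : Type*} {p : W → Prop} {w : W} (h : selectWord p = some w) : p w := by
  unfold selectWord at h
  split_ifs at h with h'
  rw [← Option.some.inj h]
  exact h'.choose_spec

theorem selectWord_none {W : Type*} {p : W → Prop} (h : selectWord p = none) (w : W) : ¬ p w := by
  unfold selectWord at h
  split_ifs at h with h'
  exact fun hw => h' ⟨w, hw⟩

theorem measurableSet_selectWord {Ω W : Type*} [MeasurableSpace Ω] [Finite W] {p : Ω → W → Prop}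
    (hp : ∀ w, MeasurableSet {ω | p ω w}) (v : Set (Option W)) :
    MeasurableSet {ω | selectWord (p ω) ∈ v} := by
  have e : {ω | selectWord (p ω) ∈ v}
      = ⋃ s ∈ {s : W → Prop | selectWord s ∈ v}, ⋂ w, {ω | p ω w ↔ s w} := by
    ext ω
    simp only [Set.mem_ofPred_eq, Set.mem_iUnion, Set.mem_iInter, exists_prop]
    constructor
    · intro h
      exact ⟨p ω, h, fun w => Iff.rfl⟩
    · rintro ⟨s, hs, h⟩
      rwa [funext fun w => propext (h w)]
  rw [e]
  refine MeasurableSet.biUnion (Set.to_countable _) fun s _ => MeasurableSet.iInter fun w => ?_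
  by_cases h : s w
  · simpa [h] using hp w
  · have e : {ω | p ω w ↔ s w} = {ω | p ω w}ᶜ := by
      ext ω; simp [h]
    rw [e]
    exact (hp w).compl

end Select

namespace RAC

variable {X Y : Type*} [MeasurableSpace X] [MeasurableSpace Y] [StandardBorelSpace Y]
variable (R : RAC X Y) (P : Measure X) [IsProbabilityMeasure P] (K : ℕ)
  (n : ℕ → ℕ) (γ : ℕ → ℝ) (A : (m : ℕ) → Set (Fin m → Y)) {M : ℕ}

/-- The test of the message vector `w` at time `n k`, given the letters of all codewords and the
outputs up to that time.  For `k = 0` it is the test `A` of the output alone. -/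
def GoodWord (k : ℕ) (q : Fin (n k) → (Fin M → X) × Y) (w : Fin k → Fin M) : Prop :=
  if k = 0 then (fun i => (q i).2) ∈ A (n k)
  else StrictMono w ∧ ENNReal.ofReal (γ k) < ∏ i, R.dens P K k k ((q i).1 ∘ w) (q i).2

/-- The decoder at time `n k`. -/
def decodeLetters (k : ℕ) (q : Fin (n k) → (Fin M → X) × Y) : Option (Fin k → Fin M) :=
  selectWord (R.GoodWord P K n γ A k q)

/-- The error event when the messages `w` are sent. -/
def errorSet (k : ℕ) (hn : ∀ t < k, n t ≤ n k) (w : Fin k → Fin M) :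
    Set (Fin (n k) → (Fin M → X) × Y) :=
  {q | (¬ ∃ σ : Equiv.Perm (Fin k), R.decodeLetters P K n γ A k q = some (w ∘ σ)) ∨
    ∃ (t : ℕ) (ht : t < k),
      R.decodeLetters P K n γ A t (fun i => q (Fin.castLE (hn t ht) i)) ≠ none}

theorem goodWord_zero (q : Fin (n 0) → (Fin M → X) × Y) (w : Fin 0 → Fin M) :
    R.GoodWord P K n γ A 0 q w ↔ (fun i => (q i).2) ∈ A (n 0) := by
  unfold GoodWord
  rw [if_pos rfl]

theorem goodWord_iff {k : ℕ} (hk : k ≠ 0) (q : Fin (n k) → (Fin M → X) × Y) (w : Fin k → Fin M) :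
    R.GoodWord P K n γ A k q w ↔ StrictMono w ∧
      ENNReal.ofReal (γ k) < ∏ i, R.dens P K k k ((q i).1 ∘ w) (q i).2 := by
  unfold GoodWord
  rw [if_neg hk]

theorem measurableSet_threshold {k : ℕ} (w : Fin k → Fin M) (m : ℕ)
    (g : ℝ) : MeasurableSet {q : Fin m → (Fin M → X) × Y |
      ENNReal.ofReal g < ∏ i, R.dens P K k k ((q i).1 ∘ w) (q i).2} :=
  measurableSet_lt measurable_const (Finset.measurable_prod _ fun i _ =>
    ((R.measurable_dens P K k k).comp (measurable_comp_prod w)).comp (measurable_pi_apply i))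

variable {A} (hA : ∀ m, MeasurableSet (A m))
include hA

theorem measurableSet_goodWord (k : ℕ) (w : Fin k → Fin M) :
    MeasurableSet {q : Fin (n k) → (Fin M → X) × Y | R.GoodWord P K n γ A k q w} := by
  unfold GoodWord
  by_cases h : k = 0
  · simp only [h, if_true]
    have : Measurable fun (q : Fin (n 0) → (Fin M → X) × Y) (i : Fin (n 0)) => (q i).2 := by fun_prop
    subst h
    exact this (hA _)
  · simp only [h, if_false]
    refine (MeasurableSet.const _).inter (R.measurableSet_threshold P K w (n k) (γ k))

theorem measurableSet_decodeLetters (k : ℕ) (v : Set (Option (Fin k → Fin M))) :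
    MeasurableSet {q : Fin (n k) → (Fin M → X) × Y | R.decodeLetters P K n γ A k q ∈ v} :=
  measurableSet_selectWord (R.measurableSet_goodWord P K n γ hA k) v

theorem measurableSet_errorSet (k : ℕ) (hn : ∀ t < k, n t ≤ n k) (w : Fin k → Fin M) :
    MeasurableSet (R.errorSet P K n γ A k hn w) := by
  refine MeasurableSet.union ?_ ?_
  · exact R.measurableSet_decodeLetters P K n γ hA k {o | ¬ ∃ σ : Equiv.Perm (Fin k), o = some (w ∘ σ)}
  · have e : {q : Fin (n k) → (Fin M → X) × Y | ∃ (t : ℕ) (ht : t < k),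
        R.decodeLetters P K n γ A t (fun i => q (Fin.castLE (hn t ht) i)) ≠ none}
        = ⋃ (t : ℕ), ⋃ (ht : t < k), (fun q i => q (Fin.castLE (hn t ht) i)) ⁻¹'
          {q | R.decodeLetters P K n γ A t q ∈ ({none}ᶜ : Set (Option (Fin t → Fin M)))} := by
      ext q; simp
    change MeasurableSet {q : Fin (n k) → (Fin M → X) × Y | ∃ (t : ℕ) (ht : t < k),
        R.decodeLetters P K n γ A t (fun i => q (Fin.castLE (hn t ht) i)) ≠ none}
    rw [e]
    refine MeasurableSet.iUnion fun t => MeasurableSet.iUnion fun ht => ?_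
    exact (by fun_prop : Measurable fun (q : Fin (n k) → (Fin M → X) × Y) (i : Fin (n t)) =>
      q (Fin.castLE (hn t ht) i)) (R.measurableSet_decodeLetters P K n γ hA t _)

variable {R P K n γ} (hmom : R.MomentConditions P K)
include hmom

/-- Bound for the error probability, averaged over random codebooks, if the messages `w` are
distinct: silence is detected, the transmitted messages fail the test, or other ones pass it. -/
theorem measure_errorSet_le {k : ℕ} (h1 : 1 ≤ k) (hk : k ≤ K) (hperm : R.PermutationInvariant K)
    (hn : ∀ t < k, n t ≤ n k) (hγ : ∀ t, 1 ≤ t → t ≤ k → 0 < γ t) {w : Fin k → Fin M}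
    (hw : Function.Injective w) {a : ℕ → ℕ → ℝ≥0∞} (ha : ∀ t s, a t s ≠ ∞) :
    (Measure.pi fun _ : Fin (n k) => R.letterLaw P w) (R.errorSet P K n γ A k hn w)
      ≤ (Measure.pi fun _ : Fin (n 0) => R.outLaw P k) (A (n 0))
      + (Measure.pi fun _ : Fin (n k) => inputLaw P k ⊗ₘ R.W k)
          {ω | ∏ i, R.dens P K k k (ω i).1 (ω i).2 ≤ ENNReal.ofReal (γ k)}
      + ∑ t ∈ Finset.Icc 1 k, ∑ s ∈ (Finset.range (t + 1)).filter (· < k),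
        (k ^ s * (Measure.pi fun _ : Fin (n t) => R.headLaw P s k)
            {ω | a t s < ∏ i, R.headDens P K s t (ω i).1 (ω i).2}
          + (Finset.univ.filter fun w' : Fin t → Fin M =>
            (Finset.univ.filter fun j => w' j ∈ Set.range w).card = s).card
              * (a t s / ENNReal.ofReal (γ t))) := by
  have hn' : ∀ t ≤ k, n t ≤ n k := fun t ht => by
    rcases ht.lt_or_eq with h | rfl
    · exact hn t h
    · exact le_rfl
  set σ := Tuple.sort w
  have hσ : StrictMono (w ∘ σ) :=
    (Tuple.monotone_sort w).strictMono_of_injective (hw.comp σ.injective)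
  set Miss : Set (Fin (n k) → (Fin M → X) × Y) :=
    {q | (fun i => (q (Fin.castLE (hn' 0 (Nat.zero_le k)) i)).2) ∈ A (n 0)}
  set Fail : Set (Fin (n k) → (Fin M → X) × Y) :=
    {q | ∏ i, R.dens P K k k ((q i).1 ∘ (w ∘ σ)) (q i).2 ≤ ENNReal.ofReal (γ k)}
  set Conf : (t : ℕ) → Set (Fin (n t) → (Fin M → X) × Y) := fun t =>
    {q | ∃ w' : Fin t → Fin M, Function.Injective w' ∧ (t = k → Set.range w' ≠ Set.range w) ∧
      ENNReal.ofReal (γ t) < ∏ i, R.dens P K t t ((q i).1 ∘ w') (q i).2} with hConf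
  have hsub : R.errorSet P K n γ A k hn w ⊆ (Miss ∪ Fail) ∪
      ⋃ t ∈ Finset.Icc 1 k, {q | ∃ h : n t ≤ n k, (fun i => q (Fin.castLE h i)) ∈ Conf t} := by
    rintro q (hq | ⟨t, ht, hq⟩)
    · rcases hd : R.decodeLetters P K n γ A k q with _ | w'
      · left; right
        have h := selectWord_none hd (w ∘ σ)
        rw [goodWord_iff R P K n γ A (by omega)] at h
        exact not_lt.1 fun h' => h ⟨hσ, h'⟩
      · right
        have h := selectWord_some hd
        rw [goodWord_iff R P K n γ A (by omega)] at h
        simp only [Set.mem_iUnion]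
        refine ⟨k, Finset.mem_Icc.2 ⟨h1, le_rfl⟩, le_rfl, w', h.1.injective, fun _ hr => ?_, h.2⟩
        obtain ⟨τ, hτ⟩ := exists_perm_of_range_eq hw h.1.injective hr
        exact hq ⟨τ, by rw [hd, hτ]⟩
    · obtain ⟨w', hd⟩ := Option.ne_none_iff_exists'.1 hq
      have h := selectWord_some hd
      rcases Nat.eq_zero_or_pos t with rfl | ht0
      · left; left
        exact (goodWord_zero R P K n γ A _ _).1 h
      · right
        rw [goodWord_iff R P K n γ A (by omega)] at h
        simp only [Set.mem_iUnion]
        exact ⟨t, Finset.mem_Icc.2 ⟨ht0, ht.le⟩, hn t ht, w', h.1.injective,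
          fun h' => absurd h' ht.ne, h.2⟩
  refine (measure_mono hsub).trans ((measure_union_le _ _).trans (add_le_add
    ((measure_union_le _ _).trans (add_le_add ?_ ?_)) ((measure_biUnion_finset_le _ _).trans
      (Finset.sum_le_sum fun t ht => ?_))))
  · have hlaw : (R.letterLaw P w).map Prod.snd = R.outLaw P k := by
      have h := congrArg (Measure.map Prod.snd) (map_letterLaw R P hw)
      rw [Measure.map_map measurable_snd (measurable_comp_prod w)] at h
      refine Eq.trans ?_ (h.trans ?_)
      · rfl
      · exact Measure.snd_compProd _ _
    rw [← hlaw, ← pi_map_comp (R.letterLaw P w)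
      (Fin.castLE_injective (hn' 0 (Nat.zero_le k))) measurable_snd,
      Measure.map_apply (by fun_prop) (hA _)]
    rfl
  · have hmc := measurable_comp_prod (X := X) (Y := Y) (w ∘ σ)
    have hlaw := map_letterLaw_comp hmom h1 hk hperm hw σ.injective
    rw [headLaw, outGivenHead_self] at hlaw
    have hm : MeasurableSet {ω : Fin (n k) → (Fin k → X) × Y |
        ∏ i, R.dens P K k k (ω i).1 (ω i).2 ≤ ENNReal.ofReal (γ k)} :=
      measurableSet_le (Finset.measurable_prod _ fun i _ =>
        (R.measurable_dens P K k k).comp (measurable_pi_apply i)) measurable_const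
    rw [← hlaw, pi_map_apply (R.letterLaw P w) hmc hm]
    rfl
  · have ht1 := (Finset.mem_Icc.1 ht).1
    have htk := (Finset.mem_Icc.1 ht).2
    refine le_trans ?_ (confusion_le hmom h1 hk hperm ht1 htk hw (n t) (ha t)
      (g := ENNReal.ofReal (γ t)) (by simpa using hγ t ht1 htk) ENNReal.ofReal_ne_top)
    have hm : MeasurableSet (Conf t) := by
      have : Conf t = ⋃ w' : Fin t → Fin M, {q | Function.Injective w' ∧
          (t = k → Set.range w' ≠ Set.range w) ∧
          ENNReal.ofReal (γ t) < ∏ i, R.dens P K t t ((q i).1 ∘ w') (q i).2} := by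
        ext q; simp [hConf]
      rw [this]
      exact MeasurableSet.iUnion fun w' => (MeasurableSet.const _).inter
        ((MeasurableSet.const _).inter (R.measurableSet_threshold P K w' (n t) (γ t)))
    have e := pi_map_injective (fun _ : Fin (n k) => R.letterLaw P w)
      (Fin.castLE_injective (hn' t htk))
    rw [← e, Measure.map_apply (by fun_prop) hm]
    refine measure_mono ?_
    rintro q ⟨_, hq⟩
    exact hq

end RAC

end

/-! ### Random coding -/

noncomputable section

/-- Some mixture of `d + 1` values of a random vector in dimension `d` does not exceed, in any
coordinate, a strict bound on the mean. -/
theorem exists_mixture_lt {Ω : Type*} [MeasurableSpace Ω] (J : Measure Ω) [IsProbabilityMeasure J]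
    {d : ℕ} {f : Ω → Fin d → ℝ} (hf : ∀ k, Integrable (fun ω => f ω k) J) {ε : Fin d → ℝ}
    (hε : ∀ k, ∫ ω, f ω k ∂J < ε k) :
    ∃ N ≤ d + 1, ∃ (z : Fin N → Ω) (p : Fin N → ℝ), (∀ i, 0 ≤ p i) ∧ ∑ i, p i = 1 ∧
      ∀ k, ∑ i, p i * f (z i) k < ε k := by
  have hint : Integrable f J := Integrable.of_eval hf
  have hm : ∫ ω, f ω ∂J ∈ closure (convexHull ℝ (Set.range f)) :=
    (convex_convexHull ℝ _).closure.integral_mem isClosed_closure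
      (Filter.Eventually.of_forall fun ω => subset_closure (subset_convexHull ℝ _ ⟨ω, rfl⟩)) hint
  have hopen : IsOpen {v : Fin d → ℝ | ∀ k, v k < ε k} := by
    simp only [Set.ofPred_forall]
    exact isOpen_iInter_of_finite fun k => isOpen_lt (continuous_apply k) continuous_const
  obtain ⟨v, hv, hvc⟩ := mem_closure_iff.1 hm _ hopen (fun k => by
    rw [eval_integral hf]; exact hε k)
  obtain ⟨ι, _, z, p, hz, hind, hp, hp1, hsum⟩ := eq_pos_convex_span_of_mem_convexHull hvc
  have hcard : Fintype.card ι ≤ d + 1 := by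
    refine hind.card_le_finrank_succ.trans ?_
    have := Submodule.finrank_le (vectorSpan ℝ (Set.range z))
    rw [Module.finrank_fin_fun] at this
    omega
  choose ω hω using fun i => hz ⟨i, rfl⟩
  let e := Fintype.equivFin ι
  refine ⟨Fintype.card ι, hcard, fun i => ω (e.symm i), fun i => p (e.symm i), fun i => (hp _).le,
    by rw [e.symm.sum_comp]; exact hp1, fun k => ?_⟩
  have := hv k
  rw [← hsum, Finset.sum_apply] at this
  rw [e.symm.sum_comp fun i => p i * f (ω i) k]
  simpa [hω] using this

/-- Random message vectors have a repetition with probability at most `k ^ 2 / M`. -/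
theorem card_not_injective_le (k : ℕ) {M : ℕ} (hM : 1 ≤ M) :
    (1 / (M : ℝ) ^ k) *
      (Finset.univ.filter fun w : Fin k → Fin M => ¬ Function.Injective w).card ≤ k ^ 2 / M := by
  classical
  have hM0 : (0 : ℝ) < M := by exact_mod_cast hM
  have hcompl : (Finset.univ.filter fun w : Fin k → Fin M => ¬ Function.Injective w).card
      + M.descFactorial k = M ^ k := by
    have h1 : (Finset.univ.filter fun w : Fin k → Fin M => Function.Injective w).card
        = M.descFactorial k := by
      rw [← Fintype.card_subtype, Fintype.card_congr (Equiv.subtypeInjectiveEquivEmbedding _ _),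
        Fintype.card_embedding_eq]
      simp
    have h2 := Finset.card_filter_add_card_filter_not (s := (Finset.univ : Finset (Fin k → Fin M)))
      (fun w => Function.Injective w)
    rw [h1, Finset.card_univ, Fintype.card_fun, Fintype.card_fin, Fintype.card_fin] at h2
    omega
  have hc : ((Finset.univ.filter fun w : Fin k → Fin M => ¬ Function.Injective w).card : ℝ)
      = (M : ℝ) ^ k - M.descFactorial k := by
    rw [eq_sub_iff_add_eq]
    exact_mod_cast hcompl
  have hMk : (0 : ℝ) < (M : ℝ) ^ k := pow_pos hM0 k
  rw [hc, one_div, inv_mul_eq_div, sub_div, div_self hMk.ne']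
  rcases le_or_gt k M with hkM | hkM
  · have h1 : ((M : ℝ) - k) ^ k ≤ M.descFactorial k := by
      have h2 : (M + 1 - k) ^ k ≤ M.descFactorial k := Nat.pow_sub_le_descFactorial M k
      have h3 : ((M : ℝ) + 1 - k) ^ k ≤ M.descFactorial k := by
        have : ((M + 1 - k : ℕ) : ℝ) = (M : ℝ) + 1 - k := by
          rw [Nat.cast_sub (by omega)]; push_cast; ring
        rw [← this]
        exact_mod_cast h2
      have h4 : (0 : ℝ) ≤ (M : ℝ) - k := by
        rw [sub_nonneg]; exact_mod_cast hkM
      exact (pow_le_pow_left₀ h4 (by linarith) k).trans h3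
    have h2 : 1 + k * (-((k : ℝ) / M)) ≤ (1 + -((k : ℝ) / M)) ^ k := by
      refine one_add_mul_le_pow ?_ k
      have : (k : ℝ) / M ≤ 1 := by
        rw [div_le_one hM0]; exact_mod_cast hkM
      linarith
    have h3 : (1 + -((k : ℝ) / M)) ^ k = ((M : ℝ) - k) ^ k / (M : ℝ) ^ k := by
      rw [← div_pow, sub_div, div_self hM0.ne']; ring_nf
    have h4 : ((M : ℝ) - k) ^ k / (M : ℝ) ^ k ≤ M.descFactorial k / (M : ℝ) ^ k := by gcongr
    have h5 : (k : ℝ) * (-((k : ℝ) / M)) = -((k : ℝ) ^ 2 / M) := by ring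
    linarith
  · have h1 : (1 : ℝ) ≤ k ^ 2 / M := by
      rw [le_div_iff₀ hM0]
      have : (M : ℝ) ≤ k := by exact_mod_cast hkM.le
      have h1 : (1 : ℝ) ≤ M := by exact_mod_cast hM
      nlinarith
    have : (0 : ℝ) ≤ M.descFactorial k / (M : ℝ) ^ k := by positivity
    linarith

namespace RAC

variable {X Y : Type*} [MeasurableSpace X] [MeasurableSpace Y] [StandardBorelSpace Y]
variable (R : RAC X Y) (P : Measure X) [IsProbabilityMeasure P] (K : ℕ)

omit [IsProbabilityMeasure P] in
theorem lt_sum_infoDensity_iff {k m : ℕ} {g : ℝ} (hg : 0 < g) (x : Fin m → Fin k → X)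
    (y : Fin m → Y) : ((Real.log g : ℝ) : EReal) < ∑ i, R.infoDensity P K k k (x i) (y i) ↔
      ENNReal.ofReal g < ∏ i, R.dens P K k k (x i) (y i) := by
  have h : ∀ s : Finset (Fin m), ∑ i ∈ s, R.infoDensity P K k k (x i) (y i)
      = ENNReal.log (∏ i ∈ s, R.dens P K k k (x i) (y i)) := by
    classical
    intro s
    induction s using Finset.induction_on with
    | empty => simp
    | insert i s hi ih =>
      rw [Finset.sum_insert hi, Finset.prod_insert hi, ENNReal.log_mul_add, ih, infoDensity_eq]
  rw [h, ← ENNReal.log_ofReal_of_pos hg, ENNReal.log_lt_log_iff]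

variable (n : ℕ → ℕ) (γ : ℕ → ℝ) (A : (m : ℕ) → Set (Fin m → Y)) {M : ℕ}
  (hn : StrictMonoOn n (Set.Iic K))

omit [IsProbabilityMeasure P] in
include hn in
theorem n_le_of_le {s t : ℕ} (hst : s ≤ t) (ht : t ≤ K) : n s ≤ n t :=
  hn.monotoneOn (hst.trans ht) ht hst

/-- The average error probability of the codebook `x` when `k` transmitters are active. -/
def codebookError {k : ℕ} (hk : k ≤ K) (x : Fin (n K) → Fin M → X) : ℝ :=
  (1 / (M : ℝ) ^ k) * ∑ w : Fin k → Fin M,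
    (Measure.pi fun i : Fin (n k) => R.W k (x (Fin.castLE (n_le_of_le K n hn hk le_rfl) i) ∘ w)).real
      {y | (fun i => (x (Fin.castLE (n_le_of_le K n hn hk le_rfl) i), y i)) ∈
        R.errorSet P K n γ A k (fun _ ht => n_le_of_le K n hn ht.le hk) w}

variable {A} (hA : ∀ m, MeasurableSet (A m))
include hA

theorem measurable_codebookError {k : ℕ} (hk : k ≤ K) :
    Measurable (R.codebookError P K n γ A hn hk : (Fin (n K) → Fin M → X) → ℝ) := by
  refine measurable_const.mul (Finset.measurable_sum _ fun w _ => ?_)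
  exact (measurable_pi_channel ((R.W k).comap (fun ξ : Fin M → X => ξ ∘ w)
    (measurable_pi_lambda _ fun _ => measurable_pi_apply _))
    (Fin.castLE (n_le_of_le K n hn hk le_rfl)) (R.measurableSet_errorSet P K n γ hA k
      (fun _ ht => n_le_of_le K n hn ht.le hk) w)).ennreal_toReal

omit hA in
theorem codebookError_nonneg {k : ℕ} (hk : k ≤ K) (x : Fin (n K) → Fin M → X) :
    0 ≤ R.codebookError P K n γ A hn hk x := by
  unfold codebookError
  positivity

omit hA in
theorem codebookError_le_one {k : ℕ} (hk : k ≤ K) (x : Fin (n K) → Fin M → X) :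
    R.codebookError P K n γ A hn hk x ≤ 1 := by
  unfold codebookError
  calc _ ≤ (1 / (M : ℝ) ^ k) * ∑ w : Fin k → Fin M, 1 := by
        gcongr
        exact measureReal_le_one
    _ = (1 / (M : ℝ) ^ k) * (M : ℝ) ^ k := by simp
    _ ≤ 1 := by rw [one_div]; exact inv_mul_le_one

theorem integrable_codebookError {k : ℕ} (hk : k ≤ K) :
    Integrable (R.codebookError P K n γ A hn hk : (Fin (n K) → Fin M → X) → ℝ)
      (Measure.pi fun _ => inputLaw P M) := by
  refine Integrable.of_bound (R.measurable_codebookError P K n γ hn hA hk).aestronglyMeasurable 1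
    (Filter.Eventually.of_forall fun x => ?_)
  rw [Real.norm_of_nonneg (R.codebookError_nonneg P K n γ hn hk x)]
  exact R.codebookError_le_one P K n γ hn hk x

theorem integral_codebookError_le {k : ℕ} (hk : k ≤ K) (hM : 1 ≤ M) {B : ℝ} (hB0 : 0 ≤ B)
    (hB : ∀ w : Fin k → Fin M, Function.Injective w →
      (Measure.pi fun _ : Fin (n k) => R.letterLaw P w).real
        (R.errorSet P K n γ A k (fun _ ht => n_le_of_le K n hn ht.le hk) w) ≤ B) :
    ∫ x, R.codebookError P K n γ A hn hk x ∂(Measure.pi fun _ : Fin (n K) => inputLaw P M)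
      ≤ k ^ 2 / M + B := by
  classical
  have hM0 : (0 : ℝ) < M := by exact_mod_cast hM
  have hterm : ∀ w : Fin k → Fin M, ∫ x : Fin (n K) → Fin M → X,
      (Measure.pi fun i : Fin (n k) => R.W k (x (Fin.castLE (n_le_of_le K n hn hk le_rfl) i) ∘ w)).real
      {y | (fun i => (x (Fin.castLE (n_le_of_le K n hn hk le_rfl) i), y i)) ∈
        R.errorSet P K n γ A k (fun _ ht => n_le_of_le K n hn ht.le hk) w}
      ∂(Measure.pi fun _ : Fin (n K) => inputLaw P M)
      = (Measure.pi fun _ : Fin (n k) => R.letterLaw P w).real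
        (R.errorSet P K n γ A k (fun _ ht => n_le_of_le K n hn ht.le hk) w) ∧
      Integrable (fun x : Fin (n K) → Fin M → X =>
      (Measure.pi fun i : Fin (n k) => R.W k (x (Fin.castLE (n_le_of_le K n hn hk le_rfl) i) ∘ w)).real
      {y | (fun i => (x (Fin.castLE (n_le_of_le K n hn hk le_rfl) i), y i)) ∈
        R.errorSet P K n γ A k (fun _ ht => n_le_of_le K n hn ht.le hk) w})
      (Measure.pi fun _ : Fin (n K) => inputLaw P M) := by
    intro w
    have hS := R.measurableSet_errorSet P K n γ hA k
      (fun _ ht => n_le_of_le K n hn ht.le hk) w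
    have hm := measurable_pi_channel ((R.W k).comap (fun ξ : Fin M → X => ξ ∘ w)
      (measurable_pi_lambda _ fun _ => measurable_pi_apply _))
      (Fin.castLE (n_le_of_le K n hn hk le_rfl)) hS
    have h := lintegral_pi_channel (inputLaw P M) ((R.W k).comap (fun ξ : Fin M → X => ξ ∘ w)
      (measurable_pi_lambda _ fun _ => measurable_pi_apply _))
      (Fin.castLE_injective (n_le_of_le K n hn hk le_rfl)) hS
    constructor
    · exact (integral_toReal hm.aemeasurable (Filter.Eventually.of_forall fun x =>
        measure_lt_top _ _)).trans (congrArg ENNReal.toReal h)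
    · refine Integrable.of_bound hm.ennreal_toReal.aestronglyMeasurable 1
        (Filter.Eventually.of_forall fun x => ?_)
      rw [Real.norm_of_nonneg measureReal_nonneg]
      exact measureReal_le_one
  unfold codebookError
  rw [integral_const_mul, integral_finsetSum _ fun w _ => (hterm w).2,
    Finset.sum_congr rfl fun w _ => (hterm w).1,
    ← Finset.sum_filter_add_sum_filter_not Finset.univ
      (fun w : Fin k → Fin M => ¬ Function.Injective w), mul_add]
  refine add_le_add ?_ ?_
  · refine le_trans ?_ (card_not_injective_le k hM)
    gcongr
    refine (Finset.sum_le_sum fun w _ => measureReal_le_one).trans ?_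
    simp
  · calc _ ≤ (1 / (M : ℝ) ^ k) * ∑ w : Fin k → Fin M, B := by
          gcongr
          refine (Finset.sum_le_sum fun w hw => hB w (not_not.1 (Finset.mem_filter.1 hw).2)).trans ?_
          exact Finset.sum_le_sum_of_subset_of_nonneg (Finset.filter_subset _ _)
            fun _ _ _ => hB0
      _ = B := by
          rw [Finset.sum_const, Finset.card_univ, nsmul_eq_mul]
          have : (M : ℝ) ^ k ≠ 0 := (pow_pos hM0 k).ne'
          simp [this]

omit hA in
/-- Without active transmitters the code plays no role. -/
theorem codebookError_zero_le (x : Fin (n K) → Fin M → X) :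
    R.codebookError P K n γ A hn (Nat.zero_le K) x
      ≤ (Measure.pi fun _ : Fin (n 0) => R.outLaw P 0).real (A (n 0))ᶜ := by
  have h0 : ∀ x : Fin 0 → X, R.W 0 x = R.outLaw P 0 := fun x => by
    unfold outLaw inputLaw
    rw [Measure.pi_of_empty _ x, Measure.dirac_bind (R.W 0).measurable]
  unfold codebookError
  rw [pow_zero, div_one, one_mul, Fintype.sum_unique]
  simp_rw [h0]
  refine measureReal_mono fun y hy hyA => ?_
  rcases hy with hy | ⟨t, ht, -⟩
  · rcases hd : R.decodeLetters P K n γ A 0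
      (fun i => (x (Fin.castLE (n_le_of_le K n hn (Nat.zero_le K) le_rfl) i), y i)) with _ | w
    · exact selectWord_none hd default ((goodWord_zero R P K n γ A _ _).2 hyA)
    · exact hy ⟨1, hd.trans (congrArg some (Subsingleton.elim _ _))⟩
  · exact absurd ht (Nat.not_lt_zero t)

/-- The code with `N` codebooks chosen at random. -/
theorem exists_code_of_codebooks {N : ℕ} (hN : N ≤ K + 1) (z : Fin N → Fin (n K) → Fin M → X)
    {p : Fin N → ℝ} (hp : ∀ i, 0 ≤ p i) (hp1 : ∑ i, p i = 1) {ε : ℕ → ℝ}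
    (hγ : ∀ k, 1 ≤ k → k ≤ K → 0 < γ k)
    (hε : ∀ (k : ℕ) (hk : k ≤ K), ∑ i, p i * R.codebookError P K n γ A hn hk (z i) ≤ ε k) :
    ∃ c : RACCode X Y K M n, c.Achieves R ε ∧ c.IsSingleThreshold R P := by
  classical
  let c : RACCode X Y K M n :=
    { U := Fin N
      card_le := by simpa using hN
      pU := PMF.ofFintype (fun i => ENNReal.ofReal (p i)) (by
        rw [← ENNReal.ofReal_sum_of_nonneg fun i _ => hp i, hp1, ENNReal.ofReal_one])
      n_mono := hn
      enc := fun u m i => z u i m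
      dec := fun k u y => if hk : k ≤ K then R.decodeLetters P K n γ A k
        (fun i => (z u (Fin.castLE (n_le_of_le K n hn hk le_rfl) i), y i)) else none
      dec_meas := fun k hk u v => by
        simp only [hk, dite_true]
        exact (by fun_prop : Measurable fun (y : Fin (n k) → Y) (i : Fin (n k)) =>
          (z u (Fin.castLE (n_le_of_le K n hn hk le_rfl) i), y i))
          (R.measurableSet_decodeLetters P K n γ hA k {v}) }
  have hdec : ∀ (k : ℕ) (hk : k ≤ K) (u : Fin N) (y : Fin (n k) → Y), c.dec k u y
      = R.decodeLetters P K n γ A k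
        (fun i => (z u (Fin.castLE (n_le_of_le K n hn hk le_rfl) i), y i)) := fun k hk u y =>
    dif_pos hk
  refine ⟨c, fun k hk => ?_, γ, fun k hk h1 => ⟨hγ k h1 hk, fun u y => ⟨fun w hw => ?_, fun h w hw => ?_⟩⟩⟩
  · have hev : ∀ (u : Fin N) (w : Fin k → Fin M), c.errorEvent hk u w
        = {y | (fun i => (z u (Fin.castLE (n_le_of_le K n hn hk le_rfl) i), y i)) ∈
        R.errorSet P K n γ A k (fun _ ht => n_le_of_le K n hn ht.le hk) w} := fun u w => by
      ext y
      refine or_congr ?_ (exists_congr fun t => exists_congr fun ht => ?_)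
      · rw [hdec k hk u y]
      · rw [hdec t (ht.le.trans hk) u]
        rfl
    refine le_trans (le_of_eq ?_) (hε k hk)
    have hpU : ∀ u : Fin N, (c.pU u).toReal = p u := fun u => ENNReal.toReal_ofReal (hp u)
    change (1 / (M : ℝ) ^ k) * ∑ w : Fin k → Fin M, ∑ u : Fin N,
      (c.pU u).toReal * (c.output R hk u w).real (c.errorEvent hk u w) = _
    simp_rw [hpU, hev]
    rw [Finset.sum_comm, Finset.mul_sum]
    refine Finset.sum_congr rfl fun u _ => ?_
    rw [codebookError, ← Finset.mul_sum]
    ring_nf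
    rfl
  · rw [hdec k hk] at hw
    have h := (goodWord_iff R P K n γ A (by omega) _ _).1 (selectWord_some hw)
    exact ⟨h.1, (R.lt_sum_infoDensity_iff P K (hγ k h1 hk) _ _).2 h.2⟩
  · rw [hdec k hk] at h
    refine selectWord_none h w ((goodWord_iff R P K n γ A (by omega) _ _).2 ⟨hw.1, ?_⟩)
    exact (R.lt_sum_infoDensity_iff P K (hγ k h1 hk) _ _).1 hw.2

/-- Random coding: bounds for the error probabilities averaged over codebooks are attained, for all
numbers of active transmitters at once, by a mixture of `K + 1` codebooks. -/
theorem exists_code {ε : ℕ → ℝ} (hγ : ∀ k, 1 ≤ k → k ≤ K → 0 < γ k)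
    (h0 : (Measure.pi fun _ : Fin (n 0) => R.outLaw P 0).real (A (n 0))ᶜ ≤ ε 0)
    (hε : ∀ (k : ℕ) (_ : 1 ≤ k) (hk : k ≤ K),
      ∫ x, R.codebookError P K n γ A hn hk x ∂(Measure.pi fun _ : Fin (n K) => inputLaw P M)
        < ε k) :
    ∃ c : RACCode X Y K M n, c.Achieves R ε ∧ c.IsSingleThreshold R P := by
  obtain ⟨N, hN, z, p, hp, hp1, h⟩ := exists_mixture_lt
    (Measure.pi fun _ : Fin (n K) => inputLaw P M) (d := K)
    (f := fun x k => R.codebookError P K n γ A hn (k := k.1 + 1) k.2 x)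
    (fun k => R.integrable_codebookError P K n γ hn hA k.2) (ε := fun k => ε (k.1 + 1))
    (fun k => hε _ (Nat.le_add_left 1 _) k.2)
  refine R.exists_code_of_codebooks P K n γ hn hA hN z hp hp1 hγ fun k hk => ?_
  rcases Nat.eq_zero_or_pos k with rfl | hk0
  · calc ∑ i, p i * R.codebookError P K n γ A hn hk (z i)
        ≤ ∑ i, p i * ε 0 := Finset.sum_le_sum fun i _ => mul_le_mul_of_nonneg_left
          ((R.codebookError_zero_le P K n γ hn (z i)).trans h0) (hp i)
      _ = ε 0 := by rw [← Finset.sum_mul, hp1, one_mul]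
  · obtain ⟨k, rfl⟩ : ∃ l, k = l + 1 := ⟨k - 1, by omega⟩
    exact (h ⟨k, hk⟩).le

end RAC

end

/-! ### Second-order asymptotics -/

noncomputable section

open Filter in
theorem eventually_mul_sqrt_add_le {a : ℝ} (ha : 0 < a) (b d : ℝ) :
    ∀ᶠ L : ℝ in atTop, b * √L + d ≤ a * L := by
  filter_upwards [eventually_ge_atTop 1, eventually_ge_atTop ((2 * b / a) ^ 2),
    eventually_ge_atTop (2 * d / a)] with L h1 h2 h3
  have hs : √L * √L = L := Real.mul_self_sqrt (by linarith)
  have hb : 2 * b / a ≤ √L := by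
    refine (le_abs_self _).trans ?_
    rw [← Real.sqrt_sq_eq_abs]
    exact Real.sqrt_le_sqrt h2
  rw [div_le_iff₀ ha] at hb h3
  have := Real.sqrt_nonneg L
  nlinarith

open Filter in
/-- What holds for large `n` holds for all `n ≥ L / D`, if `L` is large. -/
theorem eventually_forall_le_mul {p : ℕ → Prop} (hp : ∀ᶠ n in atTop, p n) {D : ℝ} (hD : 0 ≤ D) :
    ∀ᶠ L : ℝ in atTop, ∀ n : ℕ, L ≤ D * n → p n := by
  obtain ⟨N, hN⟩ := eventually_atTop.1 hp
  filter_upwards [eventually_gt_atTop (D * N)] with L hL n hn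
  refine hN n ?_
  by_contra h
  push Not at h
  have : (n : ℝ) ≤ N := by exact_mod_cast h.le
  have := mul_le_mul_of_nonneg_left this hD
  linarith

theorem half_log_le_sqrt {x : ℝ} (hx : 0 ≤ x) : 1 / 2 * Real.log x ≤ √x := by
  rcases hx.eq_or_lt with rfl | h
  · simp
  have h1 := Real.log_le_sub_one_of_pos (Real.sqrt_pos.2 h)
  rw [Real.log_sqrt hx] at h1
  linarith

theorem memLp_two_of_variance_pos {Ω : Type*} [MeasurableSpace Ω] {J : Measure Ω}
    [IsProbabilityMeasure J] {f : Ω → ℝ} (hf : Measurable f) (hV : 0 < variance f J) :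
    MemLp f 2 J := by
  exact memLp_two_of_variance_ne_zero hf.aestronglyMeasurable hV.ne'

/-- A block length at which the second-order expansion reaches `κ L` is at least of order `L`. -/
theorem le_mul_of_le_second_order {I V q A κ L : ℝ} (hA : 0 ≤ A) (hκ : 1 ≤ κ)
    (hL : 0 < L) {n : ℕ} (h : κ * L ≤ n * I - √(n * V) * q - 1 / 2 * Real.log n - A) :
    1 ≤ n ∧ L ≤ (I + √V * |q|) * n := by
  have h1 : L ≤ κ * L := le_mul_of_one_le_left hL.le hκ
  have hn : 1 ≤ n := by
    by_contra hn
    have : n = 0 := by omega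
    subst this
    simp at h
    linarith
  have hn' : (1 : ℝ) ≤ n := by exact_mod_cast hn
  refine ⟨hn, ?_⟩
  have hlog : 0 ≤ Real.log n := Real.log_nonneg hn'
  have hs : √(n : ℝ) ≤ n := by
    rw [Real.sqrt_le_left (by linarith)]
    nlinarith
  have e : √(n * V) = √n * √V := Real.sqrt_mul (by linarith) V
  have h2 : -(√(n * V) * q) ≤ n * (√V * |q|) := by
    rw [e]
    calc -(√n * √V * q) = √n * (√V * (-q)) := by ring
      _ ≤ √n * (√V * |q|) := by
          gcongr
          exact neg_le_abs q
      _ ≤ n * (√V * |q|) := by gcongr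
  linarith

open Filter in
/-- A threshold `b` for the information density at block length `n` whose miss probability leaves a
slack of order `L^(-1/2)`.  At block lengths comparable with `L` it is at the second-order value, by
the Berry–Esseen theorem; at much larger ones, a multiple of `√n` below the mean. -/
theorem exists_threshold {Ω : Type*} [MeasurableSpace Ω] (J : Measure Ω) [IsProbabilityMeasure J]
    {f : Ω → ℝ} (hf : Measurable f) (hI : 0 < ∫ x, f x ∂J) (hV : 0 < variance f J)
    (h3 : Integrable (fun ω => |f ω - ∫ x, f x ∂J| ^ 3) J) {κ : ℝ} (hκ : 1 ≤ κ) {ε : ℝ}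
    (h0 : 0 < ε) (h1 : ε < 1) {β : ℝ} (hβ : 0 ≤ β) :
    ∃ A T : ℝ, 0 ≤ A ∧ 0 ≤ T ∧ ∀ᶠ L : ℝ in atTop, ∀ n : ℕ,
      κ * L ≤ n * (∫ x, f x ∂J) - √(n * variance f J) * gaussianQInv ε - 1 / 2 * Real.log n - A →
      ∃ b : ℝ, (Measure.pi fun _ : Fin n => J).real {ω | ∑ i, f (ω i) ≤ b} ≤ ε - β / √L ∧
        κ * L + 1 / 2 * Real.log n ≤ b ∧ n * (∫ x, f x ∂J) - T * √n ≤ b := by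
  obtain ⟨B, hB0, hB⟩ := berry_esseen J hf hV h3
  have hL2 := memLp_two_of_variance_pos hf hV
  set I := ∫ x, f x ∂J with hId
  set V := variance f J with hVd
  set q := gaussianQInv ε with hq
  have hsV : 0 < √V := Real.sqrt_pos.2 hV
  set g := stdPhi (|q| + 1) with hg
  have hg0 : 0 < g := by rw [hg, stdPhi]; positivity
  -- block lengths up to `D₂ L` are comparable with `L`
  set D₂ := 4 * κ / I with hD₂
  have hD₂0 : 0 < D₂ := by positivity
  set A := √V * (B + β * √D₂) / g with hAd
  have hA0 : 0 ≤ A := by positivity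
  set T₁ := √(2 * V / ε) with hT₁
  have hT₁0 : 0 < T₁ := Real.sqrt_pos.2 (by positivity)
  set D := I + √V * |q| with hD
  have hD0 : 0 ≤ D := by positivity
  refine ⟨A, √V * |q| + A + T₁, hA0, by positivity, ?_⟩
  have hp1 : ∀ᶠ n : ℕ in atTop, A ≤ √(n * V) := by
    filter_upwards [eventually_ge_atTop ⌈A ^ 2 / V⌉₊] with n hn
    refine Real.le_sqrt_of_sq_le ?_
    rw [← div_le_iff₀ hV]
    exact (Nat.le_ceil _).trans (by exact_mod_cast hn)
  have hp2 : ∀ᶠ n : ℕ in atTop, (T₁ + 1) * √(n : ℝ) + 0 ≤ I / 2 * n :=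
    tendsto_natCast_atTop_atTop.eventually (eventually_mul_sqrt_add_le (by positivity) _ _)
  filter_upwards [eventually_forall_le_mul hp1 hD0, eventually_forall_le_mul hp2 hD0,
    eventually_gt_atTop 0, eventually_ge_atTop ((2 * β / ε) ^ 2)] with L hLA hLT hL0 hLβ n hn
  obtain ⟨hn1, hLn⟩ := le_mul_of_le_second_order hA0 hκ hL0 hn
  have hn' : (1 : ℝ) ≤ n := by exact_mod_cast hn1
  have hn0 : (0 : ℝ) < n := by linarith
  have hsn : 0 < √(n : ℝ) := Real.sqrt_pos.2 hn0
  have hsn1 : 1 ≤ √(n : ℝ) := Real.one_le_sqrt.2 hn'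
  have hsL : 0 < √L := Real.sqrt_pos.2 hL0
  have e : √(n * V) = √n * √V := Real.sqrt_mul hn0.le V
  by_cases hcase : (n : ℝ) ≤ D₂ * L
  · refine ⟨n * I - √(n * V) * q - A, ?_, by linarith, ?_⟩
    · have hS : 0 < √(n * V) := Real.sqrt_pos.2 (by positivity)
      have h := hB n hn1 (-q - A / √(n * V))
      have e1 : n * I + √(n * V) * (-q - A / √(n * V)) = n * I - √(n * V) * q - A := by
        field_simp
        ring
      rw [e1] at h
      have h2 := stdCDF_sub_le_sub_mul q (h := A / √(n * V)) (by positivity)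
        ((div_le_one hS).2 (hLA n hLn))
      rw [stdCDF_neg_gaussianQInv h0 h1] at h2
      have h4 := (abs_le.1 h).2
      have e2 : g * (A / √(n * V)) = (B + β * √D₂) * (√n)⁻¹ := by
        rw [hAd, e]
        field_simp
      have h5 : β / √L ≤ β * √D₂ * (√n)⁻¹ := by
        rw [mul_assoc, div_eq_mul_inv]
        refine mul_le_mul_of_nonneg_left ?_ hβ
        rw [← div_eq_mul_inv, le_div_iff₀ hsn, inv_mul_le_iff₀ hsL, mul_comm, ← Real.sqrt_mul hD₂0.le]
        exact Real.sqrt_le_sqrt hcase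
      have h6 : (Measure.pi fun _ : Fin n => J).real
          {ω | ∑ i, f (ω i) ≤ n * I - √(n * V) * q - A}
          ≤ stdCDF (-q - A / √(n * V)) + B * (√n)⁻¹ := by linarith
      rw [e2] at h2
      nlinarith
    · rw [e]
      have a1 : √n * √V * q ≤ √n * (√V * |q|) := by
        rw [mul_assoc]
        gcongr
        exact le_abs_self q
      have a2 : A ≤ A * √n := le_mul_of_one_le_right hA0 hsn1
      nlinarith [mul_pos hT₁0 hsn]
  · push Not at hcase
    refine ⟨n * I - √n * T₁, ?_, ?_, ?_⟩
    · have hch := pi_chebyshev J hL2 n (c := √n * T₁) (by positivity)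
      have e1 : n * V / (√n * T₁) ^ 2 = ε / 2 := by
        rw [mul_pow, Real.sq_sqrt hn0.le, hT₁, Real.sq_sqrt (by positivity)]
        field_simp
      rw [e1] at hch
      have hsub : {ω : Fin n → Ω | ∑ i, f (ω i) ≤ n * I - √n * T₁}
          ⊆ {ω | √n * T₁ ≤ |∑ i, f (ω i) - n * I|} := by
        intro ω hω
        have hω' : ∑ i, f (ω i) ≤ n * I - √n * T₁ := hω
        change √n * T₁ ≤ |∑ i, f (ω i) - n * I|
        refine le_trans ?_ (neg_le_abs _)
        linarith
      have h2 : β / √L ≤ ε / 2 := by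
        rw [div_le_iff₀ hsL]
        have : 2 * β / ε ≤ √L := Real.le_sqrt_of_sq_le hLβ
        rw [div_le_iff₀ h0] at this
        linarith
      linarith [measureReal_mono hsub (μ := Measure.pi fun _ : Fin n => J)]
    · have h2 := hLT n hLn
      have h4 := half_log_le_sqrt hn0.le
      have h5 : κ * L ≤ I / 4 * n := by
        rw [hD₂, div_mul_eq_mul_div, div_lt_iff₀ hI] at hcase
        linarith
      have h6 : 0 ≤ I / 4 * n := by positivity
      linarith
    · have : 0 ≤ (√V * |q| + A) * √n := by positivity
      linarith

/-- The contribution of `s` shared messages to the union bound is `O(n^(-1/2))`.  The share `1 - s / t`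
of the threshold `b` makes up for the number of message vectors, by the first bound for `b`, and the
share `s / t` for the density of the shared messages, by the second one. -/
theorem count_mul_exp_le {s t k M n : ℕ} (hst : s ≤ t) (ht : 1 ≤ t) (hM : 1 ≤ M) (hn : 1 ≤ n)
    {N : ℕ} (hN : N * M ^ s ≤ ((k + 1) * M) ^ t) {I T c b : ℝ}
    (hb : t * Real.log M + 1 / 2 * Real.log n ≤ b) (hb' : n * I - T * √n ≤ b)
    (hs0 : s = 0 → c ≤ 0) (hs : 1 ≤ s → (1 + T) * √n ≤ (s / t * I - c) * n) (hT : 0 ≤ T) :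
    N * (Real.exp (n * c) / Real.exp b) ≤ (k + 1) ^ t / √n := by
  have hM0 : (0 : ℝ) < M := by exact_mod_cast hM
  have ht0 : (0 : ℝ) < t := by exact_mod_cast ht
  have hn0 : (0 : ℝ) < n := by exact_mod_cast hn
  have hN' : (N : ℝ) ≤ (k + 1) ^ t * Real.exp ((t - s) * Real.log M) := by
    have h1 : (N : ℝ) * M ^ s ≤ (k + 1) ^ t * M ^ t := by
      rw [← mul_pow]; exact_mod_cast hN
    have h2 : Real.exp ((t - s) * Real.log M) * (M : ℝ) ^ s = (M : ℝ) ^ t := by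
      rw [sub_mul, Real.exp_sub, mul_comm (t : ℝ), mul_comm (s : ℝ), Real.exp_mul, Real.exp_mul,
        Real.exp_log hM0, Real.rpow_natCast, Real.rpow_natCast]
      field_simp
    have h3 : (N : ℝ) * M ^ s ≤ ((k + 1) ^ t * Real.exp ((t - s) * Real.log M)) * M ^ s := by
      rw [mul_assoc, h2]; exact h1
    exact le_of_mul_le_mul_right h3 (pow_pos hM0 s)
  have hexp : (t - s) * Real.log M + n * c - b ≤ -(1 / 2 * Real.log n) := by
    rcases Nat.eq_zero_or_pos s with rfl | hs1
    · have := mul_nonpos_of_nonneg_of_nonpos hn0.le (hs0 rfl)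
      push_cast
      linarith
    · have h1 := hs hs1
      have hlog := half_log_le_sqrt hn0.le
      have hst' : (s : ℝ) / t ≤ 1 := by
        rw [div_le_one ht0]; exact_mod_cast hst
      have hs0' : 0 ≤ (s : ℝ) / t := by positivity
      set ρ := (s : ℝ) / t with hρ
      have e : (t : ℝ) - s = t * (1 - ρ) := by rw [hρ]; field_simp
      have h2 : (t - s) * Real.log M ≤ (1 - ρ) * (b - 1 / 2 * Real.log n) := by
        rw [e, mul_comm (t : ℝ), mul_assoc]
        exact mul_le_mul_of_nonneg_left (by linarith) (by linarith)
      have h3 : ρ * (n * I - T * √n) ≤ ρ * b := mul_le_mul_of_nonneg_left hb' hs0'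
      have h4 : ρ * (1 / 2 * Real.log n) ≤ √n := by
        refine (mul_le_mul_of_nonneg_left hlog hs0').trans ?_
        exact mul_le_of_le_one_left (Real.sqrt_nonneg _) hst'
      have h5 : ρ * (T * √n) ≤ T * √n := mul_le_of_le_one_left (by positivity) hst'
      nlinarith
  have hsq : Real.exp (-(1 / 2 * Real.log n)) = (√n)⁻¹ := by
    rw [Real.exp_neg, mul_comm, Real.exp_mul, Real.exp_log hn0, Real.sqrt_eq_rpow]
  calc N * (Real.exp (n * c) / Real.exp b)
      ≤ ((k + 1) ^ t * Real.exp ((t - s) * Real.log M)) * (Real.exp (n * c) / Real.exp b) := by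
        gcongr
    _ = (k + 1) ^ t * Real.exp ((t - s) * Real.log M + n * c - b) := by
        rw [Real.exp_sub, Real.exp_add]; ring
    _ ≤ (k + 1) ^ t * Real.exp (-(1 / 2 * Real.log n)) := by gcongr
    _ = _ := by rw [hsq, div_eq_mul_inv]

end

/-! ### Error probability of the random code -/

noncomputable section

namespace RAC

variable {X Y : Type*} [MeasurableSpace X] [MeasurableSpace Y]
variable [StandardBorelSpace Y] {R : RAC X Y} {P : Measure X} [IsProbabilityMeasure P] {K : ℕ}

theorem measurable_sumDensity (k : ℕ) : Measurable (R.sumDensity P K k) := by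
  have : R.sumDensity P K k = fun p => Real.log (Function.uncurry (R.dens P K k k) p).toReal :=
    funext fun p => sumDensity_eq p
  rw [this]
  exact (R.measurable_dens P K k k).ennreal_toReal.log

variable (hmom : R.MomentConditions P K)
include hmom

theorem ae_dens_ne_zero_ne_top {k : ℕ} (h1 : 1 ≤ k) (hk : k ≤ K) :
    ∀ᵐ p ∂(inputLaw P k ⊗ₘ R.W k), R.dens P K k k p.1 p.2 ≠ 0 ∧ R.dens P K k k p.1 p.2 ≠ ∞ := by
  have hD := R.measurable_dens P K k k
  have hJ := joint_eq_withDensity_pi hmom h1 hk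
  have h0 := ae_margDensity_ne_zero hD hJ Finset.univ
  have h2 := (joint_absolutelyContinuous hD hJ).ae_le (ae_margDensity_ne_top hD hJ Finset.univ)
  filter_upwards [h0, h2] with p hp0 hp2
  rw [margDensity_univ] at hp0 hp2
  exact ⟨hp0, hp2⟩

theorem measure_prod_dens_le {k : ℕ} (h1 : 1 ≤ k) (hk : k ≤ K) (m : ℕ) (b : ℝ) :
    (Measure.pi fun _ : Fin m => inputLaw P k ⊗ₘ R.W k)
        {ω | ∏ i, R.dens P K k k (ω i).1 (ω i).2 ≤ ENNReal.ofReal (Real.exp b)}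
      ≤ (Measure.pi fun _ : Fin m => inputLaw P k ⊗ₘ R.W k)
        {ω | ∑ i, R.sumDensity P K k (ω i) ≤ b} := by
  refine measure_mono_ae ?_
  have h := ae_all_iff.2 fun i : Fin m => (measurePreserving_eval
    (fun _ : Fin m => inputLaw P k ⊗ₘ R.W k) i).quasiMeasurePreserving.ae
      (ae_dens_ne_zero_ne_top hmom h1 hk)
  filter_upwards [h] with ω hω hle
  have hle : ∏ i, R.dens P K k k (ω i).1 (ω i).2 ≤ ENNReal.ofReal (Real.exp b) := hle
  have hpos : ∀ i, (R.dens P K k k (ω i).1 (ω i).2).toReal ≠ 0 := fun i =>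
    (ENNReal.toReal_pos (hω i).1 (hω i).2).ne'
  have h2 := ENNReal.toReal_mono ENNReal.ofReal_ne_top hle
  rw [ENNReal.toReal_prod, ENNReal.toReal_ofReal (Real.exp_pos b).le] at h2
  change ∑ i, R.sumDensity P K k (ω i) ≤ b
  simp_rw [sumDensity_eq]
  rw [← Real.log_prod fun i _ => hpos i, Real.log_le_iff_le_exp
    (Finset.prod_pos fun i _ => (hpos i).symm.lt_of_le ENNReal.toReal_nonneg)]
  exact h2

theorem ae_headDens_zero_le_one {t k : ℕ} (h1 : 1 ≤ t) (htk : t ≤ k) (hk : k ≤ K) :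
    ∀ᵐ p ∂(R.headLaw P 0 k), R.headDens P K 0 t p.1 p.2 ≤ 1 := by
  rw [headLaw_eq_withDensity hmom (h1.trans htk) hk (Nat.zero_le k)]
  refine (withDensity_absolutelyContinuous _ _).ae_le ?_
  filter_upwards [(Measure.quasiMeasurePreserving_snd (μ := inputLaw P 0)).ae
    (lintegral_headDens_le_one hmom (s := 0) h1 (htk.trans hk) hk)] with p hp
  rw [lintegral_unique, measure_univ, mul_one] at hp
  rwa [Subsingleton.elim p.1 default]

/-- Tail constants for `s` shared messages among `t` decoded ones.  Without shared messages the
density never exceeds one. -/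
theorem exists_tail_constants [StandardBorelSpace X] [Zero X] (hperm : R.PermutationInvariant K)
    (hred : R.Reducible K) (hfr : R.Friendly P K) (hinterf : R.Interfering P K) {s t k : ℕ}
    (ht : 1 ≤ t) (hst : s ≤ t) (htk : t ≤ k) (hk : k ≤ K) (hsk : s < k) :
    ∃ c G : ℝ, (s = 0 → c ≤ 0) ∧ (1 ≤ s → c < s / t * R.I P K t) ∧ 0 ≤ G ∧ ∀ n : ℕ, 1 ≤ n →
      (Measure.pi fun _ : Fin n => R.headLaw P s k).real
        {ω | ENNReal.ofReal (Real.exp (n * c)) < ∏ i, R.headDens P K s t (ω i).1 (ω i).2}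
        ≤ G / √n := by
  rcases Nat.eq_zero_or_pos s with rfl | hs
  · refine ⟨0, 0, fun _ => le_rfl, fun h => absurd h (by omega), le_rfl, fun n _ => ?_⟩
    rw [zero_div, measureReal_def]
    refine (ENNReal.toReal_eq_zero_iff _ |>.2 (Or.inl ?_)).le
    refine measure_eq_zero_iff_ae_notMem.2 ?_
    have h := ae_all_iff.2 fun i : Fin n => (measurePreserving_eval
      (fun _ : Fin n => R.headLaw P 0 k) i).quasiMeasurePreserving.ae
        (ae_headDens_zero_le_one hmom ht htk hk)
    filter_upwards [h] with ω hω hlt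
    have hlt : ENNReal.ofReal (Real.exp (n * 0)) < ∏ i, R.headDens P K 0 t (ω i).1 (ω i).2 := hlt
    simp only [mul_zero, Real.exp_zero, ENNReal.ofReal_one] at hlt
    exact absurd (Finset.prod_le_one' fun i _ => hω i) (not_le.2 hlt)
  · obtain ⟨c, hc, G, hG, h⟩ := exists_headDens_tail_bound hmom hperm hred hfr hinterf hs hst htk hk hsk
    exact ⟨c, G, fun h0 => absurd h0 (by omega), fun _ => hc, hG, h⟩

/-- The error probability of the random code: apart from missing the activity and from the threshold
being too high for the transmitted messages, it is `O(n^(-1/2))`, with constants that do not depend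
on how far the thresholds are below the mean. -/
theorem exists_measure_errorSet_le [StandardBorelSpace X] [Zero X] (hperm : R.PermutationInvariant K)
    (hred : R.Reducible K) (hfr : R.Friendly P K) (hinterf : R.Interfering P K) {k : ℕ}
    (h1 : 1 ≤ k) (hk : k ≤ K) :
    ∃ G : ℝ, 0 ≤ G ∧ ∀ T : ℕ → ℝ, (∀ t, 1 ≤ t → t ≤ k → 0 ≤ T t) → ∃ N : ℕ,
      ∀ (n : ℕ → ℕ) (hn : ∀ t < k, n t ≤ n k) (b : ℕ → ℝ) (A : (m : ℕ) → Set (Fin m → Y)) (M : ℕ)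
        (w : Fin k → Fin M), (∀ m, MeasurableSet (A m)) → Function.Injective w →
        (∀ t, 1 ≤ t → t ≤ k → N ≤ n t ∧ t * Real.log M + 1 / 2 * Real.log (n t) ≤ b t ∧
          n t * R.I P K t - T t * √(n t) ≤ b t) →
        (Measure.pi fun _ : Fin (n k) => R.letterLaw P w).real
          (R.errorSet P K n (fun t => Real.exp (b t)) A k hn w)
        ≤ (Measure.pi fun _ : Fin (n 0) => R.outLaw P k).real (A (n 0))
          + (Measure.pi fun _ : Fin (n k) => inputLaw P k ⊗ₘ R.W k).real
            {ω | ∑ i, R.sumDensity P K k (ω i) ≤ b k}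
          + ∑ t ∈ Finset.Icc 1 k, G / √(n t) := by
  classical
  set F : ℕ → Finset ℕ := fun t => (Finset.range (t + 1)).filter (· < k) with hF
  have hex : ∀ t ∈ Finset.Icc 1 k, ∀ s ∈ F t, ∃ c G : ℝ,
      (s = 0 → c ≤ 0) ∧ (1 ≤ s → c < s / t * R.I P K t) ∧ 0 ≤ G ∧ ∀ n : ℕ, 1 ≤ n →
      (Measure.pi fun _ : Fin n => R.headLaw P s k).real
        {ω | ENNReal.ofReal (Real.exp (n * c)) < ∏ i, R.headDens P K s t (ω i).1 (ω i).2}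
        ≤ G / √n := by
    intro t ht s hs
    rw [Finset.mem_Icc] at ht
    rw [hF, Finset.mem_filter, Finset.mem_range] at hs
    exact exists_tail_constants hmom hperm hred hfr hinterf ht.1
      (Nat.lt_succ_iff.1 hs.1) ht.2 hk hs.2
  choose! c G hcG using hex
  set g : ℕ → ℕ → ℝ := fun t s => k ^ s * G t s + (k + 1) ^ t with hg
  have hg0 : ∀ t ∈ Finset.Icc 1 k, ∀ s ∈ F t, 0 ≤ g t s := fun t ht s hs => by
    have := (hcG t ht s hs).2.2.1
    positivity
  refine ⟨∑ t ∈ Finset.Icc 1 k, ∑ s ∈ F t, g t s,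
    Finset.sum_nonneg fun t ht => Finset.sum_nonneg (hg0 t ht), fun T hT => ?_⟩
  have hev : ∀ᶠ N : ℕ in Filter.atTop, ∀ t ∈ Finset.Icc 1 k, ∀ s ∈ F t, 1 ≤ s → ∀ n : ℕ, N ≤ n →
      (1 + T t) * √(n : ℝ) ≤ (s / t * R.I P K t - c t s) * n := by
    rw [Filter.eventually_all_finset]
    intro t ht
    rw [Filter.eventually_all_finset]
    intro s hs
    by_cases h : 1 ≤ s
    · have h2 := tendsto_natCast_atTop_atTop.eventually
        (eventually_mul_sqrt_add_le (sub_pos.2 ((hcG t ht s hs).2.1 h)) (1 + T t) 0)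
      filter_upwards [Filter.eventually_forall_ge_atTop.2 h2] with N hN _ n hn
      simpa using hN n hn
    · exact Filter.Eventually.of_forall fun N h' => absurd h' h
  obtain ⟨N, hN, hN1⟩ := (hev.and (Filter.eventually_ge_atTop 1)).exists
  refine ⟨N, fun n hn b A M w hA hw hb => ?_⟩
  have hM : 1 ≤ M := by
    have := (w ⟨0, h1⟩).pos
    omega
  have hmain := measure_errorSet_le (R := R) (P := P) (K := K) (n := n) (γ := fun t => Real.exp (b t)) hA hmom h1 hk hperm hn
    (fun t _ _ => Real.exp_pos _) hw (a := fun t s => ENNReal.ofReal (Real.exp (n t * c t s)))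
    (fun t s => ENNReal.ofReal_ne_top)
  have hterm : ∀ t ∈ Finset.Icc 1 k, ∀ s ∈ F t,
      (k : ℝ≥0∞) ^ s * (Measure.pi fun _ : Fin (n t) => R.headLaw P s k)
            {ω | ENNReal.ofReal (Real.exp (n t * c t s))
              < ∏ i, R.headDens P K s t (ω i).1 (ω i).2}
          + (Finset.univ.filter fun w' : Fin t → Fin M =>
            (Finset.univ.filter fun j => w' j ∈ Set.range w).card = s).card
              * (ENNReal.ofReal (Real.exp (n t * c t s)) / ENNReal.ofReal (Real.exp (b t)))
        ≤ ENNReal.ofReal (g t s / √(n t)) := by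
    intro t ht s hs
    obtain ⟨hc0, hc1, hG0, hG⟩ := hcG t ht s hs
    have ht' := Finset.mem_Icc.1 ht
    have hs' := Finset.mem_filter.1 hs
    obtain ⟨hNn, hb1, hb2⟩ := hb t ht'.1 ht'.2
    have hst : s ≤ t := Nat.lt_succ_iff.1 (Finset.mem_range.1 hs'.1)
    have hn1 : 1 ≤ n t := hN1.trans hNn
    have hcount := count_mul_exp_le hst ht'.1 hM hn1 (card_shared_mul_pow_le (t := t) w s) hb1 hb2 hc0
      (fun h => hN t ht s hs h (n t) hNn) (hT t ht'.1 ht'.2)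
    have htail := hG (n t) hn1
    rw [← ENNReal.ofReal_div_of_pos (Real.exp_pos _),
      ← ofReal_measureReal (μ := Measure.pi fun _ : Fin (n t) => R.headLaw P s k)
        (measure_ne_top _ _),
      ← ENNReal.ofReal_natCast, ← ENNReal.ofReal_natCast, ← ENNReal.ofReal_pow (Nat.cast_nonneg _),
      ← ENNReal.ofReal_mul (by positivity), ← ENNReal.ofReal_mul (by positivity),
      ← ENNReal.ofReal_add (by positivity) (by positivity)]
    refine ENNReal.ofReal_le_ofReal ?_
    rw [hg, add_div, mul_div_assoc]
    exact add_le_add (mul_le_mul_of_nonneg_left htail (by positivity)) hcount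
  have hnonneg : ∀ t ∈ Finset.Icc 1 k,
      0 ≤ (∑ t ∈ Finset.Icc 1 k, ∑ s ∈ F t, g t s) / √(n t) := fun t _ =>
    div_nonneg (Finset.sum_nonneg fun t ht => Finset.sum_nonneg (hg0 t ht)) (Real.sqrt_nonneg _)
  refine ENNReal.toReal_le_of_le_ofReal
    (add_nonneg (add_nonneg measureReal_nonneg measureReal_nonneg) (Finset.sum_nonneg hnonneg))
    (hmain.trans ?_)
  rw [ENNReal.ofReal_add (add_nonneg measureReal_nonneg measureReal_nonneg)
      (Finset.sum_nonneg hnonneg),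
    ENNReal.ofReal_add measureReal_nonneg measureReal_nonneg,
    ofReal_measureReal, ofReal_measureReal, ENNReal.ofReal_sum_of_nonneg hnonneg]
  refine add_le_add (add_le_add le_rfl (measure_prod_dens_le hmom h1 hk _ _)) ?_
  refine Finset.sum_le_sum fun t ht => (Finset.sum_le_sum (hterm t ht)).trans ?_
  rw [← ENNReal.ofReal_sum_of_nonneg fun s hs => div_nonneg (hg0 t ht s hs) (Real.sqrt_nonneg _),
    ← Finset.sum_div]
  refine ENNReal.ofReal_le_ofReal (div_le_div_of_nonneg_right ?_ (Real.sqrt_nonneg _))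
  exact Finset.single_le_sum (f := fun t => ∑ s ∈ F t, g t s)
    (fun t ht => Finset.sum_nonneg (hg0 t ht)) ht

end RAC

end

/-! ### Achievability -/

noncomputable section

namespace RAC

variable {X Y : Type*} [MeasurableSpace X] [MeasurableSpace Y]
variable [StandardBorelSpace Y] {R : RAC X Y} {P : Measure X} [IsProbabilityMeasure P] {K : ℕ}
  (hmom : R.MomentConditions P K)
include hmom

/-- Block lengths allowed by the second-order condition for `M` messages are at least of order
`log M`. -/
theorem exists_forall_le_mul_of_second_order (hperm : R.PermutationInvariant K) (ε : ℕ → ℝ) :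
    ∃ D : ℝ, 0 ≤ D ∧ ∀ A L : ℝ, 0 ≤ A → 0 < L → ∀ k m : ℕ, 1 ≤ k → k ≤ K →
      L ≤ 1 / (k : ℝ) * (secondOrder R P K k m (ε k) - A) → 1 ≤ m ∧ L ≤ D * m := by
  have hD : ∀ k ∈ Finset.Icc 1 K, 0 ≤ R.I P K k + √(R.V P K k) * |gaussianQInv (ε k)| := by
    intro k hk
    rw [Finset.mem_Icc] at hk
    have := (I_pos hmom hk.1 hk.2 hperm).le
    positivity
  refine ⟨∑ k ∈ Finset.Icc 1 K, (R.I P K k + √(R.V P K k) * |gaussianQInv (ε k)|),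
    Finset.sum_nonneg hD, fun A L hA hL k m h1 hk h => ?_⟩
  have hk0 : (0 : ℝ) < k := by exact_mod_cast h1
  rw [one_div, le_inv_mul_iff₀ hk0] at h
  obtain ⟨h2, h3⟩ := le_mul_of_le_second_order hA (by exact_mod_cast h1) hL h
  refine ⟨h2, h3.trans (mul_le_mul_of_nonneg_right ?_ (Nat.cast_nonneg m))⟩
  exact Finset.single_le_sum hD (Finset.mem_Icc.2 ⟨h1, hk⟩)

/-- Achievability at all block lengths that satisfy the second-order conditions. -/
theorem exists_code_of_le_secondOrder [StandardBorelSpace X] [Zero X] {φ : Y → ℝ} (hφ : Measurable φ)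
    (hperm : R.PermutationInvariant K) (hred : R.Reducible K) (hfr : R.Friendly P K)
    (hinterf : R.Interfering P K) (hKS : R.KSSeparated P φ K) (hK : 1 ≤ K) :
    ∃ C : ℝ, 0 < C ∧ ∀ ε : ℕ → ℝ, (∀ k ≤ K, 0 < ε k ∧ ε k < 1) → ∃ A : ℝ, 0 ≤ A ∧
      ∀ᶠ M : ℕ in Filter.atTop, ∀ n : ℕ → ℕ, StrictMonoOn n (Set.Iic K) →
        (∀ k, 1 ≤ k → k ≤ K →
          Real.log M ≤ 1 / (k : ℝ) * (secondOrder R P K k (n k) (ε k) - A)) →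
        C * Real.log (n 1) ≤ n 0 →
        ∃ c : RACCode X Y K M n, c.Achieves R ε ∧ c.IsSingleThreshold R P := by
  obtain ⟨δ, hδ, hsep⟩ := hKS
  obtain ⟨c, hc, htest⟩ := exists_separating_test hφ (fun k => R.outLaw P k) K hδ hsep
  choose S hS hS0 hSk using htest
  refine ⟨1 / (2 * c), by positivity, fun ε hε => ?_⟩
  obtain ⟨D, hD, hLD⟩ := exists_forall_le_mul_of_second_order hmom hperm ε
  choose! G hG0 hG using fun k (h1 : 1 ≤ k) (hk : k ≤ K) =>
    exists_measure_errorSet_le hmom hperm hred hfr hinterf h1 hk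
  -- all errors other than a miss of the transmitted messages are less than `β k / √(log M)`
  set β : ℕ → ℝ := fun k => 2 * √D + k ^ 2 + k * (|G k| * √D) + 1 with hβ
  choose! A T hA hT hAT using fun k (h1 : 1 ≤ k) (hk : k ≤ K) =>
    exists_threshold (inputLaw P k ⊗ₘ R.W k)
      (measurable_sumDensity (R := R) (P := P) (K := K) k) (I_pos hmom h1 hk hperm)
      (hmom.var_pos k h1 hk) (hmom.third_moment k h1 hk) (κ := k) (by exact_mod_cast h1)
      (hε k hk).1 (hε k hk).2 (β := β k) (by positivity)
  have hA' : ∀ k ∈ Finset.Icc 1 K, 0 ≤ A k := fun k hk =>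
    hA k (Finset.mem_Icc.1 hk).1 (Finset.mem_Icc.1 hk).2
  refine ⟨∑ k ∈ Finset.Icc 1 K, A k, Finset.sum_nonneg hA', ?_⟩
  choose! N hN using fun k (h1 : 1 ≤ k) (hk : k ≤ K) =>
    hG k h1 hk T fun t ht htk => hT t ht (htk.trans hk)
  have hlog : Filter.Tendsto (fun M : ℕ => Real.log M) Filter.atTop Filter.atTop :=
    Real.tendsto_log_atTop.comp tendsto_natCast_atTop_atTop
  have hATev : ∀ᶠ L : ℝ in Filter.atTop, ∀ k ∈ Finset.Icc 1 K, ∀ n : ℕ,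
      k * L ≤ secondOrder R P K k n (ε k) - A k →
      ∃ b : ℝ, (Measure.pi fun _ : Fin n => inputLaw P k ⊗ₘ R.W k).real
          {ω | ∑ i, R.sumDensity P K k (ω i) ≤ b} ≤ ε k - β k / √L ∧
        k * L + 1 / 2 * Real.log n ≤ b ∧ n * R.I P K k - T k * √n ≤ b := by
    rw [Filter.eventually_all_finset]
    intro k hk
    rw [Finset.mem_Icc] at hk
    exact hAT k hk.1 hk.2
  have hε0 := (hε 0 (Nat.zero_le K)).1
  filter_upwards [hlog.eventually hATev, hlog.eventually (Filter.eventually_ge_atTop 1),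
    hlog.eventually (eventually_forall_le_mul (Filter.eventually_ge_atTop (∑ k ∈ Finset.Icc 1 K, N k)) hD),
    hlog.eventually (Filter.eventually_ge_atTop ((2 * K * √D / ε 0) ^ 2)),
    Filter.eventually_ge_atTop 1] with M hM1 hL1 hM2 hM3 hM n hn hsec hn0
  set L := Real.log M with hL
  have hL0 : 0 < L := by linarith
  have hsL : 0 < √L := Real.sqrt_pos.2 hL0
  have hlen : ∀ k, 1 ≤ k → k ≤ K → 1 ≤ n k ∧ ∑ k ∈ Finset.Icc 1 K, N k ≤ n k ∧ 1 / √(n k) ≤ √D / √L := by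
    intro k h1 hk
    obtain ⟨h2, h3⟩ := hLD _ L (Finset.sum_nonneg hA') hL0 k (n k) h1 hk (hsec k h1 hk)
    refine ⟨h2, hM2 _ h3, ?_⟩
    have h4 : (0 : ℝ) < n k := by exact_mod_cast h2
    rw [div_le_div_iff₀ (Real.sqrt_pos.2 h4) hsL, one_mul, ← Real.sqrt_mul hD]
    exact Real.sqrt_le_sqrt h3
  have hb : ∀ k, 1 ≤ k → k ≤ K → ∃ b : ℝ, (Measure.pi fun _ : Fin (n k) =>
        inputLaw P k ⊗ₘ R.W k).real {ω | ∑ i, R.sumDensity P K k (ω i) ≤ b} ≤ ε k - β k / √L ∧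
        k * L + 1 / 2 * Real.log (n k) ≤ b ∧ n k * R.I P K k - T k * √(n k) ≤ b := by
    intro k h1 hk
    have hk0 : (0 : ℝ) < k := by exact_mod_cast h1
    have h2 := hsec k h1 hk
    rw [one_div, le_inv_mul_iff₀ hk0] at h2
    have h3 := Finset.single_le_sum hA' (Finset.mem_Icc.2 ⟨h1, hk⟩)
    exact hM1 k (Finset.mem_Icc.2 ⟨h1, hk⟩) (n k) (h2.trans (by linarith))
  choose! b hb using hb
  have hmiss : Real.exp (-c * n 0) ≤ √D / √L := by
    obtain ⟨h2, -, h3⟩ := hlen 1 le_rfl hK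
    have h4 : (0 : ℝ) < n 1 := by exact_mod_cast h2
    refine le_trans ?_ h3
    have h5 : 1 / √(n 1 : ℝ) = Real.exp (-(1 / 2 * Real.log (n 1))) := by
      rw [Real.exp_neg, mul_comm, Real.exp_mul, Real.exp_log h4, Real.sqrt_eq_rpow, one_div]
    rw [h5, Real.exp_le_exp]
    have h6 := mul_le_mul_of_nonneg_left hn0 hc.le
    have h7 : c * (1 / (2 * c) * Real.log (n 1)) = 1 / 2 * Real.log (n 1) := by field_simp
    linarith
  refine R.exists_code P K n (fun t => Real.exp (b t)) hn hS (fun _ _ _ => Real.exp_pos _) ?_ ?_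
  · refine (hS0 (n 0)).trans ?_
    have h2 : 2 * K * √D / ε 0 ≤ √L := Real.le_sqrt_of_sq_le hM3
    rw [div_le_iff₀ hε0] at h2
    calc 2 * K * Real.exp (-c * n 0) ≤ 2 * K * (√D / √L) := by gcongr
      _ ≤ ε 0 := by
        rw [← mul_div_assoc, div_le_iff₀ hsL]
        linarith
  · intro k h1 hk
    obtain ⟨hb1, -, -⟩ := hb k h1 hk
    have hG0 := hG0 k h1 hk
    have hB0 : 0 ≤ 2 * (√D / √L) + (ε k - β k / √L) + k * (G k * (√D / √L)) := by
      have := measureReal_nonneg.trans hb1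
      positivity
    refine (R.integral_codebookError_le P K n _ hn hS hk hM hB0 fun w hw => ?_).trans_lt ?_
    · refine (hN k h1 hk n _ b S M w hS hw fun t ht htk =>
        ⟨(Finset.single_le_sum (fun _ _ => Nat.zero_le _) (Finset.mem_Icc.2 ⟨h1, hk⟩)).trans
          (hlen t ht (htk.trans hk)).2.1, (hb t ht (htk.trans hk)).2⟩).trans ?_
      refine add_le_add (add_le_add ?_ hb1) ?_
      · exact (hSk (n 0) k h1 hk).trans (by gcongr)
      · calc ∑ t ∈ Finset.Icc 1 k, G k / √(n t) ≤ ∑ t ∈ Finset.Icc 1 k, G k * (√D / √L) := by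
              refine Finset.sum_le_sum fun t ht => ?_
              rw [Finset.mem_Icc] at ht
              rw [div_eq_mul_one_div]
              exact mul_le_mul_of_nonneg_left (hlen t ht.1 (ht.2.trans hk)).2.2 hG0
          _ = _ := by simp
    · have hML : √L ≤ M := by
        have h2 : L ≤ M := (Real.log_le_sub_one_of_pos (by exact_mod_cast hM)).trans (by linarith)
        refine le_trans ?_ h2
        rw [Real.sqrt_le_left hL0.le]
        nlinarith
      have h2 : (k : ℝ) ^ 2 / M ≤ k ^ 2 / √L := by gcongr
      have h3 : (k : ℝ) ^ 2 / √L + (2 * (√D / √L) + (ε k - β k / √L) + k * (G k * (√D / √L)))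
          = ε k - 1 / √L := by
        simp only [hβ, abs_of_nonneg hG0]
        field_simp
        ring
      have h4 : 0 < 1 / √L := by positivity
      linarith

end RAC

end

/-! ### Decoding times -/

noncomputable section

open Filter in
/-- The least block lengths at which a second-order expansion reaches `κ L`, with their growth. -/
theorem exists_least_length {I V q A κ : ℝ} (hI : 0 < I) (hA : 0 ≤ A) (hκ : 1 ≤ κ) :
    ∃ N : ℝ → ℕ,
      (∀ L, 0 < L → κ * L ≤ N L * I - √(N L * V) * q - 1 / 2 * Real.log (N L) - A ∧
        N L * I - √(N L * V) * q - 1 / 2 * Real.log (N L) - (A + (I + √V * |q|)) ≤ κ * L) ∧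
      (∀ ρ, κ / I < ρ → ∀ᶠ L in atTop, N L ≤ ρ * L) ∧
      ∀ ρ, 0 ≤ ρ → ρ < κ / I → ∀ᶠ L in atTop, ρ * L < N L := by
  classical
  have hs : ∀ n : ℕ, √(n * V) = √n * √V := fun n => Real.sqrt_mul (Nat.cast_nonneg n) V
  have hlow : ∀ n : ℕ, n * I - (√V * |q| + 1) * √n
      ≤ n * I - √(n * V) * q - 1 / 2 * Real.log n := by
    intro n
    have h1 := half_log_le_sqrt (Nat.cast_nonneg (α := ℝ) n)
    have h2 : √(n * V) * q ≤ √V * |q| * √n := by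
      rw [hs, mul_comm (√(n : ℝ)), mul_right_comm]
      gcongr
      exact le_abs_self q
    linarith
  have hup : ∀ n : ℕ, n * I - √(n * V) * q - 1 / 2 * Real.log n ≤ n * I + √V * |q| * √n := by
    intro n
    have h1 := Real.log_natCast_nonneg n
    have h2 : -(√(n * V) * q) ≤ √V * |q| * √n := by
      calc -(√(n * V) * q) = √V * -q * √n := by rw [hs]; ring
        _ ≤ √V * |q| * √n := by
          gcongr
          exact neg_le_abs q
    linarith
  have hex : ∀ L : ℝ, ∃ n : ℕ, κ * L ≤ n * I - √(n * V) * q - 1 / 2 * Real.log n - A := by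
    intro L
    obtain ⟨n, hn⟩ := (tendsto_natCast_atTop_atTop.eventually
      (eventually_mul_sqrt_add_le hI (√V * |q| + 1) (κ * L + A))).exists
    exact ⟨n, by linarith [hlow n]⟩
  refine ⟨fun L => Nat.find (hex L), fun L hL => ⟨Nat.find_spec (hex L), ?_⟩, fun ρ hρ => ?_,
    fun ρ hρ0 hρ => ?_⟩
  · obtain ⟨h1, -⟩ := le_mul_of_le_second_order hA hκ hL (Nat.find_spec (hex L))
    obtain ⟨m, hm⟩ : ∃ m, Nat.find (hex L) = m + 1 := ⟨_, (Nat.sub_add_cancel h1).symm⟩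
    have hmin := not_le.1 (Nat.find_min (hex L) (m := m) (by omega))
    beta_reduce
    rw [hm]
    have hsq : √((m + 1 : ℕ) : ℝ) ≤ √m + 1 := by
      rw [Real.sqrt_le_left (by positivity)]
      have := Real.mul_self_sqrt (Nat.cast_nonneg (α := ℝ) m)
      have := Real.sqrt_nonneg (m : ℝ)
      push_cast
      nlinarith
    have hsq' : √(m : ℝ) ≤ √((m + 1 : ℕ) : ℝ) := Real.sqrt_le_sqrt (by push_cast; linarith)
    have hlog : Real.log m ≤ Real.log (m + 1 : ℕ) := by
      rcases Nat.eq_zero_or_pos m with rfl | h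
      · simp
      · exact Real.log_le_log (by exact_mod_cast h) (by push_cast; linarith)
    have h2 : -((√((m + 1 : ℕ) : ℝ) - √m) * (√V * q)) ≤ √V * |q| := by
      calc -((√((m + 1 : ℕ) : ℝ) - √m) * (√V * q))
          = (√((m + 1 : ℕ) : ℝ) - √m) * (√V * -q) := by ring
        _ ≤ (√((m + 1 : ℕ) : ℝ) - √m) * (√V * |q|) :=
            mul_le_mul_of_nonneg_left
              (mul_le_mul_of_nonneg_left (neg_le_abs q) (Real.sqrt_nonneg V)) (by linarith)
        _ ≤ 1 * (√V * |q|) := mul_le_mul_of_nonneg_right (by linarith) (by positivity)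
        _ = _ := one_mul _
    rw [hs] at hmin ⊢
    have h3 : ((m + 1 : ℕ) : ℝ) * I = m * I + I := by push_cast; ring
    rw [h3]
    nlinarith
  · rw [div_lt_iff₀ hI] at hρ
    have hρ0 : 0 < ρ := by
      by_contra h
      nlinarith [mul_nonneg (sub_nonneg.2 (not_lt.1 h)) hI.le]
    filter_upwards [eventually_mul_sqrt_add_le (sub_pos.2 hρ) ((√V * |q| + 1) * √ρ) (I + A),
      eventually_gt_atTop 0] with L hL hL0
    have hfl := Nat.floor_le (mul_pos hρ0 hL0).le
    refine le_trans ?_ hfl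
    have hm : κ * L ≤ (⌊ρ * L⌋₊ : ℝ) * I - √((⌊ρ * L⌋₊ : ℝ) * V) * q
        - 1 / 2 * Real.log (⌊ρ * L⌋₊ : ℝ) - A := by
      have h1 := hlow ⌊ρ * L⌋₊
      have h2 : √(⌊ρ * L⌋₊ : ℝ) ≤ √ρ * √L := by
        rw [← Real.sqrt_mul hρ0.le]
        exact Real.sqrt_le_sqrt hfl
      have h3 : (√V * |q| + 1) * √(⌊ρ * L⌋₊ : ℝ) ≤ (√V * |q| + 1) * (√ρ * √L) := by gcongr
      have h4 := mul_le_mul_of_nonneg_right (Nat.lt_floor_add_one (ρ * L)).le hI.le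
      linarith
    exact_mod_cast Nat.find_min' (hex L) hm
  · rw [lt_div_iff₀ hI] at hρ
    filter_upwards [eventually_mul_sqrt_add_le (sub_pos.2 hρ) (√V * |q| * √ρ) 1,
      eventually_gt_atTop 0] with L hL hL0
    by_contra hle
    push Not at hle
    have h0 := Nat.find_spec (hex L)
    set n := Nat.find (hex L)
    have h1 := hup n
    have h2 : √(n : ℝ) ≤ √ρ * √L := by
      rw [← Real.sqrt_mul hρ0]
      exact Real.sqrt_le_sqrt hle
    have h3 : √V * |q| * √(n : ℝ) ≤ √V * |q| * (√ρ * √L) := by gcongr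
    have h4 := mul_le_mul_of_nonneg_right hle hI.le
    linarith

namespace RAC

variable {X Y : Type*} [MeasurableSpace X] [MeasurableSpace Y]
variable [StandardBorelSpace Y] {R : RAC X Y} {P : Measure X} [IsProbabilityMeasure P] {K : ℕ}
  (hmom : R.MomentConditions P K)
include hmom

open Filter in
/-- The least block lengths allowed by the second-order conditions are increasing, because `I_k / k`
is strictly decreasing in `k`. -/
theorem exists_lengths [StandardBorelSpace X] [Zero X] (hperm : R.PermutationInvariant K)
    (hred : R.Reducible K) (hfr : R.Friendly P K) (hinterf : R.Interfering P K) (hK : 1 ≤ K)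
    (ε : ℕ → ℝ) (C : ℝ) (hC : 0 ≤ C) {A : ℝ} (hA : 0 ≤ A) :
    ∃ B : ℝ, ∀ᶠ L : ℝ in atTop, ∃ n : ℕ → ℕ, StrictMonoOn n (Set.Iic K) ∧
      n 0 = ⌈C * Real.log (n 1)⌉₊ ∧ ∀ k, 1 ≤ k → k ≤ K →
        L ≤ 1 / (k : ℝ) * (secondOrder R P K k (n k) (ε k) - A) ∧
        1 / (k : ℝ) * (secondOrder R P K k (n k) (ε k) - B) ≤ L := by
  choose! N hN hNup hNlow using fun k (h1 : 1 ≤ k) (hk : k ≤ K) =>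
    exists_least_length (V := R.V P K k) (q := gaussianQInv (ε k)) (κ := k) (I_pos hmom h1 hk hperm)
      hA (by exact_mod_cast h1)
  obtain ⟨D, hD, hLD⟩ := exists_forall_le_mul_of_second_order hmom hperm ε
  have hstep : ∀ k, 1 ≤ k → k + 1 ≤ K → ∀ᶠ L : ℝ in atTop, N k L < N (k + 1) L := by
    intro k h1 hk
    have hI1 := I_pos hmom h1 (by omega) hperm
    have hI2 := I_pos hmom (Nat.le_add_left 1 k) hk hperm
    have hlt := mul_I_lt hmom hperm hred hfr hinterf h1 (Nat.lt_succ_self k) hk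
    have hlt' : (k : ℝ) / R.I P K k < (k + 1 : ℕ) / R.I P K (k + 1) := by
      rwa [div_lt_div_iff₀ hI1 hI2]
    obtain ⟨ρ, hρ1, hρ2⟩ := exists_between hlt'
    have hρ0 : 0 ≤ ρ := le_trans (by positivity) hρ1.le
    filter_upwards [hNup k h1 (by omega) ρ hρ1, hNlow (k + 1) (by omega) hk ρ hρ0 hρ2] with L hL1 hL2
    exact_mod_cast hL1.trans_lt hL2
  have hstep' : ∀ᶠ L : ℝ in atTop, ∀ k ∈ Finset.Ico 1 K, N k L < N (k + 1) L := by
    rw [eventually_all_finset]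
    intro k hk
    rw [Finset.mem_Ico] at hk
    exact hstep k hk.1 hk.2
  have hzero : ∀ᶠ m : ℕ in atTop, ⌈C * Real.log m⌉₊ < m := by
    filter_upwards [tendsto_natCast_atTop_atTop.eventually
      (eventually_mul_sqrt_add_le one_pos (2 * C) 1)] with m hm
    have h1 := half_log_le_sqrt (Nat.cast_nonneg (α := ℝ) m)
    have h2 := Nat.ceil_lt_add_one (mul_nonneg hC (Real.log_natCast_nonneg m))
    have h3 := mul_le_mul_of_nonneg_left h1 hC
    have h4 : (⌈C * Real.log m⌉₊ : ℝ) < m := by linarith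
    exact_mod_cast h4
  have hB : ∀ k ∈ Finset.Icc 1 K, 0 ≤ R.I P K k + √(R.V P K k) * |gaussianQInv (ε k)| := by
    intro k hk
    rw [Finset.mem_Icc] at hk
    have := (I_pos hmom hk.1 hk.2 hperm).le
    positivity
  refine ⟨A + ∑ k ∈ Finset.Icc 1 K, (R.I P K k + √(R.V P K k) * |gaussianQInv (ε k)|), ?_⟩
  filter_upwards [hstep', eventually_gt_atTop 0, eventually_forall_le_mul hzero hD] with L hL hL0 hLz
  have hsec : ∀ k, 1 ≤ k → k ≤ K →
      L ≤ 1 / (k : ℝ) * (secondOrder R P K k (N k L) (ε k) - A) := by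
    intro k h1 hk
    have hk0 : (0 : ℝ) < k := by exact_mod_cast h1
    rw [one_div, le_inv_mul_iff₀ hk0]
    exact (hN k h1 hk L hL0).1
  obtain ⟨n, hn0, hn⟩ : ∃ n : ℕ → ℕ, n 0 = ⌈C * Real.log (N 1 L)⌉₊ ∧ ∀ k, 1 ≤ k → n k = N k L :=
    ⟨fun k => if k = 0 then ⌈C * Real.log (N 1 L)⌉₊ else N k L, if_pos rfl,
      fun k h1 => if_neg (by omega)⟩
  refine ⟨n, ?_, by rw [hn0, hn 1 le_rfl], fun k h1 hk => ?_⟩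
  · refine strictMonoOn_Iic_of_lt_succ fun k hk => ?_
    rw [Nat.succ_eq_succ, hn _ (Nat.succ_pos k)]
    rcases Nat.eq_zero_or_pos k with rfl | h1
    · rw [hn0]
      exact hLz _ (hLD A L hA hL0 1 _ le_rfl hK (hsec 1 le_rfl hK)).2
    · rw [hn k h1]
      exact hL k (Finset.mem_Ico.2 ⟨h1, hk⟩)
  · rw [hn k h1]
    refine ⟨hsec k h1 hk, ?_⟩
    have hk0 : (0 : ℝ) < k := by exact_mod_cast h1
    rw [one_div, inv_mul_le_iff₀ hk0]
    have h2 := (hN k h1 hk L hL0).2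
    have h3 := Finset.single_le_sum hB (Finset.mem_Icc.2 ⟨h1, hk⟩)
    unfold secondOrder
    linarith

end RAC

end

theorem theorem1 {X Y : Type*} [MeasurableSpace X] [StandardBorelSpace X] [Zero X]
    [MeasurableSpace Y] [StandardBorelSpace Y] (φ : Y → ℝ) (hφ : Measurable φ)
    (K : ℕ) (hK : 1 ≤ K) (R : RAC X Y)
    (hperm : R.PermutationInvariant K) (hred : R.Reducible K)
    (P : Measure X) [IsProbabilityMeasure P]
    (hfriendly : R.Friendly P K) (hinterf : R.Interfering P K)
    (hKS : R.KSSeparated P φ K) (hmom : R.MomentConditions P K) :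
    ∃ C : ℝ, 0 < C ∧ ∀ ε : ℕ → ℝ, (∀ k ≤ K, 0 < ε k ∧ ε k < 1) →
      ∃ (A B : ℝ) (r : ℕ → ℝ) (M₀ : ℕ),
        (r =o[Filter.atTop] fun m : ℕ => Real.log m) ∧
        ∀ M : ℕ, M₀ ≤ M →
          (∀ n : ℕ → ℕ, StrictMonoOn n (Set.Iic K) →
            (∀ k, 1 ≤ k → k ≤ K →
              Real.log M ≤ 1 / (k : ℝ) * (secondOrder R P K k (n k) (ε k) - A)) →
            C * Real.log (n 1) + r (n 1) ≤ n 0 →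
            ∃ c : RACCode X Y K M n, c.Achieves R ε ∧ c.IsSingleThreshold R P) ∧
          (∃ n : ℕ → ℕ, StrictMonoOn n (Set.Iic K) ∧
            n 0 = ⌈C * Real.log (n 1) + r (n 1)⌉₊ ∧
            ∀ k, 1 ≤ k → k ≤ K →
              Real.log M ≤ 1 / (k : ℝ) * (secondOrder R P K k (n k) (ε k) - A) ∧
              1 / (k : ℝ) * (secondOrder R P K k (n k) (ε k) - B) ≤ Real.log M) := by
  obtain ⟨C, hC, hcode⟩ := RAC.exists_code_of_le_secondOrder hmom hφ hperm hred hfriendly hinterf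
    hKS hK
  refine ⟨C, hC, fun ε hε => ?_⟩
  obtain ⟨A, hA, hcode⟩ := hcode ε hε
  obtain ⟨B, hlen⟩ := RAC.exists_lengths hmom hperm hred hfriendly hinterf hK ε C hC.le hA
  have hlog : Filter.Tendsto (fun M : ℕ => Real.log M) Filter.atTop Filter.atTop :=
    Real.tendsto_log_atTop.comp tendsto_natCast_atTop_atTop
  obtain ⟨M₀, hM₀⟩ := Filter.eventually_atTop.1 (hcode.and (hlog.eventually hlen))
  refine ⟨A, B, fun _ => 0, M₀, Asymptotics.isLittleO_zero _ _, fun M hM => ?_⟩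
  simp only [add_zero]
  exact hM₀ M hM
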